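/- **Setting.** Let $\varphi(z),\psi(z)\in\mathbb Z[z]$ be coprime monic polynomials of degree $22$ with $z^{22}\varphi(z^{-1})=-\varphi(z)$ and $z^{22}\psi(z^{-1})=\psi(z)$. Let $A=Z(\varphi)$, $B=Z(\psi)$ be their companion matrices and let $\mathbf r\in\mathbb Q^{22}$ be a nonzero vector with $C\mathbf r=-\mathbf r$, where $C=A^{-1}B$ (a reflection). The hypergeometric lattice is $L=L(\varphi,\psi)=\langle \mathbf r,A\mathbf r,\dots,A^{21}\mathbf r\rangle_{\mathbb Z}$ with the $\langle A,B\rangle$-invariant symmetric bilinear form given by $(A^{i-1}\mathbf r,A^{j-1}\mathbf r)=\xi_{|i-j|}$, where $\xi_0=2$ and $\psi(z)/\varphi(z)=1+\sum_{i\ge1}\xi_i z^{-i}$ around $z=\infty$. Renormalization means replacing the form by its negative when its index (signature difference) is positive, and keeping it otherwise. A K3 lattice is an even unimodular lattice of rank $22$ and signature $(3,19)$. A Hodge structure on it is an orthogonal decomposition (for the induced Hermitian form) $L\otimes\mathbb C=H^{2,0}\oplus H^{1,1}\oplus H^{0,2}$ of signatures $(1,0)\oplus(1,19)\oplus(1,0)$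 with $\overline{H^{i,j}}=H^{j,i}$. A Hodge isometry is a lattice automorphism $F$ preserving this decomposition; it is positive if it preserves each of the two connected components of $\{v\in H^{1,1}\cap (L\otimes\mathbb R):(v,v)>0\}$. It acts on $H^{2,0}$ by some $\delta$ with $|\delta|=1$ and on $H^{0,2}$ by $\delta^{-1}$, and $\tau(F)=\delta+\delta^{-1}$ is its special trace. It is of hyperbolic type if there is a real $\lambda>1$ such that $\lambda^{\pm1}$ are the only eigenvalues of $F$ outside the unit circle. The trace polynomials $\Phi,\Psi\in\mathbb Z[w]$, of degrees $10$ and $11$, are defined by $\varphi(z)=(z^2-1)z^{10}\Phi(z+z^{-1})$ and $\psi(z)=z^{11}\Psi(z+z^{-1})$. Let $\mathbf A_{\rm on}$, $\mathbf B_{\rm on}$ be the multisets of roots of $\Phi$, $\Psi$ in $[-2,2]$, and let $\mathbf B_{>2}$ be the multiset of roots of $\Psi$ in $(2,\infty)$; cardinalities count multiplicities. $\mathbf A_{\rm on}$ and $\mathbf B_{\rm on}$ dissect each other into clusters $-2\le\mathbf A_{s+1}<\mathbf B_s<\mathbf A_s<\dots<\mathbf B_1<\mathbf A_1\le2$, where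 only $\mathbf A_1$ and $\mathbf A_{s+1}$ may be empty; put $\mathbf A_{\rm in}=\mathbf A_2\cup\dots\cup\mathbf A_s$. The notation $[\,\cdot\,]=1^{\nu_1}2^{\nu_2}3^{\nu_3}$ means that there are exactly $\nu_j$ clusters with $j$ elements for each $j$, and no others. "Doubles adjacent" means that the unique double cluster $\mathbf A_i$ of $\mathbf A_{\rm in}$ and the unique double cluster $\mathbf B_j$ of $\mathbf B_{\rm on}$ are adjacent, that is, $i=j$ or $i=j+1$. **Theorem 1.3.** Let $L=L(\varphi,\psi)$ be a unimodular hypergeometric lattice of rank $22$. After renormalization, $L$ is a K3 lattice with a Hodge structure such that $B$ is a positive Hodge isometry, if and only if all roots of $\Psi$ are simple, $\Psi(\pm2)\ne0$, and the clusters satisfy one of the following nine sets of conditions: $$\begin{array}{c|c|c|c|c|c|l|l} \text{case}&s&[\mathbf A_{\rm in}]&[\mathbf B_{\rm on}]&|\mathbf A_{\rm in}|&|\mathbf B_{>2}|&\text{constraint}&\tau(B)\\\hline 1&8&1^7&1^73^1&7&1&&\text{middle of TC}\\ 2&8&1^63^1&1^73^1&9&1&&\text{middle of TC}\\ 3&9&1^72^1&1^82^1&9&1&\text{doubles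 adjacent}&\text{inner of AP}\\ 4&9&1^8&1^82^1&8&1&|\mathbf B_1|=2&\max\mathbf B_1\\ 5&9&1^8&1^82^1&8&1&|\mathbf B_9|=2&\min\mathbf B_9\\ 6&9&1^73^1&1^82^1&10&1&|\mathbf B_1|=2&\max\mathbf B_1\\ 7&9&1^73^1&1^82^1&10&1&|\mathbf B_9|=2&\min\mathbf B_9\\ 8&10&1^82^1&1^{10}&10&1&|\mathbf A_2|=2&\text{element of }\mathbf B_1\\ 9&10&1^82^1&1^{10}&10&1&|\mathbf A_{10}|=2&\text{element of }\mathbf B_{10} \end{array}$$ In this situation the special trace $\tau(B)$ and, up to complex conjugation (exchange of $H^{2,0}$ and $H^{0,2}$), the Hodge structure are uniquely determined by $(\varphi,\psi)$. The location of $\tau(B)$ is given in the last column, where "middle of TC" is the middle element of the unique triple cluster of $\mathbf B_{\rm on}$, and "inner of AP" is the one of the two middle elements $\lambda_2,\lambda_3$ of $\mathbf A_i\cup\mathbf B_j=\{\lambda_1\le\lambda_2\le\lambda_3\le\lambda_4\}$ that lies in $\mathbf B_j$, for the adjacent pair of double clusters $\mathbf A_i,\mathbf B_j$. Moreover, the Hodge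 isometry $B$ is always of hyperbolic type, and every root of $\Phi$ is simple except for at most one integer root of multiplicity $2$ or $3$. -/

import Mathlib

open Polynomial

namespace HypergeometricK3

/-! ### Hypergeometric pairs, groups and lattices -/

/-- `φ`, `ψ` is a coprime pair of monic integer polynomials of degree `2N`, `φ` anti-palindromic
(`z^{2N} φ(1/z) = -φ(z)`) and `ψ` palindromic (`z^{2N} ψ(1/z) = ψ(z)`). -/
structure IsHypergeometricPair (N : ℕ) (φ ψ : ℤ[X]) : Prop where
  monic_left : φ.Monic
  monic_right : ψ.Monic
  natDegree_left : φ.natDegree = 2 * N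
  natDegree_right : ψ.natDegree = 2 * N
  antipalindromic : φ.reflect (2 * N) = -φ
  palindromic : ψ.reflect (2 * N) = ψ
  coprime : IsCoprime (φ.map (Int.castRingHom ℚ)) (ψ.map (Int.castRingHom ℚ))

/-- The companion matrix `Z(f)` of a monic polynomial `f` of degree `n`: ones below the diagonal,
and last column `-f(0), …` (minus the coefficients of `z^0, …, z^{n-1}` from top to bottom). -/
def companion (n : ℕ) (f : ℤ[X]) : Matrix (Fin n) (Fin n) ℚ :=
  Matrix.of fun i j =>
    if (j : ℕ) + 1 = n then -(f.coeff i : ℚ) else if (i : ℕ) = (j : ℕ) + 1 then 1 else 0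

/-- `r` is a nonzero vector that the reflection `C = A⁻¹ B` sends to its negative, where
`A = Z(φ)` and `B = Z(ψ)`. -/
def IsReflectionVector (n : ℕ) (φ ψ : ℤ[X]) (r : Fin n → ℚ) : Prop :=
  r ≠ 0 ∧ ((companion n φ)⁻¹ * companion n ψ).mulVec r = -r

/-- The hypergeometric lattice `L = ⟨r, A r, …, A^{n-1} r⟩_ℤ`, `A = Z(φ)`, inside `ℚ^n`. -/
def lattice (n : ℕ) (φ : ℤ[X]) (r : Fin n → ℚ) : Submodule ℤ (Fin n → ℚ) :=
  Submodule.span ℤ (Set.range fun k : Fin n => (companion n φ ^ (k : ℕ)).mulVec r)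

/-- The numbers `ξ_i`: `ξ_0 = 2`, and `ψ(z)/φ(z) = 1 + ∑_{i ≥ 1} ξ_i z^{-i}` around `z = ∞`.
In terms of `u = 1/z` the quotient is `(u^n ψ(1/u)) / (u^n φ(1/u))`, a quotient of reversed
polynomials. -/
noncomputable def xi (φ ψ : ℤ[X]) (i : ℕ) : ℚ :=
  if i = 0 then 2
  else PowerSeries.coeff i
    (((ψ.reverse.map (Int.castRingHom ℚ) : ℚ[X]) : PowerSeries ℚ) *
      ((φ.reverse.map (Int.castRingHom ℚ) : ℚ[X]) : PowerSeries ℚ)⁻¹)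

/-- The matrix with columns `r, A r, …, A^{n-1} r` (the `A`-basis). -/
def basisMatrix (n : ℕ) (φ : ℤ[X]) (r : Fin n → ℚ) : Matrix (Fin n) (Fin n) ℚ :=
  Matrix.of fun i k => (companion n φ ^ (k : ℕ)).mulVec r i

/-- The invariant symmetric bilinear form with `(r, r) = 2`, written as a matrix with respect to
the standard basis of `ℚ^n`; with respect to the `A`-basis its Gram matrix is
`(A^{i-1} r, A^{j-1} r) = ξ_{|i-j|}`. -/
noncomputable def invariantForm (n : ℕ) (φ ψ : ℤ[X]) (r : Fin n → ℚ) :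
    Matrix (Fin n) (Fin n) ℚ :=
  ((basisMatrix n φ r)⁻¹).transpose *
    (Matrix.of fun i j : Fin n => xi φ ψ ((i : ℤ) - (j : ℤ)).natAbs) * (basisMatrix n φ r)⁻¹

/-- The lattice `L`, with the form given by `M`, is unimodular: it equals its dual lattice. -/
def IsUnimodular {n : ℕ} (L : Submodule ℤ (Fin n → ℚ)) (M : Matrix (Fin n) (Fin n) ℚ) : Prop :=
  LinearMap.BilinForm.dualSubmodule (Matrix.toBilin' M) L = L

/-! ### Signatures, renormalization and K3 lattices -/

/-- A rational matrix as a complex one. -/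
def toC {n : ℕ} (M : Matrix (Fin n) (Fin n) ℚ) : Matrix (Fin n) (Fin n) ℂ :=
  M.map fun q => (q : ℂ)

/-- The Hermitian form on `L ⊗ ℂ = ℂ^n` induced by the symmetric matrix `M`. -/
def hermForm {n : ℕ} (M : Matrix (Fin n) (Fin n) ℚ) (v w : Fin n → ℂ) : ℂ :=
  v ⬝ᵥ (toC M).mulVec (star w)

/-- The Hermitian form induced by `M` has signature `(p, q)` on the subspace `W` of `ℂ^n`
(and is nondegenerate there). For `W = ℂ^n` this is the signature of the real form `M`. -/
def HasSignature {n : ℕ} (M : Matrix (Fin n) (Fin n) ℚ) (W : Submodule ℂ (Fin n → ℂ))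
    (p q : ℕ) : Prop :=
  Module.finrank ℂ W = p + q ∧
  (∃ P ≤ W, Module.finrank ℂ P = p ∧ ∀ v ∈ P, v ≠ 0 → 0 < (hermForm M v v).re) ∧
  (∃ Q ≤ W, Module.finrank ℂ Q = q ∧ ∀ v ∈ Q, v ≠ 0 → (hermForm M v v).re < 0)

open Classical in
/-- Renormalization: the form is negated when its index `p - q` is positive, and kept otherwise. -/
noncomputable def renormalized {n : ℕ} (M : Matrix (Fin n) (Fin n) ℚ) :
    Matrix (Fin n) (Fin n) ℚ :=
  if ∃ p q : ℕ, HasSignature M ⊤ p q ∧ q < p then -M else M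

/-- The intersection form on the rank `22` hypergeometric lattice: the renormalized invariant
form. -/
noncomputable def intersectionForm (φ ψ : ℤ[X]) (r : Fin 22 → ℚ) :
    Matrix (Fin 22) (Fin 22) ℚ :=
  renormalized (invariantForm 22 φ ψ r)

/-- A K3 lattice: an even unimodular lattice of rank `22` and signature `(3, 19)`. -/
structure IsK3Lattice (L : Submodule ℤ (Fin 22 → ℚ)) (M : Matrix (Fin 22) (Fin 22) ℚ) :
    Prop where
  fg : L.FG
  full : Submodule.span ℚ (L : Set (Fin 22 → ℚ)) = ⊤
  rank : Module.finrank ℤ L = 22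
  symm : M.IsSymm
  even : ∀ v ∈ L, ∃ m : ℤ, v ⬝ᵥ M.mulVec v = 2 * (m : ℚ)
  unimodular : IsUnimodular L M
  signature : HasSignature M ⊤ 3 19

/-! ### Hodge structures and Hodge isometries -/

/-- A Hodge structure on a K3 lattice with form `M`: an orthogonal decomposition of `L ⊗ ℂ` of
signatures `(1, 0) ⊕ (1, 19) ⊕ (1, 0)` with `conj H^{i,j} = H^{j,i}`. -/
structure HodgeStructure (M : Matrix (Fin 22) (Fin 22) ℚ) where
  H20 : Submodule ℂ (Fin 22 → ℂ)
  H11 : Submodule ℂ (Fin 22 → ℂ)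
  H02 : Submodule ℂ (Fin 22 → ℂ)
  isInternal : DirectSum.IsInternal ![H20, H11, H02]
  orthogonal_20_11 : ∀ v ∈ H20, ∀ w ∈ H11, hermForm M v w = 0
  orthogonal_20_02 : ∀ v ∈ H20, ∀ w ∈ H02, hermForm M v w = 0
  orthogonal_11_02 : ∀ v ∈ H11, ∀ w ∈ H02, hermForm M v w = 0
  signature_20 : HasSignature M H20 1 0
  signature_11 : HasSignature M H11 1 19
  signature_02 : HasSignature M H02 1 0
  conj_20 : ∀ v, star v ∈ H02 ↔ v ∈ H20
  conj_11 : ∀ v, star v ∈ H11 ↔ v ∈ H11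

/-- `F` is a lattice automorphism of `(L, M)`. -/
def IsLatticeAutomorphism (L : Submodule ℤ (Fin 22 → ℚ)) (M F : Matrix (Fin 22) (Fin 22) ℚ) :
    Prop :=
  L.map ((Matrix.toLin' F).restrictScalars ℤ) = L ∧ F.transpose * M * F = M

/-- `F` is a Hodge isometry: a lattice automorphism preserving the Hodge structure. -/
structure IsHodgeIsometry (L : Submodule ℤ (Fin 22 → ℚ)) {M : Matrix (Fin 22) (Fin 22) ℚ}
    (h : HodgeStructure M) (F : Matrix (Fin 22) (Fin 22) ℚ) : Prop where
  automorphism : IsLatticeAutomorphism L M F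
  map_20 : h.H20.map (Matrix.toLin' (toC F)) = h.H20
  map_11 : h.H11.map (Matrix.toLin' (toC F)) = h.H11
  map_02 : h.H02.map (Matrix.toLin' (toC F)) = h.H02

/-- A rational matrix as a real one. -/
def toR {n : ℕ} (M : Matrix (Fin n) (Fin n) ℚ) : Matrix (Fin n) (Fin n) ℝ :=
  M.map fun q => (q : ℝ)

/-- The set of time-like vectors `{v ∈ H^{1,1} ∩ ℝ^22 : (v, v) > 0}`; it consists of two connected
components, the positive and the negative cone. -/
def HodgeStructure.cone {M : Matrix (Fin 22) (Fin 22) ℚ} (h : HodgeStructure M) :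
    Set (Fin 22 → ℝ) :=
  {v | (fun i => (v i : ℂ)) ∈ h.H11 ∧ 0 < v ⬝ᵥ (toR M).mulVec v}

/-- A positive Hodge isometry: it preserves each connected component of the set of time-like
vectors. -/
def IsPositiveHodgeIsometry (L : Submodule ℤ (Fin 22 → ℚ)) {M : Matrix (Fin 22) (Fin 22) ℚ}
    (h : HodgeStructure M) (F : Matrix (Fin 22) (Fin 22) ℚ) : Prop :=
  IsHodgeIsometry L h F ∧
  ∀ v ∈ h.cone, (toR F).mulVec '' connectedComponentIn h.cone v = connectedComponentIn h.cone v

/-- `τ = δ + δ⁻¹` is the special trace of the Hodge isometry `F`, where `|δ| = 1` and `F` acts on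
`H^{2,0}` as `δ` and on `H^{0,2}` as `δ⁻¹`. -/
def IsSpecialTrace {M : Matrix (Fin 22) (Fin 22) ℚ} (h : HodgeStructure M)
    (F : Matrix (Fin 22) (Fin 22) ℚ) (τ : ℝ) : Prop :=
  ∃ δ : ℂ, ‖δ‖ = 1 ∧ (∀ v ∈ h.H20, (toC F).mulVec v = δ • v) ∧
    (∀ v ∈ h.H02, (toC F).mulVec v = δ⁻¹ • v) ∧ (τ : ℂ) = δ + δ⁻¹

/-- `F` is of hyperbolic type: there is a real number `l > 1` such that `l` and `l⁻¹` are the only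
eigenvalues of `F` outside the unit circle. -/
def IsHyperbolic (F : Matrix (Fin 22) (Fin 22) ℚ) : Prop :=
  ∃ l : ℝ, 1 < l ∧ ∀ μ : ℂ,
    (Module.End.HasEigenvalue (Matrix.toLin' (toC F)) μ ∧ ‖μ‖ ≠ 1) ↔
      (μ = (l : ℂ) ∨ μ = (l : ℂ)⁻¹)

/-- After renormalization, the rank `22` hypergeometric lattice `L` is a K3 lattice with a Hodge
structure such that the matrix `B = Z(ψ)` is a positive Hodge isometry. -/
def IsPositiveHodgeIsometryB (φ ψ : ℤ[X]) (r : Fin 22 → ℚ) : Prop :=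
  IsK3Lattice (lattice 22 φ r) (intersectionForm φ ψ r) ∧
    ∃ h : HodgeStructure (intersectionForm φ ψ r),
      IsPositiveHodgeIsometry (lattice 22 φ r) h (companion 22 ψ)

/-- Two Hodge structures agree up to complex conjugation. -/
def HodgeStructure.EqUpToConj {M : Matrix (Fin 22) (Fin 22) ℚ} (h h' : HodgeStructure M) : Prop :=
  h'.H11 = h.H11 ∧
    ((h'.H20 = h.H20 ∧ h'.H02 = h.H02) ∨ (h'.H20 = h.H02 ∧ h'.H02 = h.H20))

/-! ### Trace polynomials -/

/-- The trace polynomial of a palindromic polynomial `f` of degree `2N`, that is, the `F` with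
`f(z) = z^N F(z + 1/z)`. It is written with the polynomials `D_k = dickson 1 1 k`, which satisfy
`D_k(z + 1/z) = z^k + z^{-k}`. -/
noncomputable def tracePolynomial (N : ℕ) (f : ℤ[X]) : ℤ[X] :=
  C (f.coeff N) + ∑ k ∈ Finset.range N, C (f.coeff (N + k + 1)) * dickson 1 1 (k + 1)

/-- The trace polynomial of an anti-palindromic polynomial `f` of degree `2N`, that is, the `F`
with `f(z) = (z^2 - 1) z^{N-1} F(z + 1/z)`. -/
noncomputable def antiTracePolynomial (N : ℕ) (f : ℤ[X]) : ℤ[X] :=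
  tracePolynomial (N - 1) (f /ₘ (X ^ 2 - 1))

theorem tracePolynomial_spec (N : ℕ) (f : ℤ[X]) (hd : f.natDegree ≤ 2 * N)
    (hf : f.reflect (2 * N) = f) (z : ℂ) (hz : z ≠ 0) :
    aeval z f = z ^ N * aeval (z + z⁻¹) (tracePolynomial N f) := by
  have hD : ∀ k : ℕ, aeval (z + z⁻¹) (dickson 1 (1 : ℤ) k) = z ^ k + z⁻¹ ^ k := by
    intro k
    have h := dickson_one_one_eval_add_inv z z⁻¹ (mul_inv_cancel₀ hz) k
    rw [← h, aeval_def, ← eval_map, map_dickson]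
    simp
  have hc : ∀ j, j < N → f.coeff (N - 1 - j) = f.coeff (N + j + 1) := by
    intro j hj
    conv_lhs => rw [← hf]
    rw [coeff_reflect, revAt_le (by omega)]
    congr 1
    omega
  rw [aeval_eq_sum_range' (n := N + (N + 1)) (by omega), Finset.sum_range_add,
    Finset.sum_range_succ', ← Finset.sum_range_reflect, tracePolynomial]
  simp only [map_add, map_sum, map_mul, hD, aeval_C]
  rw [mul_add, Finset.mul_sum, add_zero, ← add_assoc, ← Finset.sum_add_distrib, add_comm]
  congr 1
  · simp [zsmul_eq_mul, mul_comm]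
  · refine Finset.sum_congr rfl fun j hj => ?_
    have hj' := Finset.mem_range.mp hj
    rw [hc j hj', ← add_assoc]
    have e : z ^ N * z⁻¹ ^ (j + 1) = z ^ (N - 1 - j) := by
      have : N = (N - 1 - j) + (j + 1) := by omega
      conv_lhs => rw [this]
      rw [pow_add, mul_assoc, ← mul_pow, mul_inv_cancel₀ hz, one_pow, mul_one]
    simp only [zsmul_eq_mul, algebraMap_int_eq, eq_intCast]
    rw [← e]
    ring

theorem antiTracePolynomial_spec (N : ℕ) (hN : 1 ≤ N) (f : ℤ[X]) (hd : f.natDegree = 2 * N)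
    (hf : f.reflect (2 * N) = -f) (z : ℂ) (hz : z ≠ 0) :
    aeval z f = (z ^ 2 - 1) * z ^ (N - 1) * aeval (z + z⁻¹) (antiTracePolynomial N f) := by
  have h1 : f.eval 1 = 0 := by
    let inst1 : Invertible (1 : ℤ) := invertibleOne
    have h := eval₂_reflect_mul_pow (RingHom.id ℤ) (1 : ℤ) (2 * N) f hd.le
    rw [hf] at h
    simp at h
    omega
  obtain ⟨g, hg⟩ := dvd_iff_isRoot.mpr h1
  have h2 : f.eval (-1) = 0 := by
    let inst2 : Invertible (-1 : ℤ) := ⟨-1, by norm_num, by norm_num⟩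
    have h := eval₂_reflect_mul_pow (RingHom.id ℤ) (-1 : ℤ) (2 * N) f hd.le
    rw [hf] at h
    have h3 : (⅟(-1 : ℤ)) = -1 := rfl
    rw [h3, pow_mul] at h
    simp [eval₂_id] at h
    omega
  have h4 : g.eval (-1) = 0 := by
    rw [hg] at h2
    simp at h2
    omega
  obtain ⟨k, hk⟩ := dvd_iff_isRoot.mpr h4
  have hfk : f = (X ^ 2 - 1) * k := by
    rw [hg, hk]
    simp only [map_neg, map_one]
    ring
  have hm : (X ^ 2 - 1 : ℤ[X]).Monic := by monicity!
  have hX : (X ^ 2 - 1 : ℤ[X]).natDegree = 2 := by compute_degree!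
  have hq : f /ₘ (X ^ 2 - 1) = k := by
    rw [hfk, mul_divByMonic_cancel_left _ hm]
  have hk0 : k ≠ 0 := by
    rintro rfl
    rw [mul_zero] at hfk
    rw [hfk, natDegree_zero] at hd
    omega
  have hkd : k.natDegree = 2 * (N - 1) := by
    rw [hfk, hm.natDegree_mul' hk0, hX] at hd
    omega
  have hkp : k.reflect (2 * (N - 1)) = k := by
    have e : 2 * N = 2 + 2 * (N - 1) := by omega
    rw [hfk, e, reflect_mul _ _ hX.le hkd.le] at hf
    have e2 : (X ^ 2 - 1 : ℤ[X]).reflect 2 = -(X ^ 2 - 1) := by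
      rw [sub_eq_add_neg, reflect_add, reflect_neg, reflect_one, ← one_mul (X ^ 2 : ℤ[X]),
        ← C_1, reflect_C_mul_X_pow]
      simp [revAt_le]
    rw [e2, neg_mul, neg_inj] at hf
    exact mul_left_cancel₀ hm.ne_zero hf
  rw [antiTracePolynomial, hq]
  conv_lhs => rw [hfk]
  rw [map_mul, tracePolynomial_spec _ k hkd.le hkp z hz]
  simp [mul_assoc]

/-! ### Trace clusters -/

/-- The multiset of all complex roots of an integer polynomial. -/
noncomputable def complexRoots (P : ℤ[X]) : Multiset ℂ := (P.map (Int.castRingHom ℂ)).roots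

open Classical in
/-- The part of the multiset of roots of `P` that lies on the interval `[-2, 2]`. -/
noncomputable def rootsOn (P : ℤ[X]) : Multiset ℝ :=
  ((P.map (Int.castRingHom ℝ)).roots).filter fun x => -2 ≤ x ∧ x ≤ 2

open Classical in
/-- The part of the multiset of roots of `P` that lies in `(2, ∞)`. -/
noncomputable def rootsGtTwo (P : ℤ[X]) : Multiset ℝ :=
  ((P.map (Int.castRingHom ℝ)).roots).filter fun x => 2 < x

/-- `A_1, …, A_{s+1}` and `B_1, …, B_s` are the trace clusters of `Φ`, `Ψ`: they decompose the
multisets of roots on `[-2, 2]`, with `A_{s+1} < B_s < A_s < ⋯ < B_1 < A_1`, and only the end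
clusters `A_1`, `A_{s+1}` may be null. (The values outside the index range are irrelevant.) -/
structure IsTraceClusters (Φ Ψ : ℤ[X]) (s : ℕ) (A B : ℕ → Multiset ℝ) : Prop where
  sum_left : ∑ i ∈ Finset.Icc 1 (s + 1), A i = rootsOn Φ
  sum_right : ∑ i ∈ Finset.Icc 1 s, B i = rootsOn Ψ
  left_ne : ∀ i ∈ Finset.Icc 2 s, A i ≠ 0
  right_ne : ∀ i ∈ Finset.Icc 1 s, B i ≠ 0
  right_lt_left : ∀ i ∈ Finset.Icc 1 s, ∀ b ∈ B i, ∀ a ∈ A i, b < a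
  left_lt_right : ∀ i ∈ Finset.Icc 1 s, ∀ a ∈ A (i + 1), ∀ b ∈ B i, a < b

/-- The multiset of cardinalities of the clusters with index in `I`. -/
def clusterType (I : Finset ℕ) (K : ℕ → Multiset ℝ) : Multiset ℕ :=
  I.val.map fun i => (K i).card

/-- The type `0^{ν₀} 1^{ν₁} 2^{ν₂} 3^{ν₃}`. -/
def ctype (ν₀ ν₁ ν₂ ν₃ : ℕ) : Multiset ℕ :=
  Multiset.replicate ν₀ 0 + Multiset.replicate ν₁ 1 + Multiset.replicate ν₂ 2 +
    Multiset.replicate ν₃ 3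

/-- The clusters `A_i` and `B_j` form an adjacent pair of double clusters, where `A_i` belongs to
`A_in = A_2 ∪ ⋯ ∪ A_s`. -/
def IsAdjacentDoublePair (s : ℕ) (A B : ℕ → Multiset ℝ) (i j : ℕ) : Prop :=
  i ∈ Finset.Icc 2 s ∧ j ∈ Finset.Icc 1 s ∧ (A i).card = 2 ∧ (B j).card = 2 ∧
    (i = j ∨ i = j + 1)

/-- The columns `s`, `[A_in]`, `[B_on]`, `|A_in|` and `|B_{>2}|` of a row of the table. -/
def HasShape (Ψ : ℤ[X]) (s : ℕ) (A B : ℕ → Multiset ℝ) (s₀ : ℕ) (tA tB : Multiset ℕ)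
    (cA c : ℕ) : Prop :=
  s = s₀ ∧ clusterType (Finset.Icc 2 s) A = tA ∧ clusterType (Finset.Icc 1 s) B = tB ∧
    ∑ i ∈ Finset.Icc 2 s, (A i).card = cA ∧ (rootsGtTwo Ψ).card = c

/-- The clusters satisfy the conditions in row `k` of the table. -/
def InCase (Ψ : ℤ[X]) (s : ℕ) (A B : ℕ → Multiset ℝ) (k : ℕ) : Prop :=
  match k with
  | 1 => HasShape Ψ s A B 8 (ctype 0 7 0 0) (ctype 0 7 0 1) 7 1
  | 2 => HasShape Ψ s A B 8 (ctype 0 6 0 1) (ctype 0 7 0 1) 9 1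
  | 3 => HasShape Ψ s A B 9 (ctype 0 7 1 0) (ctype 0 8 1 0) 9 1 ∧
      ∃ i j, IsAdjacentDoublePair s A B i j
  | 4 => HasShape Ψ s A B 9 (ctype 0 8 0 0) (ctype 0 8 1 0) 8 1 ∧ (B 1).card = 2
  | 5 => HasShape Ψ s A B 9 (ctype 0 8 0 0) (ctype 0 8 1 0) 8 1 ∧ (B 9).card = 2
  | 6 => HasShape Ψ s A B 9 (ctype 0 7 0 1) (ctype 0 8 1 0) 10 1 ∧ (B 1).card = 2
  | 7 => HasShape Ψ s A B 9 (ctype 0 7 0 1) (ctype 0 8 1 0) 10 1 ∧ (B 9).card = 2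
  | 8 => HasShape Ψ s A B 10 (ctype 0 8 1 0) (ctype 0 10 0 0) 10 1 ∧ (A 2).card = 2
  | 9 => HasShape Ψ s A B 10 (ctype 0 8 1 0) (ctype 0 10 0 0) 10 1 ∧ (A 10).card = 2
  | _ => False

/-- `τ` is the middle element of a triple `B_on`-cluster. -/
def IsMiddleOfTriple (s : ℕ) (B : ℕ → Multiset ℝ) (τ : ℝ) : Prop :=
  ∃ j ∈ Finset.Icc 1 s, ∃ b c : ℝ, b < τ ∧ τ < c ∧ B j = {b, τ, c}

/-- `τ` is the inner element in `B_on` of an adjacent pair of double clusters `A_i`, `B_j`: if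
`A_i ∪ B_j` consists of `l₁ ≤ l₂ ≤ l₃ ≤ l₄`, then `τ` is the one of `l₂`, `l₃` in `B_j`. -/
def IsInnerOfAdjacentPair (s : ℕ) (A B : ℕ → Multiset ℝ) (τ : ℝ) : Prop :=
  ∃ i j, IsAdjacentDoublePair s A B i j ∧ τ ∈ B j ∧
    ∃ l₁ l₂ l₃ l₄ : ℝ, l₁ ≤ l₂ ∧ l₂ ≤ l₃ ∧ l₃ ≤ l₄ ∧ A i + B j = {l₁, l₂, l₃, l₄} ∧
      (τ = l₂ ∨ τ = l₃)

/-- `τ = max K`. -/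
def IsMaxOf (K : Multiset ℝ) (τ : ℝ) : Prop := τ ∈ K ∧ ∀ b ∈ K, b ≤ τ

/-- `τ = min K`. -/
def IsMinOf (K : Multiset ℝ) (τ : ℝ) : Prop := τ ∈ K ∧ ∀ b ∈ K, τ ≤ b

/-- `τ` has the location exhibited in the last column of row `k` of the table. -/
def HasLocation (s : ℕ) (A B : ℕ → Multiset ℝ) (k : ℕ) (τ : ℝ) : Prop :=
  match k with
  | 1 => IsMiddleOfTriple s B τ
  | 2 => IsMiddleOfTriple s B τ
  | 3 => IsInnerOfAdjacentPair s A B τ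
  | 4 => IsMaxOf (B 1) τ
  | 5 => IsMinOf (B 9) τ
  | 6 => IsMaxOf (B 1) τ
  | 7 => IsMinOf (B 9) τ
  | 8 => τ ∈ B 1
  | 9 => τ ∈ B 10
  | _ => False

/-- Every root of `P` is simple except for at most one integer root of multiplicity `2` or `3`. -/
def SimpleExceptOneInteger (P : ℤ[X]) : Prop :=
  (complexRoots P).Nodup ∨
    ∃ m : ℤ, ((complexRoots P).count (m : ℂ) = 2 ∨ (complexRoots P).count (m : ℂ) = 3) ∧
      ∀ z ∈ complexRoots P, z ≠ (m : ℂ) → (complexRoots P).count z = 1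

end HypergeometricK3

/-!
The geometry is reduced to signs of trace polynomials, and the signs to a parity count of the trace
roots.

*Eigenvectors.* The form has `(v, r) = (2 / rₙ) vₙ` (`rₙ` the last coordinate), because the numbers
`ξ_k` and the last coordinates of `A^k r` obey the same recursion; hence `B` is `A` composed
with a reflection and is an isometry of the lattice. For a root `μ` of `ψ` put
`v_μ = q(B) r` with `q(z) = ψ(z)/(z - μ)`. It spans the eigenspace of `B` for `μ`, and invariance
of the form gives, with `τ = μ + 1/μ`,
`(v_μ, v_{1/μ}) = (4 - τ²) Φ(τ) Ψ'(τ)` (`IsHypergeometricPair.bform_eigvec_trace`). On the unit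
circle this is the Hermitian length of `v_μ`, so the signature of the form is read off from the
signs of `Φ Ψ'` at the roots of `Ψ` in `(-2, 2)`.

*The spectral condition.* `SpectralCondition Φ Ψ ε τ` says that `Ψ` has simple roots, one of them
in `(2, ∞)` and ten in `(-2, 2)`, and that `ε Φ Ψ'` is positive at `τ` and negative at the other
nine. It is necessary: `H^{2,0}` is spanned by some `v_δ`, and `H^{1,1}` is hyperbolic, so it
contains no isotropic planes and no orthogonal pairs of nonnegative vectors other than multiples of
each other. This makes the eigenvalues simple, leaves one real pair `l, 1/l` off the unit circle,
and makes the remaining `v_μ` negative; positivity of `B` on the time-like cone means `l > 0`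
(`IsPositiveHodgeIsometry.exists_spectralCondition`). It is sufficient: `H^{2,0} = ⟨v_δ⟩` with
`δ + 1/δ = τ` defines a Hodge structure, and `(v, B v) ≥ (v, v)` for time-like `v` keeps the
segment from `v` to `B v` inside the cone (`HodgeFrame.isPositiveHodgeIsometry`). Since `τ` is the
only root at which the sign differs, it determines the Hodge structure up to conjugation.

*Clusters.* The sign of `Φ Ψ'` at a root `t` of `Ψ` is, up to a common sign, the parity of the
number of trace roots above `t` (`sign_mul_derivative`), which changes by one inside a `B`-cluster
and by `|A_{i+1}| + |B_i|` from one cluster to the next. If exactly one root `τ` has the odd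
parity, then all `B`-clusters other than the one of `τ` are singletons, the one of `τ` has at most
three elements, and every inner `A`-cluster is odd unless it is adjacent to `τ` in the right way.
As there are at most ten roots of `Φ`, only the nine rows of the table remain
(`IsTraceClusters.exists_inCase`), and in each of them the position of `τ` is forced
(`IsTraceClusters.exists_hasLocation`). Finally, at least seven inner `A`-clusters are odd, and each
contains a root of odd multiplicity of `Φ`, a polynomial of degree ten; this leaves room for one
multiple root, of multiplicity at most three, and being unique it is rational.
-/

namespace HypergeometricK3

/-! ### Companion matrices -/

/-- The companion matrix over an arbitrary commutative ring. -/
def compMatrix {K : Type*} [CommRing K] (m : ℕ) (f : K[X]) :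
    Matrix (Fin (m + 1)) (Fin (m + 1)) K :=
  Matrix.of fun i j =>
    if (j : ℕ) = m then -f.coeff i else if (i : ℕ) = (j : ℕ) + 1 then 1 else 0

theorem companion_eq_compMatrix (m : ℕ) (f : ℤ[X]) :
    companion (m + 1) f = compMatrix m (f.map (Int.castRingHom ℚ)) := by
  ext i j
  simp [companion, compMatrix]

theorem toC_companion (m : ℕ) (f : ℤ[X]) :
    toC (companion (m + 1) f) = compMatrix m (f.map (Int.castRingHom ℂ)) := by
  ext i j
  simp only [companion, compMatrix, toC, Matrix.map_apply, Matrix.of_apply, coeff_map]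
  split_ifs <;> simp_all

section Companion

variable {K : Type*} [Field K] {m : ℕ} {f : K[X]}

theorem compMatrix_mulVec_zero (v : Fin (m + 1) → K) :
    (compMatrix m f).mulVec v 0 = -f.coeff 0 * v (Fin.last m) := by
  rw [Matrix.mulVec, dotProduct, Fin.sum_univ_castSucc]
  rw [Finset.sum_eq_zero]
  · simp [compMatrix]
  · intro j _
    have : (j : ℕ) ≠ m := j.2.ne
    simp [compMatrix, this]

theorem compMatrix_mulVec_succ (v : Fin (m + 1) → K) (i : Fin m) :
    (compMatrix m f).mulVec v i.succ =
      v i.castSucc - f.coeff (i + 1) * v (Fin.last m) := by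
  rw [Matrix.mulVec, dotProduct, Fin.sum_univ_castSucc, Finset.sum_eq_single i]
  · have : (i : ℕ) ≠ m := i.2.ne
    simp [compMatrix, this, sub_eq_add_neg]
  · intro j _ hj
    have : (j : ℕ) ≠ m := j.2.ne
    have h2 : (i : ℕ) ≠ j := fun h => hj (Fin.ext h.symm)
    simp [compMatrix, this, h2]
  · simp

/-- An eigenvector of a companion matrix is determined by its last coordinate, so eigenspaces are
lines. -/
theorem eq_zero_of_eigenvector {μ : K} {v : Fin (m + 1) → K}
    (hv : (compMatrix m f).mulVec v = μ • v) (h0 : v (Fin.last m) = 0) : v = 0 := by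
  have key : ∀ k : ℕ, ∀ i : Fin (m + 1), (i : ℕ) + k = m → v i = 0 := by
    intro k
    induction k with
    | zero =>
      intro i hi
      have : i = Fin.last m := Fin.ext (by simpa using hi)
      rw [this, h0]
    | succ k ih =>
      intro i hi
      have hi' : (i : ℕ) < m := by omega
      have h1 := compMatrix_mulVec_succ (f := f) v ⟨i, hi'⟩
      have h2 := ih (Fin.succ ⟨i, hi'⟩) (by simp; omega)
      rw [hv, Pi.smul_apply, h2, h0, mul_zero, sub_zero, smul_zero] at h1
      exact h1.symm
  ext i
  exact key (m - i) i (by have := i.2; omega)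

theorem compMatrix_mulVec_injective (h0 : f.coeff 0 ≠ 0) :
    Function.Injective (compMatrix m f).mulVec := by
  intro v w hvw
  have h : (compMatrix m f).mulVec (v - w) = (0 : K) • (v - w) := by
    rw [Matrix.mulVec_sub, zero_smul, sub_eq_zero]
    exact hvw
  have h2 := compMatrix_mulVec_zero (f := f) (v - w)
  rw [h] at h2
  have h3 : (v - w) (Fin.last m) = 0 := by
    simpa [h0] using h2
  exact sub_eq_zero.mp (eq_zero_of_eigenvector h h3)

theorem isUnit_compMatrix (h0 : f.coeff 0 ≠ 0) : IsUnit (compMatrix m f) :=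
  Matrix.mulVec_injective_iff_isUnit.mp (compMatrix_mulVec_injective h0)

theorem compMatrix_mulVec_single {k : ℕ} (hk : k < m) :
    (compMatrix m f).mulVec (Pi.single ⟨k, by omega⟩ 1) = Pi.single ⟨k + 1, by omega⟩ 1 := by
  ext i
  have : k ≠ m := hk.ne
  simp [compMatrix, this, Pi.single_apply, Fin.ext_iff]

theorem compMatrix_pow_mulVec {k : ℕ} (hk : k ≤ m) :
    (compMatrix m f ^ k).mulVec (Pi.single 0 1) = Pi.single ⟨k, by omega⟩ 1 := by
  induction k with
  | zero => rw [pow_zero, Matrix.one_mulVec]; rfl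
  | succ k ih =>
    rw [pow_succ', ← Matrix.mulVec_mulVec, ih (by omega), compMatrix_mulVec_single (by omega)]

/-- The first basis vector is cyclic: applying a polynomial of degree less than the size lists its
coefficients. -/
theorem aeval_mulVec_of_natDegree_le {g : K[X]} (hg : g.natDegree ≤ m) :
    (aeval (compMatrix m f) g).mulVec (Pi.single 0 1) = fun i : Fin (m + 1) => g.coeff i := by
  rw [aeval_eq_sum_range' (n := m + 1) (by omega), Matrix.sum_mulVec, Finset.sum_range]
  ext i
  rw [Finset.sum_apply, Finset.sum_eq_single i]
  · rw [Matrix.smul_mulVec, compMatrix_pow_mulVec (by omega)]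
    simp
  · intro j _ hj
    rw [Matrix.smul_mulVec, compMatrix_pow_mulVec (by omega)]
    simp [hj.symm]
  · simp

theorem compMatrix_pow_top_mulVec :
    (compMatrix m f ^ (m + 1)).mulVec (Pi.single 0 1) = fun i : Fin (m + 1) => -f.coeff i := by
  rw [pow_succ', ← Matrix.mulVec_mulVec, compMatrix_pow_mulVec le_rfl]
  ext i
  simp [compMatrix]

/-- In the degree of the size itself the top power is reduced modulo `f`. -/
theorem aeval_mulVec_of_monic {g : K[X]} (hg : g.Monic) (hd : g.natDegree = m + 1) :
    (aeval (compMatrix m f) g).mulVec (Pi.single 0 1) =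
      fun i : Fin (m + 1) => g.coeff i - f.coeff i := by
  rw [hg.as_sum, hd, map_add, Matrix.add_mulVec, map_pow, aeval_X, compMatrix_pow_top_mulVec]
  have h : (∑ i ∈ Finset.range (m + 1), C (g.coeff i) * X ^ i : K[X]).natDegree ≤ m := by
    refine natDegree_sum_le_of_forall_le _ _ fun i hi => ?_
    exact (natDegree_C_mul_X_pow_le _ _).trans (by simpa [Nat.lt_succ_iff] using hi)
  rw [aeval_mulVec_of_natDegree_le h]
  ext i
  have hi : (i : ℕ) ≠ m + 1 := i.2.ne
  simp only [Pi.add_apply, finsetSum_coeff, coeff_C_mul, coeff_X_pow, coeff_add, hi]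
  simp [Finset.sum_ite_eq, i.2]
  ring

/-- Matrices commuting with a companion matrix are determined by their first column. -/
theorem eq_of_commute_compMatrix {S T : Matrix (Fin (m + 1)) (Fin (m + 1)) K}
    (hS : Commute S (compMatrix m f)) (hT : Commute T (compMatrix m f))
    (h : S.mulVec (Pi.single 0 1) = T.mulVec (Pi.single 0 1)) : S = T := by
  refine Matrix.ext_of_mulVec_single fun i => ?_
  have hi : (Pi.single i 1 : Fin (m + 1) → K) =
      (compMatrix m f ^ (i : ℕ)).mulVec (Pi.single 0 1) := by
    rw [compMatrix_pow_mulVec (by omega)]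
  rw [hi, Matrix.mulVec_mulVec, Matrix.mulVec_mulVec, (hS.pow_right _).eq, (hT.pow_right _).eq,
    ← Matrix.mulVec_mulVec, h, Matrix.mulVec_mulVec]

theorem aeval_compMatrix_commute (g : K[X]) :
    Commute (aeval (compMatrix m f) g) (compMatrix m f) := by
  have := (Commute.all g X).map (aeval (compMatrix m f))
  rwa [aeval_X] at this

theorem aeval_compMatrix_self (hf : f.Monic) (hd : f.natDegree = m + 1) :
    aeval (compMatrix m f) f = 0 := by
  refine eq_of_commute_compMatrix (aeval_compMatrix_commute f) (Commute.zero_left _) ?_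
  rw [aeval_mulVec_of_monic hf hd, Matrix.zero_mulVec]
  ext i
  simp

end Companion

/-! ### The numbers `ξ_i` and the Gram matrix -/

section Pair

variable {N m : ℕ} {φ ψ : ℤ[X]}

namespace IsHypergeometricPair

theorem coeff_left (hp : IsHypergeometricPair N φ ψ) {k l : ℕ} (h : k + l = 2 * N) :
    φ.coeff k = -φ.coeff l := by
  have h1 := congrArg (fun p => coeff p k) hp.antipalindromic
  simp only [coeff_reflect, coeff_neg] at h1
  rw [revAt_le (by omega), show 2 * N - k = l by omega] at h1
  omega

theorem coeff_right (hp : IsHypergeometricPair N φ ψ) {k l : ℕ} (h : k + l = 2 * N) :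
    ψ.coeff k = ψ.coeff l := by
  have h1 := congrArg (fun p => coeff p k) hp.palindromic
  simp only [coeff_reflect] at h1
  rw [revAt_le (by omega), show 2 * N - k = l by omega] at h1
  omega

theorem coeff_left_top (hp : IsHypergeometricPair N φ ψ) : φ.coeff (2 * N) = 1 := by
  rw [← hp.natDegree_left]; exact hp.monic_left

theorem coeff_right_top (hp : IsHypergeometricPair N φ ψ) : ψ.coeff (2 * N) = 1 := by
  rw [← hp.natDegree_right]; exact hp.monic_right

theorem coeff_left_zero (hp : IsHypergeometricPair N φ ψ) : φ.coeff 0 = -1 := by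
  rw [hp.coeff_left (zero_add _), hp.coeff_left_top]

theorem coeff_right_zero (hp : IsHypergeometricPair N φ ψ) : ψ.coeff 0 = 1 := by
  rw [hp.coeff_right (zero_add _), hp.coeff_right_top]

theorem reverse_left (hp : IsHypergeometricPair N φ ψ) : φ.reverse = -φ := by
  rw [reverse, hp.natDegree_left, hp.antipalindromic]

theorem reverse_right (hp : IsHypergeometricPair N φ ψ) : ψ.reverse = ψ := by
  rw [reverse, hp.natDegree_right, hp.palindromic]

/-- The defining relation `φ(z) (ψ(z)/φ(z)) = ψ(z)` of the numbers `ξ_i`, coefficient by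
coefficient; the normalization `ξ_0 = 2` in place of `1` accounts for the term `φ_k`. -/
theorem sum_coeff_mul_xi (hp : IsHypergeometricPair N φ ψ) (k : ℕ) :
    ∑ j ∈ Finset.range (k + 1), (φ.coeff (k - j) : ℚ) * xi φ ψ j =
      φ.coeff k - ψ.coeff k := by
  have hcc : ∀ p : ℚ[X], PowerSeries.constantCoeff (p : PowerSeries ℚ) = p.coeff 0 := fun p => by
    rw [← PowerSeries.coeff_zero_eq_constantCoeff_apply, coeff_coe]
  have hq : ∀ j, xi φ ψ j = PowerSeries.coeff j
      ((1 : PowerSeries ℚ) + ((ψ.map (Int.castRingHom ℚ) : ℚ[X]) : PowerSeries ℚ) *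
        (((-φ).map (Int.castRingHom ℚ) : ℚ[X]) : PowerSeries ℚ)⁻¹) := by
    intro j
    rw [xi, hp.reverse_left, hp.reverse_right]
    split_ifs with hj
    · subst hj
      rw [PowerSeries.coeff_zero_eq_constantCoeff_apply, map_add, map_mul,
        PowerSeries.constantCoeff_inv, hcc, hcc, coeff_map, coeff_map, coeff_neg,
        hp.coeff_left_zero, hp.coeff_right_zero]
      norm_num
    · rw [map_add, PowerSeries.coeff_one, if_neg hj, zero_add]
  have hc : PowerSeries.constantCoeff
      (((-φ).map (Int.castRingHom ℚ) : ℚ[X]) : PowerSeries ℚ) ≠ 0 := by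
    rw [hcc]
    simp [hp.coeff_left_zero]
  have h : ((1 : PowerSeries ℚ) + ((ψ.map (Int.castRingHom ℚ) : ℚ[X]) : PowerSeries ℚ) *
        (((-φ).map (Int.castRingHom ℚ) : ℚ[X]) : PowerSeries ℚ)⁻¹) *
        (((-φ).map (Int.castRingHom ℚ) : ℚ[X]) : PowerSeries ℚ) =
      (((-φ).map (Int.castRingHom ℚ) + ψ.map (Int.castRingHom ℚ) : ℚ[X]) : PowerSeries ℚ) := by
    rw [add_mul, mul_assoc, PowerSeries.inv_mul_cancel _ hc, coe_add]
    ring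
  have h2 := congrArg (PowerSeries.coeff k) h
  rw [PowerSeries.coeff_mul, Finset.Nat.sum_antidiagonal_eq_sum_range_succ_mk] at h2
  simp only [← hq, coeff_coe] at h2
  simp at h2
  simp only [mul_comm]
  linarith

/-- The two-sided sequence `ξ_{|i|}` satisfies the linear recurrence given by `φ`. -/
theorem sum_coeff_mul_xi_natAbs (hp : IsHypergeometricPair N φ ψ) {j : ℕ} (hj : j ≤ 2 * N) :
    ∑ k ∈ Finset.range (2 * N + 1),
      (φ.coeff k : ℚ) * xi φ ψ ((j : ℤ) - (k : ℤ)).natAbs = 0 := by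
  have h1 := hp.sum_coeff_mul_xi j
  rw [← Finset.sum_range_reflect, Finset.sum_range_succ] at h1
  have h2 := hp.sum_coeff_mul_xi (2 * N - j)
  rw [show 2 * N + 1 = j + (2 * N - j + 1) by omega, Finset.sum_range_add]
  have e1 : ∑ k ∈ Finset.range j, (φ.coeff k : ℚ) * xi φ ψ ((j : ℤ) - (k : ℤ)).natAbs =
      ∑ k ∈ Finset.range j, (φ.coeff (j - (j + 1 - 1 - k)) : ℚ) * xi φ ψ (j + 1 - 1 - k) := by
    refine Finset.sum_congr rfl fun k hk => ?_
    have := Finset.mem_range.mp hk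
    congr 3 <;> omega
  have e2 : ∑ k ∈ Finset.range (2 * N - j + 1),
      (φ.coeff (j + k) : ℚ) * xi φ ψ ((j : ℤ) - ((j + k : ℕ) : ℤ)).natAbs =
      -∑ k ∈ Finset.range (2 * N - j + 1), (φ.coeff (2 * N - j - k) : ℚ) * xi φ ψ k := by
    rw [← Finset.sum_neg_distrib]
    refine Finset.sum_congr rfl fun k hk => ?_
    have := Finset.mem_range.mp hk
    rw [hp.coeff_left (k := j + k) (l := 2 * N - j - k) (by omega)]
    rw [show ((j : ℤ) - ((j + k : ℕ) : ℤ)).natAbs = k by omega]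
    push_cast
    ring
  rw [e1, e2, h2, eq_sub_of_add_eq h1]
  rw [hp.coeff_left (k := 2 * N - j) (l := j) (by omega),
    hp.coeff_right (k := 2 * N - j) (l := j) (by omega)]
  have : xi φ ψ 0 = 2 := by simp [xi]
  simp [this]
  ring

end IsHypergeometricPair

/-- The Gram matrix of the `A`-basis. -/
noncomputable def gramMatrix (m : ℕ) (φ ψ : ℤ[X]) : Matrix (Fin (m + 1)) (Fin (m + 1)) ℚ :=
  Matrix.of fun i j => xi φ ψ ((i : ℤ) - (j : ℤ)).natAbs

theorem gramMatrix_transpose : (gramMatrix m φ ψ).transpose = gramMatrix m φ ψ := by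
  ext i j
  simp only [gramMatrix, Matrix.transpose_apply, Matrix.of_apply]
  rw [← Int.natAbs_neg, neg_sub]

/-- A row vector whose entries continue to a sequence satisfying the recurrence of `φ` is shifted
by the companion matrix. -/
theorem sum_mul_companion (hφ : φ.coeff (m + 1) = 1) (w : ℕ → ℚ)
    (hw : ∑ k ∈ Finset.range (m + 2), (φ.coeff k : ℚ) * w k = 0) (j : Fin (m + 1)) :
    ∑ k : Fin (m + 1), w k * companion (m + 1) φ k j = w (j + 1) := by
  by_cases hj : (j : ℕ) = m
  · rw [Finset.sum_range_succ, hφ] at hw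
    simp only [companion, Matrix.of_apply, hj, if_true]
    rw [← Finset.sum_range (fun k => w k * -(φ.coeff k : ℚ))]
    rw [← sub_eq_zero, ← neg_eq_zero, ← hw, neg_sub, sub_eq_add_neg, ← Finset.sum_neg_distrib,
      add_comm]
    congr 1
    · exact Finset.sum_congr rfl fun _ _ => by ring
    · simp
  · have hj' : (j : ℕ) + 1 ≠ m + 1 := by omega
    simp only [companion, Matrix.of_apply, hj', if_false]
    rw [Finset.sum_eq_single (⟨j + 1, by omega⟩ : Fin (m + 1))]
    · simp
    · intro k _ hk
      have : (k : ℕ) ≠ j + 1 := fun h => hk (Fin.ext h)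
      simp [this]
    · simp

/-- `A`, written in the `A`-basis (where it is its own companion matrix), preserves the Gram matrix.
-/
theorem gramMatrix_invariant (hp : IsHypergeometricPair N φ ψ) (hm : 2 * N = m + 1) :
    (companion (m + 1) φ).transpose * gramMatrix m φ ψ * companion (m + 1) φ =
      gramMatrix m φ ψ := by
  have htop : φ.coeff (m + 1) = 1 := by rw [← hm]; exact hp.coeff_left_top
  rw [Matrix.mul_assoc]
  have h1 : gramMatrix m φ ψ * companion (m + 1) φ =
      Matrix.of fun i j : Fin (m + 1) => xi φ ψ ((i : ℤ) - (j + 1 : ℕ)).natAbs := by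
    ext i j
    rw [Matrix.mul_apply, Matrix.of_apply]
    simp only [gramMatrix, Matrix.of_apply]
    refine sum_mul_companion htop (fun k => xi φ ψ ((i : ℤ) - (k : ℤ)).natAbs) ?_ j
    have := hp.sum_coeff_mul_xi_natAbs (j := i) (by omega)
    rwa [hm] at this
  rw [h1]
  ext i j
  rw [Matrix.mul_apply]
  simp only [gramMatrix, Matrix.of_apply, Matrix.transpose_apply]
  have h2 := sum_mul_companion htop
    (fun k => xi φ ψ (((j : ℕ) + 1 : ℕ) - (k : ℤ)).natAbs) (by
      have := hp.sum_coeff_mul_xi_natAbs (j := j + 1) (by omega)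
      rwa [hm] at this) i
  have h3 : ((i : ℤ) - (j : ℤ)).natAbs =
    ((((j : ℕ) + 1 : ℕ) : ℤ) - ((i : ℕ) + 1 : ℕ)).natAbs := by omega
  rw [h3, ← h2]
  refine Finset.sum_congr rfl fun k _ => ?_
  rw [mul_comm, ← Int.natAbs_neg, neg_sub]

end Pair

/-! ### The reflection vector and the invariant form -/

/-- A matrix is determined by its bilinear form. -/
theorem matrix_ext_of_dotProduct {ι R : Type*} [Fintype ι] [CommRing R] {S T : Matrix ι ι R}
    (h : ∀ x y : ι → R, x ⬝ᵥ S.mulVec y = x ⬝ᵥ T.mulVec y) : S = T := by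
  classical
  ext i j
  simpa using h (Pi.single i 1) (Pi.single j 1)

section Reflection

variable {N m : ℕ} {φ ψ : ℤ[X]} {r : Fin (m + 1) → ℚ}

/-- Two companion matrices differ only in the last column. -/
theorem companion_mulVec_sub (v : Fin (m + 1) → ℚ) :
    (companion (m + 1) ψ).mulVec v - (companion (m + 1) φ).mulVec v =
      v (Fin.last m) • fun i : Fin (m + 1) => (φ.coeff i - ψ.coeff i : ℚ) := by
  rw [companion_eq_compMatrix, companion_eq_compMatrix]
  ext i
  rw [Pi.sub_apply]
  refine Fin.cases ?_ (fun i => ?_) i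
  · rw [compMatrix_mulVec_zero, compMatrix_mulVec_zero]
    simp
    ring
  · rw [compMatrix_mulVec_succ, compMatrix_mulVec_succ]
    simp
    ring

theorem IsHypergeometricPair.isUnit_companion_left (hp : IsHypergeometricPair N φ ψ) :
    IsUnit (companion (m + 1) φ) := by
  rw [companion_eq_compMatrix]
  exact isUnit_compMatrix (by simp [hp.coeff_left_zero])

namespace IsReflectionVector

variable (hp : IsHypergeometricPair N φ ψ) (hr : IsReflectionVector (m + 1) φ ψ r)

include hp hr

theorem right_mulVec :
    (companion (m + 1) ψ).mulVec r = -(companion (m + 1) φ).mulVec r := by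
  have hu := (Matrix.isUnit_iff_isUnit_det _).mp (hp.isUnit_companion_left (m := m))
  have h := congrArg (companion (m + 1) φ).mulVec hr.2
  rwa [Matrix.mulVec_mulVec, ← Matrix.mul_assoc, Matrix.mul_nonsing_inv _ hu, Matrix.one_mul,
    Matrix.mulVec_neg] at h

theorem left_mulVec :
    (companion (m + 1) φ).mulVec r =
      (r (Fin.last m) / 2) • fun i : Fin (m + 1) => (ψ.coeff i - φ.coeff i : ℚ) := by
  have h := companion_mulVec_sub (φ := φ) (ψ := ψ) r
  rw [hr.right_mulVec hp] at h
  ext i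
  have hi := congrFun h i
  simp only [Pi.sub_apply, Pi.neg_apply, Pi.smul_apply, smul_eq_mul] at hi ⊢
  linarith

theorem last_ne_zero : r (Fin.last m) ≠ 0 := by
  intro h
  refine hr.1 (Matrix.mulVec_injective_iff_isUnit.mpr (hp.isUnit_companion_left (m := m)) ?_)
  rw [Matrix.mulVec_zero, hr.left_mulVec hp, h]
  simp

theorem right_mulVec_eq :
    (companion (m + 1) ψ).mulVec r =
      (r (Fin.last m) / 2) • fun i : Fin (m + 1) => (φ.coeff i - ψ.coeff i : ℚ) := by
  rw [hr.right_mulVec hp, hr.left_mulVec hp, ← smul_neg]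
  congr 1
  ext i
  simp

/-- `B` is `A` composed with the reflection in `r`. -/
theorem right_mulVec_eq_left (v : Fin (m + 1) → ℚ) :
    (companion (m + 1) ψ).mulVec v = (companion (m + 1) φ).mulVec
      (v - (2 / r (Fin.last m) * v (Fin.last m)) • r) := by
  have hc := hr.last_ne_zero hp
  rw [Matrix.mulVec_sub, Matrix.mulVec_smul, hr.left_mulVec hp,
    eq_add_of_sub_eq (companion_mulVec_sub (φ := φ) v)]
  ext i
  simp
  field_simp
  ring

/-- The matrix of the `A`-basis is a polynomial in `A`, up to an inverse of `A`. -/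
theorem basisMatrix_eq (hm : 2 * N = m + 1) :
    basisMatrix (m + 1) φ r = (r (Fin.last m) / 2) • ((companion (m + 1) φ)⁻¹ *
      aeval (companion (m + 1) φ) (ψ.map (Int.castRingHom ℚ))) := by
  have hu := (Matrix.isUnit_iff_isUnit_det _).mp (hp.isUnit_companion_left (m := m))
  refine Matrix.ext_of_mulVec_single fun k => ?_
  have h1 : (basisMatrix (m + 1) φ r).mulVec (Pi.single k 1) =
      (companion (m + 1) φ ^ (k : ℕ)).mulVec r := by
    ext i
    simp [basisMatrix]
  have h2 : (Pi.single k 1 : Fin (m + 1) → ℚ) =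
      (companion (m + 1) φ ^ (k : ℕ)).mulVec (Pi.single 0 1) := by
    rw [companion_eq_compMatrix, compMatrix_pow_mulVec (by omega)]
  have h3 : Commute (aeval (companion (m + 1) φ) (ψ.map (Int.castRingHom ℚ)))
      (companion (m + 1) φ) := by
    rw [companion_eq_compMatrix]
    exact aeval_compMatrix_commute _
  have h4 : Commute ((companion (m + 1) φ)⁻¹) (companion (m + 1) φ) := by
    rw [commute_iff_eq, Matrix.nonsing_inv_mul _ hu, Matrix.mul_nonsing_inv _ hu]
  have h5 : (aeval (companion (m + 1) φ) (ψ.map (Int.castRingHom ℚ))).mulVec (Pi.single 0 1) =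
      fun i : Fin (m + 1) => (ψ.coeff i - φ.coeff i : ℚ) := by
    rw [companion_eq_compMatrix, aeval_mulVec_of_monic (hp.monic_right.map _)
      (by rw [hp.monic_right.natDegree_map, hp.natDegree_right, hm])]
    simp
  rw [h1, h2, Matrix.smul_mulVec, Matrix.mulVec_mulVec,
    ((h4.mul_left h3).pow_right _).eq, ← Matrix.mulVec_mulVec, ← Matrix.mulVec_mulVec, h5,
    ← Matrix.mulVec_smul, ← Matrix.mulVec_smul, ← hr.left_mulVec hp, Matrix.mulVec_mulVec r,
    Matrix.nonsing_inv_mul _ hu, Matrix.one_mulVec]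

theorem basisMatrix_commute (hm : 2 * N = m + 1) :
    Commute (basisMatrix (m + 1) φ r) (companion (m + 1) φ) := by
  have hu := (Matrix.isUnit_iff_isUnit_det _).mp (hp.isUnit_companion_left (m := m))
  have h3 : Commute (aeval (companion (m + 1) φ) (ψ.map (Int.castRingHom ℚ)))
      (companion (m + 1) φ) := by
    rw [companion_eq_compMatrix]
    exact aeval_compMatrix_commute _
  have h4 : Commute ((companion (m + 1) φ)⁻¹) (companion (m + 1) φ) := by
    rw [commute_iff_eq, Matrix.nonsing_inv_mul _ hu, Matrix.mul_nonsing_inv _ hu]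
  rw [hr.basisMatrix_eq hp hm]
  exact (h4.mul_left h3).smul_left _

/-- The vector `r` is cyclic for `A`. -/
theorem isUnit_basisMatrix (hm : 2 * N = m + 1) :
    IsUnit (basisMatrix (m + 1) φ r).det := by
  have hu := (Matrix.isUnit_iff_isUnit_det _).mp (hp.isUnit_companion_left (m := m))
  have h1 : IsUnit (aeval (companion (m + 1) φ) (ψ.map (Int.castRingHom ℚ))).det := by
    obtain ⟨u, w, huw⟩ := hp.coprime
    have h := congrArg (aeval (companion (m + 1) φ)) huw
    have h0 : aeval (companion (m + 1) φ) (φ.map (Int.castRingHom ℚ)) = 0 := by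
      rw [companion_eq_compMatrix]
      exact aeval_compMatrix_self (hp.monic_left.map _)
        (by rw [hp.monic_left.natDegree_map, hp.natDegree_left, hm])
    rw [map_add, map_mul, map_mul, h0, mul_zero, zero_add, map_one] at h
    exact Matrix.isUnit_det_of_left_inverse h
  rw [hr.basisMatrix_eq hp hm, Matrix.det_smul, Matrix.det_mul]
  have hc := hr.last_ne_zero hp
  refine IsUnit.mul (IsUnit.pow _ (isUnit_iff_ne_zero.mpr (by simpa using hc))) (IsUnit.mul ?_ h1)
  exact (Matrix.isUnit_nonsing_inv_det_iff).mpr hu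

omit hp hr in
theorem invariantForm_eq : invariantForm (m + 1) φ ψ r =
    ((basisMatrix (m + 1) φ r)⁻¹).transpose * gramMatrix m φ ψ *
      (basisMatrix (m + 1) φ r)⁻¹ := rfl

omit hp hr in
theorem invariantForm_isSymm : (invariantForm (m + 1) φ ψ r).IsSymm := by
  rw [Matrix.IsSymm, invariantForm_eq, Matrix.transpose_mul, Matrix.transpose_mul,
    Matrix.transpose_transpose, gramMatrix_transpose, Matrix.mul_assoc]

theorem left_invariant (hm : 2 * N = m + 1) :
    (companion (m + 1) φ).transpose * invariantForm (m + 1) φ ψ r * companion (m + 1) φ =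
      invariantForm (m + 1) φ ψ r := by
  have hP := hr.isUnit_basisMatrix hp hm
  have hcm := (hr.basisMatrix_commute hp hm).eq
  have h1 : (basisMatrix (m + 1) φ r)⁻¹ * companion (m + 1) φ =
      companion (m + 1) φ * (basisMatrix (m + 1) φ r)⁻¹ := by
    rw [← Matrix.mul_one (_ * companion (m + 1) φ), ← Matrix.mul_nonsing_inv _ hP,
      Matrix.mul_assoc, ← Matrix.mul_assoc (companion (m + 1) φ), ← hcm, ← Matrix.mul_assoc,
      ← Matrix.mul_assoc, Matrix.nonsing_inv_mul _ hP, Matrix.one_mul]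
  have h2 := congrArg Matrix.transpose h1
  rw [Matrix.transpose_mul, Matrix.transpose_mul] at h2
  rw [invariantForm_eq]
  calc _ = ((companion (m + 1) φ).transpose * ((basisMatrix (m + 1) φ r)⁻¹).transpose) *
      gramMatrix m φ ψ * ((basisMatrix (m + 1) φ r)⁻¹ * companion (m + 1) φ) := by
        simp only [Matrix.mul_assoc]
    _ = ((basisMatrix (m + 1) φ r)⁻¹).transpose * ((companion (m + 1) φ).transpose *
      gramMatrix m φ ψ * companion (m + 1) φ) * (basisMatrix (m + 1) φ r)⁻¹ := by
        rw [h1, h2]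
        simp only [Matrix.mul_assoc]
    _ = _ := by rw [gramMatrix_invariant hp hm]

omit hp hr in
/-- The last coordinate of `A^s w` in terms of the coordinates of `w`. -/
theorem companion_pow_mulVec_last (w : Fin (m + 1) → ℚ) (s : ℕ) (hs : s ≤ m) :
    (companion (m + 1) φ ^ s).mulVec w (Fin.last m) = w ⟨m - s, by omega⟩ -
      ∑ j ∈ Finset.range s, (φ.coeff (m - s + 1 + j) : ℚ) *
        (companion (m + 1) φ ^ j).mulVec w (Fin.last m) := by
  induction s generalizing w with
  | zero =>
    simp
    rfl
  | succ s ih =>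
    rw [pow_succ, ← Matrix.mulVec_mulVec, ih _ (by omega), Finset.sum_range_succ']
    have h1 : (companion (m + 1) φ).mulVec w ⟨m - s, by omega⟩ =
        w ⟨m - (s + 1), by omega⟩ - φ.coeff (m - s) * w (Fin.last m) := by
      rw [companion_eq_compMatrix]
      have h := compMatrix_mulVec_succ (f := φ.map (Int.castRingHom ℚ)) w
        ⟨m - (s + 1), by omega⟩
      have e : (⟨m - s, by omega⟩ : Fin (m + 1)) = Fin.succ ⟨m - (s + 1), by omega⟩ := by
        ext
        simp
        omega
      rw [e, h, coeff_map]
      simp only [eq_intCast]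
      congr 4
      omega
    rw [h1, pow_zero, Matrix.one_mulVec, show m - (s + 1) + 1 + 0 = m - s by omega]
    have h2 : ∀ j ∈ Finset.range s, (φ.coeff (m - s + 1 + j) : ℚ) *
        (companion (m + 1) φ ^ j).mulVec ((companion (m + 1) φ).mulVec w) (Fin.last m) =
        (φ.coeff (m - s + (j + 1)) : ℚ) *
        (companion (m + 1) φ ^ (j + 1)).mulVec w (Fin.last m) := by
      intro j _
      rw [Matrix.mulVec_mulVec, ← pow_succ]
      congr 3
      omega
    rw [Finset.sum_congr rfl h2]
    ring

/-- The numbers `ξ_k` are, up to a scalar, the last coordinates of the vectors `A^k r`: both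
satisfy the same recursion. -/
theorem pow_mulVec_last (hm : 2 * N = m + 1) (k : ℕ) (hk : k ≤ m) :
    (companion (m + 1) φ ^ k).mulVec r (Fin.last m) = r (Fin.last m) / 2 * xi φ ψ k := by
  induction k using Nat.strong_induction_on with
  | _ k ih =>
    rcases k with - | s
    · simp [xi]
    · have h1 := companion_pow_mulVec_last (φ := φ) ((companion (m + 1) φ).mulVec r) s (by omega)
      rw [Matrix.mulVec_mulVec, ← pow_succ] at h1
      have h2 := hp.sum_coeff_mul_xi (s + 1)
      rw [Finset.sum_range_succ, Finset.sum_range_succ'] at h2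
      have h3 : ∀ j ∈ Finset.range s, (φ.coeff (m - s + 1 + j) : ℚ) *
          (companion (m + 1) φ ^ j).mulVec ((companion (m + 1) φ).mulVec r) (Fin.last m) =
          -(r (Fin.last m) / 2) * ((φ.coeff (s + 1 - (j + 1)) : ℚ) * xi φ ψ (j + 1)) := by
        intro j hj
        have := Finset.mem_range.mp hj
        rw [Matrix.mulVec_mulVec, ← pow_succ, ih (j + 1) (by omega) (by omega),
          hp.coeff_left (k := m - s + 1 + j) (l := s + 1 - (j + 1)) (by omega)]
        push_cast
        ring
      rw [h1, Finset.sum_congr rfl h3, ← Finset.mul_sum, hr.left_mulVec hp]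
      simp only [Pi.smul_apply, smul_eq_mul]
      rw [hp.coeff_left (k := m - s) (l := s + 1) (by omega),
        hp.coeff_right (k := m - s) (l := s + 1) (by omega)]
      have h0 : xi φ ψ 0 = 2 := by simp [xi]
      simp only [h0, Nat.sub_zero, Nat.sub_self, hp.coeff_left_zero] at h2
      push_cast at h2 ⊢
      linear_combination (r (Fin.last m) / 2) * h2

theorem gram_eq (hm : 2 * N = m + 1) :
    (basisMatrix (m + 1) φ r).transpose * invariantForm (m + 1) φ ψ r *
      basisMatrix (m + 1) φ r = gramMatrix m φ ψ := by
  have hP := hr.isUnit_basisMatrix hp hm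
  rw [invariantForm_eq]
  calc _ = ((basisMatrix (m + 1) φ r)⁻¹ * basisMatrix (m + 1) φ r).transpose *
      gramMatrix m φ ψ * ((basisMatrix (m + 1) φ r)⁻¹ * basisMatrix (m + 1) φ r) := by
        rw [Matrix.transpose_mul]
        simp only [Matrix.mul_assoc]
    _ = _ := by rw [Matrix.nonsing_inv_mul _ hP]; simp

/-- Pairing with `r` is, up to a scalar, the last coordinate. -/
theorem form_mulVec (hm : 2 * N = m + 1) :
    (invariantForm (m + 1) φ ψ r).mulVec r =
      (2 / r (Fin.last m)) • (Pi.single (Fin.last m) 1 : Fin (m + 1) → ℚ) := by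
  have hP := hr.isUnit_basisMatrix hp hm
  have hc := hr.last_ne_zero hp
  have hPt : IsUnit (basisMatrix (m + 1) φ r).transpose := by
    rwa [Matrix.isUnit_iff_isUnit_det, Matrix.det_transpose]
  refine Matrix.mulVec_injective_iff_isUnit.mpr hPt ?_
  have hPe : r = (basisMatrix (m + 1) φ r).mulVec (Pi.single 0 1) := by
    ext i
    simp [basisMatrix]
  have h1 : (basisMatrix (m + 1) φ r).transpose.mulVec ((invariantForm (m + 1) φ ψ r).mulVec r) =
      (gramMatrix m φ ψ).mulVec (Pi.single 0 1) := by
    conv_lhs => enter [2, 2]; rw [hPe]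
    rw [Matrix.mulVec_mulVec, Matrix.mulVec_mulVec, hr.gram_eq hp hm]
  rw [h1, Matrix.mulVec_smul]
  ext i
  have h2 := hr.pow_mulVec_last hp hm i (by omega)
  simp [gramMatrix, basisMatrix, h2]
  field_simp

theorem dotProduct_form (hm : 2 * N = m + 1) (v : Fin (m + 1) → ℚ) :
    v ⬝ᵥ (invariantForm (m + 1) φ ψ r).mulVec r = 2 / r (Fin.last m) * v (Fin.last m) := by
  rw [hr.form_mulVec hp hm]
  simp

omit hp hr in
theorem form_comm (v w : Fin (m + 1) → ℚ) :
    v ⬝ᵥ (invariantForm (m + 1) φ ψ r).mulVec w = w ⬝ᵥ (invariantForm (m + 1) φ ψ r).mulVec v := by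
  rw [dotProduct_comm, Matrix.dotProduct_mulVec, ← Matrix.mulVec_transpose,
    invariantForm_isSymm.eq]

theorem form_left (hm : 2 * N = m + 1) (v w : Fin (m + 1) → ℚ) :
    (companion (m + 1) φ).mulVec v ⬝ᵥ
      (invariantForm (m + 1) φ ψ r).mulVec ((companion (m + 1) φ).mulVec w) =
      v ⬝ᵥ (invariantForm (m + 1) φ ψ r).mulVec w := by
  conv_rhs => rw [← hr.left_invariant hp hm]
  rw [← Matrix.mulVec_mulVec, ← Matrix.mulVec_mulVec,
    Matrix.dotProduct_mulVec v, Matrix.vecMul_transpose]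

theorem form_self (hm : 2 * N = m + 1) :
    r ⬝ᵥ (invariantForm (m + 1) φ ψ r).mulVec r = 2 := by
  have hc := hr.last_ne_zero hp
  rw [hr.dotProduct_form hp hm]
  field_simp

/-- `B` is an isometry, being the composition of the isometry `A` and a reflection. -/
theorem right_invariant (hm : 2 * N = m + 1) :
    (companion (m + 1) ψ).transpose * invariantForm (m + 1) φ ψ r * companion (m + 1) ψ =
      invariantForm (m + 1) φ ψ r := by
  refine matrix_ext_of_dotProduct fun v w => ?_
  have h : v ⬝ᵥ ((companion (m + 1) ψ).transpose * invariantForm (m + 1) φ ψ r *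
      companion (m + 1) ψ).mulVec w = (companion (m + 1) ψ).mulVec v ⬝ᵥ
      (invariantForm (m + 1) φ ψ r).mulVec ((companion (m + 1) ψ).mulVec w) := by
    rw [← Matrix.mulVec_mulVec, ← Matrix.mulVec_mulVec,
      Matrix.dotProduct_mulVec v, Matrix.vecMul_transpose]
  rw [h, hr.right_mulVec_eq_left hp, hr.right_mulVec_eq_left hp, hr.form_left hp hm]
  simp only [Matrix.mulVec_sub, Matrix.mulVec_smul, sub_dotProduct, dotProduct_sub,
    smul_dotProduct, dotProduct_smul, smul_eq_mul]
  rw [form_comm r w, hr.dotProduct_form hp hm, hr.dotProduct_form hp hm, hr.form_self hp hm]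
  ring

end IsReflectionVector
end Reflection

/-! ### The hypergeometric lattice -/

section Lattice

variable {N m : ℕ} {φ ψ : ℤ[X]} {r : Fin (m + 1) → ℚ}

theorem pow_mulVec_mem_lattice {k : ℕ} (hk : k ≤ m) :
    (companion (m + 1) φ ^ k).mulVec r ∈ lattice (m + 1) φ r :=
  Submodule.subset_span ⟨⟨k, by omega⟩, rfl⟩

theorem lattice_fg : (lattice (m + 1) φ r).FG := Submodule.fg_span (Set.finite_range _)

namespace IsReflectionVector

variable (hp : IsHypergeometricPair N φ ψ) (hr : IsReflectionVector (m + 1) φ ψ r)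

include hp hr

theorem span_lattice (hm : 2 * N = m + 1) :
    Submodule.span ℚ (lattice (m + 1) φ r : Set (Fin (m + 1) → ℚ)) = ⊤ := by
  have hP := hr.isUnit_basisMatrix hp hm
  refine eq_top_iff.mpr fun v _ => ?_
  have h : v = (basisMatrix (m + 1) φ r).mulVec ((basisMatrix (m + 1) φ r)⁻¹.mulVec v) := by
    rw [Matrix.mulVec_mulVec, Matrix.mul_nonsing_inv _ hP, Matrix.one_mulVec]
  have e : ∀ x, (basisMatrix (m + 1) φ r).mulVec x =
      ∑ k : Fin (m + 1), x k • (companion (m + 1) φ ^ (k : ℕ)).mulVec r := by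
    intro x
    ext i
    simp [Matrix.mulVec, dotProduct, basisMatrix, mul_comm]
  rw [h, e]
  refine Submodule.sum_mem _ fun k _ => ?_
  exact Submodule.smul_mem _ _ (Submodule.subset_span
    (pow_mulVec_mem_lattice (k := k) (Nat.lt_succ_iff.mp k.2)))

theorem finrank_lattice (hm : 2 * N = m + 1) :
    Module.finrank ℤ (lattice (m + 1) φ r) = m + 1 := by
  have hP := hr.isUnit_basisMatrix hp hm
  have h : LinearIndependent ℚ
      (fun k : Fin (m + 1) => (companion (m + 1) φ ^ (k : ℕ)).mulVec r) :=
    Matrix.linearIndependent_cols_of_isUnit ((Matrix.isUnit_iff_isUnit_det _).mpr hP)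
  have h2 := finrank_span_eq_card (h.restrict_scalars (R := ℤ)
    (fun a b hab => by simpa using hab))
  rw [Fintype.card_fin] at h2
  exact h2

omit hr in
theorem sum_coeff_smul_pow (hm : 2 * N = m + 1) (r : Fin (m + 1) → ℚ) :
    ∑ k ∈ Finset.range (m + 2), φ.coeff k • (companion (m + 1) φ ^ k).mulVec r = 0 := by
  have h0 : aeval (companion (m + 1) φ) (φ.map (Int.castRingHom ℚ)) = 0 := by
    rw [companion_eq_compMatrix]
    exact aeval_compMatrix_self (hp.monic_left.map _)
      (by rw [hp.monic_left.natDegree_map, hp.natDegree_left, hm])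
  rw [aeval_eq_sum_range' (n := m + 2)
    (by rw [hp.monic_left.natDegree_map, hp.natDegree_left, hm]; omega)] at h0
  have h1 := congrArg (fun S => S.mulVec r) h0
  simp only [Matrix.zero_mulVec, Matrix.sum_mulVec] at h1
  rw [← h1]
  refine Finset.sum_congr rfl fun k _ => ?_
  rw [Matrix.smul_mulVec, coeff_map]
  ext i
  simp

omit hr in
/-- The relation `φ(A) = 0` expresses `A^n r` through lower powers. -/
theorem left_mulVec_mem_lattice (hm : 2 * N = m + 1) {v : Fin (m + 1) → ℚ}
    (hv : v ∈ lattice (m + 1) φ r) :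
    (companion (m + 1) φ).mulVec v ∈ lattice (m + 1) φ r := by
  induction hv using Submodule.span_induction with
  | zero => rw [Matrix.mulVec_zero]; exact zero_mem _
  | add x y _ _ hx hy => rw [Matrix.mulVec_add]; exact add_mem hx hy
  | smul a x _ hx => rw [Matrix.mulVec_smul]; exact Submodule.smul_mem _ _ hx
  | mem x hx =>
    obtain ⟨k, rfl⟩ := hx
    simp only
    rw [Matrix.mulVec_mulVec, ← pow_succ']
    by_cases hk : (k : ℕ) + 1 ≤ m
    · exact pow_mulVec_mem_lattice hk
    · have hk' : (k : ℕ) + 1 = m + 1 := by omega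
      have h := sum_coeff_smul_pow hp hm r
      have htop : φ.coeff (m + 1) = 1 := by rw [← hm]; exact hp.coeff_left_top
      rw [Finset.sum_range_succ, htop, one_smul] at h
      rw [hk', eq_neg_of_add_eq_zero_right h]
      refine neg_mem (Submodule.sum_mem _ fun j hj => Submodule.smul_mem _ _ ?_)
      have := Finset.mem_range.mp hj
      exact pow_mulVec_mem_lattice (by omega)

omit hr in
/-- The constant coefficient `-1` of `φ` makes `A⁻¹` integral as well. -/
theorem exists_left_mulVec_eq (hm : 2 * N = m + 1) {v : Fin (m + 1) → ℚ}
    (hv : v ∈ lattice (m + 1) φ r) :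
    ∃ w ∈ lattice (m + 1) φ r, (companion (m + 1) φ).mulVec w = v := by
  induction hv using Submodule.span_induction with
  | zero => exact ⟨0, zero_mem _, Matrix.mulVec_zero _⟩
  | add x y _ _ hx hy =>
    obtain ⟨x', hx', rfl⟩ := hx
    obtain ⟨y', hy', rfl⟩ := hy
    exact ⟨x' + y', add_mem hx' hy', Matrix.mulVec_add _ _ _⟩
  | smul a x _ hx =>
    obtain ⟨x', hx', rfl⟩ := hx
    exact ⟨a • x', Submodule.smul_mem _ _ hx', Matrix.mulVec_smul _ _ _⟩
  | mem x hx =>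
    obtain ⟨⟨k, hk⟩, rfl⟩ := hx
    simp only
    rcases k with - | k
    · refine ⟨∑ k ∈ Finset.range (m + 1), φ.coeff (k + 1) • (companion (m + 1) φ ^ k).mulVec r,
        Submodule.sum_mem _ fun j hj => Submodule.smul_mem _ _ (pow_mulVec_mem_lattice ?_), ?_⟩
      · have := Finset.mem_range.mp hj
        omega
      · have h := sum_coeff_smul_pow hp hm r
        rw [Finset.sum_range_succ', hp.coeff_left_zero, neg_one_smul, add_neg_eq_zero] at h
        rw [← h, Matrix.mulVec_sum]
        refine Finset.sum_congr rfl fun k _ => ?_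
        rw [Matrix.mulVec_smul, Matrix.mulVec_mulVec, ← pow_succ']
    · refine ⟨_, pow_mulVec_mem_lattice (k := k) (by omega), ?_⟩
      rw [Matrix.mulVec_mulVec, ← pow_succ']

omit hp hr in
theorem exists_int_form
    (hL : IsUnimodular (lattice (m + 1) φ r) (invariantForm (m + 1) φ ψ r))
    {v w : Fin (m + 1) → ℚ} (hv : v ∈ lattice (m + 1) φ r) (hw : w ∈ lattice (m + 1) φ r) :
    ∃ z : ℤ, v ⬝ᵥ (invariantForm (m + 1) φ ψ r).mulVec w = z := by
  rw [← hL] at hv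
  have h := LinearMap.BilinForm.mem_dualSubmodule _ |>.mp hv w hw
  rw [Submodule.mem_one] at h
  obtain ⟨z, hz⟩ := h
  refine ⟨z, ?_⟩
  rw [Matrix.toBilin'_apply'] at hz
  rw [← hz]
  simp

theorem form_pow (hm : 2 * N = m + 1) (k : ℕ) :
    (companion (m + 1) φ ^ k).mulVec r ⬝ᵥ
      (invariantForm (m + 1) φ ψ r).mulVec ((companion (m + 1) φ ^ k).mulVec r) = 2 := by
  induction k with
  | zero => simpa using hr.form_self hp hm
  | succ k ih =>
    rw [pow_succ', ← Matrix.mulVec_mulVec, hr.form_left hp hm, ih]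

/-- The form is even because the lattice is generated by vectors of length `2` and unimodularity
makes it integral. -/
theorem form_even (hm : 2 * N = m + 1)
    (hL : IsUnimodular (lattice (m + 1) φ r) (invariantForm (m + 1) φ ψ r))
    {v : Fin (m + 1) → ℚ} (hv : v ∈ lattice (m + 1) φ r) :
    ∃ z : ℤ, v ⬝ᵥ (invariantForm (m + 1) φ ψ r).mulVec v = 2 * (z : ℚ) := by
  induction hv using Submodule.span_induction with
  | zero => exact ⟨0, by simp⟩
  | add x y hx' hy' hx hy =>
    obtain ⟨a, ha⟩ := hx
    obtain ⟨b, hb⟩ := hy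
    obtain ⟨c, hc⟩ := exists_int_form hL hx' hy'
    refine ⟨a + b + c, ?_⟩
    rw [Matrix.mulVec_add, add_dotProduct, dotProduct_add, dotProduct_add, form_comm y x, ha, hb,
      hc]
    push_cast
    ring
  | smul a x _ hx =>
    obtain ⟨z, hz⟩ := hx
    refine ⟨a * a * z, ?_⟩
    rw [← Int.cast_smul_eq_zsmul ℚ, Matrix.mulVec_smul, smul_dotProduct, dotProduct_smul, hz]
    simp only [smul_eq_mul]
    push_cast
    ring
  | mem x hx =>
    obtain ⟨k, rfl⟩ := hx
    exact ⟨1, (hr.form_pow hp hm k).trans (by norm_num)⟩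

/-- `B` is an automorphism of the lattice. -/
theorem map_right_lattice (hm : 2 * N = m + 1)
    (hL : IsUnimodular (lattice (m + 1) φ r) (invariantForm (m + 1) φ ψ r)) :
    (lattice (m + 1) φ r).map
      ((Matrix.toLin' (companion (m + 1) ψ)).restrictScalars ℤ) = lattice (m + 1) φ r := by
  have hc := hr.last_ne_zero hp
  have hrL : r ∈ lattice (m + 1) φ r := by
    simpa using pow_mulVec_mem_lattice (φ := φ) (r := r) (Nat.zero_le m)
  have hC : ∀ v ∈ lattice (m + 1) φ r,
      v - (2 / r (Fin.last m) * v (Fin.last m)) • r ∈ lattice (m + 1) φ r := by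
    intro v hv
    obtain ⟨z, hz⟩ := exists_int_form hL hv hrL
    rw [hr.dotProduct_form hp hm] at hz
    rw [hz, Int.cast_smul_eq_zsmul]
    exact sub_mem hv (Submodule.smul_mem _ _ hrL)
  refine le_antisymm ?_ ?_
  · rintro _ ⟨v, hv, rfl⟩
    change (companion (m + 1) ψ).mulVec v ∈ _
    rw [hr.right_mulVec_eq_left hp]
    exact left_mulVec_mem_lattice hp hm (hC v hv)
  · intro v hv
    obtain ⟨w, hw, rfl⟩ := exists_left_mulVec_eq hp hm hv
    refine ⟨_, hC w hw, ?_⟩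
    change (companion (m + 1) ψ).mulVec _ = _
    rw [hr.right_mulVec_eq_left hp]
    congr 1
    ext i
    simp
    field_simp
    ring

end IsReflectionVector
end Lattice

/-! ### Eigenvectors of `B` -/

/-- The complex bilinear extension of the form with matrix `M`. -/
def bform {n : ℕ} (M : Matrix (Fin n) (Fin n) ℚ) (v w : Fin n → ℂ) : ℂ :=
  v ⬝ᵥ (toC M).mulVec w

theorem hermForm_eq_bform {n : ℕ} (M : Matrix (Fin n) (Fin n) ℚ) (v w : Fin n → ℂ) :
    hermForm M v w = bform M v (star w) := rfl

/-- The complex vector with the given rational coordinates. -/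
def vecC {n : ℕ} (v : Fin n → ℚ) : Fin n → ℂ := fun i => (v i : ℂ)

section toC

variable {n : ℕ}

theorem toC_mulVec (M : Matrix (Fin n) (Fin n) ℚ) (v : Fin n → ℚ) :
    (toC M).mulVec (vecC v) = vecC (M.mulVec v) := by
  ext i
  simp [toC, vecC, Matrix.mulVec, dotProduct]

theorem toC_mul (M M' : Matrix (Fin n) (Fin n) ℚ) : toC (M * M') = toC M * toC M' :=
  Matrix.map_mul (f := Rat.castHom ℂ)

theorem star_toC_mulVec (M : Matrix (Fin n) (Fin n) ℚ) (v : Fin n → ℂ) :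
    star ((toC M).mulVec v) = (toC M).mulVec (star v) := by
  ext i
  simp [toC, Matrix.mulVec, dotProduct]

variable (M : Matrix (Fin n) (Fin n) ℚ)

theorem bform_add_left (v w x : Fin n → ℂ) : bform M (v + w) x = bform M v x + bform M w x :=
  add_dotProduct _ _ _

theorem bform_add_right (v w x : Fin n → ℂ) : bform M v (w + x) = bform M v w + bform M v x := by
  simp [bform, Matrix.mulVec_add]

theorem bform_sub_left (v w x : Fin n → ℂ) : bform M (v - w) x = bform M v x - bform M w x := by
  simp [bform, sub_dotProduct]

theorem bform_sub_right (v w x : Fin n → ℂ) : bform M v (w - x) = bform M v w - bform M v x := by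
  simp [bform, Matrix.mulVec_sub]

theorem bform_smul_left (a : ℂ) (v w : Fin n → ℂ) : bform M (a • v) w = a * bform M v w := by
  simp [bform]

theorem bform_smul_right (a : ℂ) (v w : Fin n → ℂ) : bform M v (a • w) = a * bform M v w := by
  simp [bform, Matrix.mulVec_smul]

theorem bform_smul_matrix (a : ℚ) (v w : Fin n → ℂ) : bform (a • M) v w = a * bform M v w := by
  have : toC (a • M) = (a : ℂ) • toC M := by
    ext i j
    simp [toC]
  simp [bform, this, Matrix.smul_mulVec]

theorem star_bform (v w : Fin n → ℂ) : star (bform M v w) = bform M (star v) (star w) := by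
  simp [bform, toC, Matrix.mulVec, dotProduct]

variable {M}

theorem bform_comm (hM : M.IsSymm) (v w : Fin n → ℂ) : bform M v w = bform M w v := by
  have : (toC M).transpose = toC M := by
    rw [toC, ← Matrix.transpose_map, hM.eq]
  rw [bform, dotProduct_comm, bform, Matrix.dotProduct_mulVec, ← Matrix.mulVec_transpose, this]

theorem bform_isometry {F : Matrix (Fin n) (Fin n) ℚ} (hF : F.transpose * M * F = M)
    (v w : Fin n → ℂ) : bform M ((toC F).mulVec v) ((toC F).mulVec w) = bform M v w := by
  have h : (toC F).transpose * toC M * toC F = toC M := by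
    conv_rhs => rw [← hF]
    rw [toC_mul, toC_mul]
    rfl
  rw [bform, bform]
  conv_rhs => rw [← h]
  rw [← Matrix.mulVec_mulVec, ← Matrix.mulVec_mulVec, Matrix.dotProduct_mulVec v,
    Matrix.vecMul_transpose]

/-- The adjoint of a polynomial in an isometry acts on an eigenvector through the inverse
eigenvalue. -/
theorem bform_aeval_of_eigenvector {F : Matrix (Fin n) (Fin n) ℚ}
    (hF : F.transpose * M * F = M) {ν : ℂ} (hν : ν ≠ 0) {w : Fin n → ℂ}
    (hw : (toC F).mulVec w = ν • w) (p : ℂ[X]) (x : Fin n → ℂ) :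
    bform M w ((aeval (toC F) p).mulVec x) = p.eval ν⁻¹ * bform M w x := by
  have h1 : ∀ x, bform M w ((toC F).mulVec x) = ν⁻¹ * bform M w x := by
    intro x
    rw [← bform_isometry hF w x, hw, bform_smul_left, inv_mul_cancel_left₀ hν]
  have h2 : ∀ k : ℕ, bform M w ((toC F ^ k).mulVec x) = ν⁻¹ ^ k * bform M w x := by
    intro k
    induction k with
    | zero => simp
    | succ k ih => rw [pow_succ', ← Matrix.mulVec_mulVec, h1, ih, pow_succ']; ring
  induction p using Polynomial.induction_on' with
  | add p q hp hq => rw [map_add, Matrix.add_mulVec, bform_add_right, hp, hq, eval_add, add_mul]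
  | monomial k a =>
    rw [aeval_monomial, eval_monomial, ← Algebra.smul_def, Matrix.smul_mulVec, bform_smul_right,
      h2, mul_assoc]

end toC

section Eigenvectors

variable {N m : ℕ} {φ ψ : ℤ[X]} {r : Fin (m + 1) → ℚ}

theorem aeval_mulVec_of_eigenvector {n : ℕ} {F : Matrix (Fin n) (Fin n) ℂ} {ν : ℂ}
    {w : Fin n → ℂ} (hw : F.mulVec w = ν • w) (p : ℂ[X]) :
    (aeval F p).mulVec w = p.eval ν • w := by
  have h2 : ∀ k : ℕ, (F ^ k).mulVec w = ν ^ k • w := by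
    intro k
    induction k with
    | zero => simp
    | succ k ih => rw [pow_succ', ← Matrix.mulVec_mulVec, ih, Matrix.mulVec_smul, hw, smul_smul,
        pow_succ]
  induction p using Polynomial.induction_on' with
  | add p q hp hq => rw [map_add, Matrix.add_mulVec, hp, hq, eval_add, add_smul]
  | monomial k a =>
    rw [aeval_monomial, eval_monomial, ← Algebra.smul_def, Matrix.smul_mulVec, h2, smul_smul]

/-- The quotient `ψ(z)/(z - μ)`. -/
noncomputable def quot (ψ : ℤ[X]) (μ : ℂ) : ℂ[X] := ψ.map (Int.castRingHom ℂ) /ₘ (X - C μ)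

theorem mul_quot {μ : ℂ} (hμ : aeval μ ψ = 0) :
    (X - C μ) * quot ψ μ = ψ.map (Int.castRingHom ℂ) := by
  refine mul_divByMonic_eq_iff_isRoot.mpr ?_
  rwa [IsRoot, eval_map, ← algebraMap_int_eq, ← aeval_def]

theorem eval_quot_self {μ : ℂ} (hμ : aeval μ ψ = 0) :
    (quot ψ μ).eval μ = aeval μ (derivative ψ) := by
  have h := congrArg (fun p => eval μ (derivative p)) (mul_quot hμ)
  simp only [derivative_mul, derivative_map] at h
  simp only [derivative_sub, derivative_X, derivative_C, sub_zero, one_mul, eval_add, eval_mul,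
    eval_sub, eval_X, eval_C, sub_self, zero_mul, add_zero] at h
  rw [h, eval_map, ← algebraMap_int_eq, ← aeval_def]

/-- The eigenvector `q(B) r`, `q(z) = ψ(z)/(z - μ)`, of `B` for a root `μ` of `ψ`. For a simple root
it is a multiple of the component of `r` in the eigenspace. -/
noncomputable def eigvec (ψ : ℤ[X]) (r : Fin (m + 1) → ℚ) (μ : ℂ) : Fin (m + 1) → ℂ :=
  (aeval (toC (companion (m + 1) ψ)) (quot ψ μ)).mulVec (vecC r)

theorem star_eigvec (μ : ℂ) : star (eigvec ψ r μ) = eigvec ψ r (star μ) := by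
  have h1 : ∀ (p : ℂ[X]) (v : Fin (m + 1) → ℂ),
      star ((aeval (toC (companion (m + 1) ψ)) p).mulVec v) =
      (aeval (toC (companion (m + 1) ψ)) (p.map (starRingEnd ℂ))).mulVec (star v) := by
    intro p v
    have h2 : ∀ k : ℕ, star ((toC (companion (m + 1) ψ) ^ k).mulVec v) =
        (toC (companion (m + 1) ψ) ^ k).mulVec (star v) := by
      intro k
      induction k with
      | zero => simp
      | succ k ih =>
        rw [pow_succ', ← Matrix.mulVec_mulVec, star_toC_mulVec, ih, Matrix.mulVec_mulVec]
    induction p using Polynomial.induction_on' with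
    | add p q hp hq => rw [map_add, Matrix.add_mulVec, star_add, hp, hq, Polynomial.map_add,
        map_add, Matrix.add_mulVec]
    | monomial k a =>
      rw [aeval_monomial, map_monomial, aeval_monomial, ← Algebra.smul_def, ← Algebra.smul_def,
        Matrix.smul_mulVec, Matrix.smul_mulVec, star_smul, h2]
      rfl
  rw [eigvec, h1, eigvec]
  congr 2
  · rw [quot, quot, map_divByMonic _ (monic_X_sub_C μ)]
    congr 1
    · rw [Polynomial.map_map]
      congr 1
      ext
      simp
    · simp
  · ext i
    simp [vecC]

variable (hp : IsHypergeometricPair N φ ψ)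

include hp in
theorem aeval_companion_right (hm : 2 * N = m + 1) :
    aeval (toC (companion (m + 1) ψ)) (ψ.map (Int.castRingHom ℂ)) = 0 := by
  rw [toC_companion]
  exact aeval_compMatrix_self (hp.monic_right.map _)
    (by rw [hp.monic_right.natDegree_map, hp.natDegree_right, hm])

include hp in
theorem quot_mulVec_eigen (hm : 2 * N = m + 1) {μ : ℂ} (hμ : aeval μ ψ = 0)
    (x : Fin (m + 1) → ℂ) :
    (toC (companion (m + 1) ψ)).mulVec
      ((aeval (toC (companion (m + 1) ψ)) (quot ψ μ)).mulVec x) =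
      μ • (aeval (toC (companion (m + 1) ψ)) (quot ψ μ)).mulVec x := by
  have h := congrArg (fun p => (aeval (toC (companion (m + 1) ψ)) p).mulVec x) (mul_quot hμ)
  simp only [aeval_companion_right hp hm, map_mul, map_sub, aeval_X, aeval_C,
    Matrix.zero_mulVec] at h
  rw [← Matrix.mulVec_mulVec, Matrix.sub_mulVec, sub_eq_zero] at h
  rw [h, Algebra.algebraMap_eq_smul_one, Matrix.smul_mulVec, Matrix.one_mulVec]

include hp in
theorem eigvec_eigen (hm : 2 * N = m + 1) {μ : ℂ} (hμ : aeval μ ψ = 0) :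
    (toC (companion (m + 1) ψ)).mulVec (eigvec ψ r μ) = μ • eigvec ψ r μ :=
  quot_mulVec_eigen hp hm hμ _

include hp in
theorem root_of_eigenvector (hm : 2 * N = m + 1) {μ : ℂ} {w : Fin (m + 1) → ℂ} (hw0 : w ≠ 0)
    (hw : (toC (companion (m + 1) ψ)).mulVec w = μ • w) : aeval μ ψ = 0 := by
  have h := aeval_mulVec_of_eigenvector hw (ψ.map (Int.castRingHom ℂ))
  rw [aeval_companion_right hp hm, Matrix.zero_mulVec] at h
  have h2 := (smul_eq_zero.mp h.symm).resolve_right hw0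
  rwa [eval_map, ← algebraMap_int_eq, ← aeval_def] at h2

include hp in
theorem IsHypergeometricPair.root_ne_zero {μ : ℂ} (hμ : aeval μ ψ = 0) : μ ≠ 0 := by
  rintro rfl
  rw [aeval_def, eval₂_at_zero, hp.coeff_right_zero] at hμ
  simp at hμ

include hp in
theorem IsHypergeometricPair.left_ne_zero {μ : ℂ} (hμ : aeval μ ψ = 0) : aeval μ φ ≠ 0 := by
  intro h
  obtain ⟨u, w, huw⟩ := hp.coprime
  have h2 := congrArg (aeval μ) huw
  have e : ∀ f : ℤ[X], aeval μ (f.map (Int.castRingHom ℚ)) = aeval μ f := fun f => by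
    rw [← algebraMap_int_eq, aeval_map_algebraMap]
  rw [map_add, map_mul, map_mul, e, e, h, hμ] at h2
  simp at h2

namespace IsReflectionVector

variable (hr : IsReflectionVector (m + 1) φ ψ r)

include hp hr

theorem bform_vecC (hm : 2 * N = m + 1) (v : Fin (m + 1) → ℂ) :
    bform (invariantForm (m + 1) φ ψ r) v (vecC r) =
      2 / (r (Fin.last m) : ℂ) * v (Fin.last m) := by
  rw [bform, toC_mulVec, hr.form_mulVec hp hm, dotProduct, Finset.sum_eq_single (Fin.last m)]
  · simp [vecC]
    ring
  · intro i _ hi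
    simp [vecC, hi]
  · simp

theorem right_mulVec_vecC (hm : 2 * N = m + 1) :
    (toC (companion (m + 1) ψ)).mulVec (vecC r) =
      ((r (Fin.last m) : ℂ) / 2) • (aeval (toC (companion (m + 1) ψ))
        (φ.map (Int.castRingHom ℂ))).mulVec (Pi.single 0 1) := by
  rw [toC_mulVec, hr.right_mulVec_eq hp, toC_companion, aeval_mulVec_of_monic
    (hp.monic_left.map _) (by rw [hp.monic_left.natDegree_map, hp.natDegree_left, hm])]
  ext i
  simp [vecC]

/-- The last coordinate of `v_μ`, computed by letting `B` act on `r` first: `B r` is a multiple of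
`φ(B) e_0`. -/
theorem eigvec_last (hm : 2 * N = m + 1) {μ : ℂ} (hμ : aeval μ ψ = 0) :
    eigvec ψ r μ (Fin.last m) = (r (Fin.last m) : ℂ) / 2 * (aeval μ φ / μ) := by
  have hμ0 := hp.root_ne_zero hμ
  set F := toC (companion (m + 1) ψ) with hF
  have h1 : μ • eigvec ψ r μ = ((r (Fin.last m) : ℂ) / 2 * aeval μ φ) •
      (aeval F (quot ψ μ)).mulVec (Pi.single 0 1) := by
    rw [← eigvec_eigen hp hm hμ, eigvec, ← hF, Matrix.mulVec_mulVec]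
    have hcm : F * aeval F (quot ψ μ) = aeval F (quot ψ μ) * F := by
      rw [hF, toC_companion]
      exact (aeval_compMatrix_commute _).eq.symm
    rw [hcm, ← Matrix.mulVec_mulVec, hr.right_mulVec_vecC hp hm, Matrix.mulVec_smul,
      Matrix.mulVec_mulVec, ← map_mul, mul_comm, map_mul, ← Matrix.mulVec_mulVec,
      aeval_mulVec_of_eigenvector (quot_mulVec_eigen hp hm hμ _), smul_smul, eval_map,
      ← algebraMap_int_eq, ← aeval_def]
  have hd : (quot ψ μ).natDegree = m := by
    rw [quot, natDegree_divByMonic _ (monic_X_sub_C μ), natDegree_X_sub_C,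
      hp.monic_right.natDegree_map, hp.natDegree_right, hm, Nat.add_sub_cancel]
  have hmon : (quot ψ μ).Monic := by
    have h := hp.monic_right.map (Int.castRingHom ℂ)
    rw [← mul_quot hμ] at h
    exact (monic_X_sub_C μ).of_mul_monic_left h
  have h2 : (aeval F (quot ψ μ)).mulVec (Pi.single 0 1) (Fin.last m) = 1 := by
    rw [hF, toC_companion, aeval_mulVec_of_natDegree_le hd.le]
    have := hmon.coeff_natDegree
    rwa [hd] at this
  have h3 := congrFun h1 (Fin.last m)
  rw [Pi.smul_apply, Pi.smul_apply, h2, smul_eq_mul, smul_eq_mul, mul_one] at h3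
  field_simp
  linear_combination 2 * h3

theorem eigvec_ne_zero (hm : 2 * N = m + 1) {μ : ℂ} (hμ : aeval μ ψ = 0) :
    eigvec ψ r μ ≠ 0 := by
  intro h
  have h1 := hr.eigvec_last hp hm hμ
  rw [h] at h1
  have hc := hr.last_ne_zero hp
  have := hp.left_ne_zero hμ
  have := hp.root_ne_zero hμ
  simp_all

/-- The eigenspaces of `B` are lines. -/
theorem eq_smul_eigvec (hm : 2 * N = m + 1) {μ : ℂ} (hμ : aeval μ ψ = 0) {w : Fin (m + 1) → ℂ}
    (hw : (toC (companion (m + 1) ψ)).mulVec w = μ • w) : ∃ a : ℂ, w = a • eigvec ψ r μ := by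
  have h1 := hr.eigvec_last hp hm hμ
  have h0 : eigvec ψ r μ (Fin.last m) ≠ 0 := by
    intro h
    refine hr.eigvec_ne_zero hp hm hμ ?_
    have h2 := eigvec_eigen (r := r) hp hm hμ
    rw [toC_companion] at h2
    exact eq_zero_of_eigenvector h2 h
  refine ⟨w (Fin.last m) / eigvec ψ r μ (Fin.last m), ?_⟩
  rw [← sub_eq_zero]
  refine eq_zero_of_eigenvector (f := ψ.map (Int.castRingHom ℂ)) (μ := μ) ?_ ?_
  · rw [← toC_companion, Matrix.mulVec_sub, hw, Matrix.mulVec_smul, eigvec_eigen hp hm hμ,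
      smul_sub, smul_comm]
  · simp [h0]

/-- The pairing of the eigenvectors for `μ` and `μ⁻¹`: by invariance it is
`ψ'(μ⁻¹)` times the pairing of the first one with `r`. -/
theorem bform_eigvec (hm : 2 * N = m + 1) {μ : ℂ} (hμ : aeval μ ψ = 0)
    (hμ' : aeval μ⁻¹ ψ = 0) :
    bform (invariantForm (m + 1) φ ψ r) (eigvec ψ r μ) (eigvec ψ r μ⁻¹) =
      aeval μ⁻¹ (derivative ψ) * (aeval μ φ / μ) := by
  have hμ0 := hp.root_ne_zero hμ
  have hc : (r (Fin.last m) : ℂ) ≠ 0 := by exact_mod_cast hr.last_ne_zero hp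
  conv_lhs => enter [3]; rw [eigvec]
  rw [bform_aeval_of_eigenvector (hr.right_invariant hp hm) hμ0 (eigvec_eigen hp hm hμ),
    eval_quot_self hμ', hr.bform_vecC hp hm, hr.eigvec_last hp hm hμ]
  field_simp

end IsReflectionVector
end Eigenvectors

/-! ### Trace polynomials -/

theorem dickson_one_one_natDegree_monic (k : ℕ) :
    (dickson 1 (1 : ℤ) (k + 1)).natDegree = k + 1 ∧ (dickson 1 (1 : ℤ) (k + 1)).Monic := by
  induction k using Nat.strong_induction_on with
  | _ k ih =>
    match k with
    | 0 => rw [zero_add, dickson_one]; exact ⟨natDegree_X, monic_X⟩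
    | 1 =>
      rw [dickson_two]
      constructor
      · compute_degree!
      · norm_num
        monicity!
    | k + 2 =>
      obtain ⟨h1, h1'⟩ := ih (k + 1) (by omega)
      obtain ⟨h2, -⟩ := ih k (by omega)
      have e : (X * dickson 1 (1 : ℤ) (k + 2)).natDegree = k + 3 := by
        rw [monic_X.natDegree_mul h1', natDegree_X, h1]
        omega
      have hlt : (dickson 1 (1 : ℤ) (k + 1)).degree < (X * dickson 1 (1 : ℤ) (k + 2)).degree := by
        refine degree_lt_degree ?_
        rw [e, h2]
        omega
      rw [show k + 2 + 1 = (k + 1) + 2 by ring, dickson_add_two, C_1, one_mul]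
      refine ⟨?_, (monic_X.mul h1').sub_of_left hlt⟩
      rw [natDegree_sub_eq_left_of_natDegree_lt (by rw [e, h2]; omega), e]

theorem tracePolynomial_natDegree_monic {N : ℕ} {f : ℤ[X]} (hf : f.Monic)
    (hd : f.natDegree = 2 * N) :
    (tracePolynomial N f).natDegree = N ∧ (tracePolynomial N f).Monic := by
  rcases N with - | N
  · have h1 : f = 1 := hf.natDegree_eq_zero.mp (by simpa using hd)
    simp [tracePolynomial, h1]
  · have hlead : f.coeff (N + 1 + N + 1) = 1 := by
      rw [show N + 1 + N + 1 = f.natDegree by omega]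
      exact hf
    obtain ⟨h1, h2⟩ := dickson_one_one_natDegree_monic N
    have hlt : (C (f.coeff (N + 1)) +
        ∑ k ∈ Finset.range N, C (f.coeff (N + 1 + k + 1)) * dickson 1 1 (k + 1)).natDegree <
        (dickson 1 (1 : ℤ) (N + 1)).natDegree := by
      rw [h1, Nat.lt_succ_iff]
      refine (natDegree_add_le _ _).trans (max_le (by simp) ?_)
      refine natDegree_sum_le_of_forall_le _ _ fun k hk => ?_
      refine (natDegree_C_mul_le _ _).trans ?_
      rw [(dickson_one_one_natDegree_monic k).1]
      have := Finset.mem_range.mp hk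
      omega
    rw [tracePolynomial, Finset.sum_range_succ, hlead, C_1, one_mul, ← add_assoc]
    exact ⟨by rw [natDegree_add_eq_right_of_natDegree_lt hlt, h1],
      h2.add_of_right (degree_lt_degree hlt)⟩

theorem exists_add_inv_eq (τ : ℂ) : ∃ μ : ℂ, μ ≠ 0 ∧ μ + μ⁻¹ = τ := by
  obtain ⟨s, hs⟩ := IsAlgClosed.exists_pow_nat_eq (τ ^ 2 - 4) (n := 2) (by norm_num)
  have h0 : (τ + s) / 2 ≠ 0 := by
    intro h
    have h1 : s = -τ := by linear_combination 2 * h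
    rw [h1] at hs
    have h4 : (4 : ℂ) = 0 := by linear_combination hs
    norm_num at h4
  refine ⟨(τ + s) / 2, h0, ?_⟩
  have h1 : τ + s ≠ 0 := fun h => h0 (by rw [h]; simp)
  field_simp
  linear_combination hs

section TracePair

variable {N m : ℕ} {φ ψ : ℤ[X]}

namespace IsHypergeometricPair

variable (hp : IsHypergeometricPair N φ ψ)

include hp

theorem aeval_left_of_sq {μ : ℂ} (hμ : μ ^ 2 = 1) (hN : 1 ≤ N) : aeval μ φ = 0 := by
  have h0 : μ ≠ 0 := by
    rintro rfl
    norm_num at hμ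
  rw [antiTracePolynomial_spec N hN φ hp.natDegree_left hp.antipalindromic μ h0, hμ]
  simp

theorem root_sq_ne_one (hN : 1 ≤ N) {μ : ℂ} (hμ : aeval μ ψ = 0) : μ ^ 2 ≠ 1 := fun h =>
  hp.left_ne_zero hμ (hp.aeval_left_of_sq h hN)

theorem root_iff {μ : ℂ} (h0 : μ ≠ 0) :
    aeval μ ψ = 0 ↔ aeval (μ + μ⁻¹) (tracePolynomial N ψ) = 0 := by
  rw [tracePolynomial_spec N ψ hp.natDegree_right.le hp.palindromic μ h0]
  simp [h0]

theorem root_inv {μ : ℂ} (hμ : aeval μ ψ = 0) : aeval μ⁻¹ ψ = 0 := by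
  have h0 := hp.root_ne_zero hμ
  rw [hp.root_iff (inv_ne_zero h0), inv_inv, add_comm, ← hp.root_iff h0]
  exact hμ

/-- Differentiating `ψ(z) = z^N Ψ(z + 1/z)` at a root. -/
theorem aeval_derivative_right {μ : ℂ} (hμ : aeval μ ψ = 0) :
    aeval μ (derivative ψ) = μ ^ N * (1 - (μ ^ 2)⁻¹) *
      aeval (μ + μ⁻¹) (derivative (tracePolynomial N ψ)) := by
  have h0 := hp.root_ne_zero hμ
  have h1 : HasDerivAt (fun z : ℂ => aeval z ψ) (aeval μ (derivative ψ)) μ :=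
    ψ.hasDerivAt_aeval μ
  have h2 : HasDerivAt (fun z : ℂ => z ^ N * aeval (z + z⁻¹) (tracePolynomial N ψ))
      (N * μ ^ (N - 1) * aeval (μ + μ⁻¹) (tracePolynomial N ψ) +
        μ ^ N * (aeval (μ + μ⁻¹) (derivative (tracePolynomial N ψ)) * (1 + -(μ ^ 2)⁻¹))) μ := by
    refine (hasDerivAt_pow N μ).mul ?_
    exact ((tracePolynomial N ψ).hasDerivAt_aeval (μ + μ⁻¹)).comp μ
      ((hasDerivAt_id μ).add (hasDerivAt_inv h0))
  have h3 : (fun z : ℂ => aeval z ψ) =ᶠ[nhds μ]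
      (fun z : ℂ => z ^ N * aeval (z + z⁻¹) (tracePolynomial N ψ)) := by
    filter_upwards [isOpen_ne.mem_nhds h0] with z hz
    exact tracePolynomial_spec N ψ hp.natDegree_right.le hp.palindromic z hz
  rw [(h1.congr_of_eventuallyEq h3.symm).unique h2, (hp.root_iff h0).mp hμ]
  ring

/-- The squared length of an eigenvector in terms of trace polynomials. -/
theorem bform_eigvec_trace (hm : 2 * N = m + 1) {r : Fin (m + 1) → ℚ}
    (hr : IsReflectionVector (m + 1) φ ψ r) {μ : ℂ} (hμ : aeval μ ψ = 0) :
    bform (invariantForm (m + 1) φ ψ r) (eigvec ψ r μ) (eigvec ψ r μ⁻¹) =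
      (4 - (μ + μ⁻¹) ^ 2) * aeval (μ + μ⁻¹) (antiTracePolynomial N φ) *
        aeval (μ + μ⁻¹) (derivative (tracePolynomial N ψ)) := by
  have h0 := hp.root_ne_zero hμ
  rw [hr.bform_eigvec hp hm hμ (hp.root_inv hμ), hp.aeval_derivative_right (hp.root_inv hμ),
    antiTracePolynomial_spec N (by omega) φ hp.natDegree_left hp.antipalindromic μ h0, inv_inv,
    add_comm μ⁻¹]
  obtain ⟨n, rfl⟩ : ∃ n, N = n + 1 := ⟨N - 1, by omega⟩
  generalize aeval (μ + μ⁻¹) (derivative (tracePolynomial (n + 1) ψ)) = y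
  generalize aeval (μ + μ⁻¹) (antiTracePolynomial (n + 1) φ) = x
  rw [Nat.add_sub_cancel]
  simp only [inv_pow]
  field_simp
  ring

theorem left_monic (hN : 1 ≤ N) :
    (antiTracePolynomial N φ).natDegree = N - 1 ∧ (antiTracePolynomial N φ).Monic := by
  have hX : (X ^ 2 - 1 : ℤ[X]).Monic := by monicity!
  have hXd : (X ^ 2 - 1 : ℤ[X]).natDegree = 2 := by compute_degree!
  refine tracePolynomial_natDegree_monic ?_ ?_
  · rw [Monic, leadingCoeff_divByMonic_of_monic hX]
    · exact hp.monic_left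
    · rw [degree_eq_natDegree hX.ne_zero, degree_eq_natDegree hp.monic_left.ne_zero, hXd,
        hp.natDegree_left]
      exact_mod_cast (by omega : 2 ≤ 2 * N)
  · rw [natDegree_divByMonic _ hX, hXd, hp.natDegree_left]
    omega

theorem right_monic :
    (tracePolynomial N ψ).natDegree = N ∧ (tracePolynomial N ψ).Monic :=
  tracePolynomial_natDegree_monic hp.monic_right hp.natDegree_right

/-- The trace polynomials have no common roots. -/
theorem trace_left_ne_zero (hN : 1 ≤ N) {τ : ℂ} (hτ : aeval τ (tracePolynomial N ψ) = 0) :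
    aeval τ (antiTracePolynomial N φ) ≠ 0 := by
  obtain ⟨μ, h0, rfl⟩ := exists_add_inv_eq τ
  intro h
  refine hp.left_ne_zero ((hp.root_iff h0).mpr hτ) ?_
  rw [antiTracePolynomial_spec N hN φ hp.natDegree_left hp.antipalindromic μ h0, h, mul_zero]

end IsHypergeometricPair
end TracePair

/-! ### Hermitian forms and signatures -/

section Hermitian

variable {n : ℕ} {M : Matrix (Fin n) (Fin n) ℚ}

theorem hermForm_add_left (v w x : Fin n → ℂ) :
    hermForm M (v + w) x = hermForm M v x + hermForm M w x := bform_add_left _ _ _ _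

theorem hermForm_add_right (v w x : Fin n → ℂ) :
    hermForm M v (w + x) = hermForm M v w + hermForm M v x := by
  simp only [hermForm_eq_bform, star_add, bform_add_right]

theorem hermForm_sub_left (v w x : Fin n → ℂ) :
    hermForm M (v - w) x = hermForm M v x - hermForm M w x := bform_sub_left _ _ _ _

theorem hermForm_sub_right (v w x : Fin n → ℂ) :
    hermForm M v (w - x) = hermForm M v w - hermForm M v x := by
  simp only [hermForm_eq_bform, star_sub, bform_sub_right]

theorem hermForm_smul_left (a : ℂ) (v w : Fin n → ℂ) :
    hermForm M (a • v) w = a * hermForm M v w := bform_smul_left _ _ _ _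

theorem hermForm_smul_right (a : ℂ) (v w : Fin n → ℂ) :
    hermForm M v (a • w) = star a * hermForm M v w := by
  simp only [hermForm_eq_bform, star_smul, bform_smul_right]

theorem hermForm_zero_left (w : Fin n → ℂ) : hermForm M 0 w = 0 := by
  simp [hermForm]

theorem hermForm_sum_left {ι : Type*} (s : Finset ι) (v : ι → Fin n → ℂ) (w : Fin n → ℂ) :
    hermForm M (∑ i ∈ s, v i) w = ∑ i ∈ s, hermForm M (v i) w := by
  simp [hermForm, sum_dotProduct]

theorem hermForm_sum_right {ι : Type*} (s : Finset ι) (v : ι → Fin n → ℂ) (w : Fin n → ℂ) :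
    hermForm M w (∑ i ∈ s, v i) = ∑ i ∈ s, hermForm M w (v i) := by
  simp [hermForm, star_sum, Matrix.mulVec_sum, dotProduct_sum]

theorem hermForm_smul_matrix (a : ℚ) (v w : Fin n → ℂ) :
    hermForm (a • M) v w = a * hermForm M v w := bform_smul_matrix _ _ _ _

theorem star_hermForm (hM : M.IsSymm) (v w : Fin n → ℂ) :
    star (hermForm M v w) = hermForm M w v := by
  rw [hermForm_eq_bform, star_bform, star_star, bform_comm hM, hermForm_eq_bform]

theorem hermForm_eq_zero_comm (hM : M.IsSymm) {v w : Fin n → ℂ} (h : hermForm M v w = 0) :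
    hermForm M w v = 0 := by
  rw [← star_hermForm hM, h, star_zero]

theorem hermForm_star_left (v w : Fin n → ℂ) :
    hermForm M (star v) w = star (hermForm M v (star w)) := by
  rw [hermForm_eq_bform, hermForm_eq_bform, star_bform, star_star]

theorem hermForm_star_self (hM : M.IsSymm) (v : Fin n → ℂ) :
    hermForm M (star v) (star v) = hermForm M v v := by
  rw [hermForm_star_left, star_star, star_hermForm hM]

theorem hermForm_isometry {F : Matrix (Fin n) (Fin n) ℚ} (hF : F.transpose * M * F = M)
    (v w : Fin n → ℂ) :
    hermForm M ((toC F).mulVec v) ((toC F).mulVec w) = hermForm M v w := by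
  rw [hermForm_eq_bform, star_toC_mulVec, bform_isometry hF, hermForm_eq_bform]

/-- Eigenvectors of an isometry for `μ`, `ν` are orthogonal unless `μ ν̄ = 1`. -/
theorem hermForm_eigenvectors {F : Matrix (Fin n) (Fin n) ℚ} (hF : F.transpose * M * F = M)
    {μ ν : ℂ} {v w : Fin n → ℂ} (hv : (toC F).mulVec v = μ • v) (hw : (toC F).mulVec w = ν • w)
    (h : μ * star ν ≠ 1) : hermForm M v w = 0 := by
  have h1 := hermForm_isometry hF v w
  rw [hv, hw, hermForm_smul_left, hermForm_smul_right] at h1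
  have h2 : (μ * star ν - 1) * hermForm M v w = 0 := by linear_combination h1
  exact (mul_eq_zero.mp h2).resolve_left (sub_ne_zero.mpr h)

/-- Two subspaces of `W`, one definite and the other semidefinite of the opposite sign, are
disjoint. The sign is recorded by the real number `e`. -/
theorem finrank_add_finrank_le {e : ℝ} {P Q W : Submodule ℂ (Fin n → ℂ)} (hPW : P ≤ W)
    (hQW : Q ≤ W) (hP : ∀ v ∈ P, v ≠ 0 → 0 < e * (hermForm M v v).re)
    (hQ : ∀ v ∈ Q, e * (hermForm M v v).re ≤ 0) :
    Module.finrank ℂ P + Module.finrank ℂ Q ≤ Module.finrank ℂ W := by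
  have hd : P ⊓ Q = ⊥ := by
    refine (Submodule.eq_bot_iff _).mpr fun v hv => ?_
    by_contra h0
    exact absurd (hQ v hv.2) (not_le.mpr (hP v hv.1 h0))
  have h := Submodule.finrank_sup_add_finrank_inf_eq P Q
  rw [hd, finrank_bot, add_zero] at h
  rw [← h]
  exact Submodule.finrank_mono (sup_le hPW hQW)

/-- An orthogonal family of vectors of positive (`e > 0`) or negative (`e < 0`) length is linearly
independent and spans a definite subspace. -/
theorem orthogonal_family {ι : Type*} [Fintype ι] {e : ℝ} {w : ι → Fin n → ℂ}
    (horth : ∀ i j, i ≠ j → hermForm M (w i) (w j) = 0)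
    (hw : ∀ i, 0 < e * (hermForm M (w i) (w i)).re) :
    Module.finrank ℂ (Submodule.span ℂ (Set.range w)) = Fintype.card ι ∧
      ∀ v ∈ Submodule.span ℂ (Set.range w), v ≠ 0 → 0 < e * (hermForm M v v).re := by
  classical
  have hself : ∀ (c : ι → ℂ) (j : ι), hermForm M (∑ i, c i • w i) (w j) =
      c j * hermForm M (w j) (w j) := by
    intro c j
    rw [hermForm_sum_left, Finset.sum_eq_single j]
    · rw [hermForm_smul_left]
    · intro i _ hij
      rw [hermForm_smul_left, horth i j hij, mul_zero]
    · simp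
  have hne : ∀ j, hermForm M (w j) (w j) ≠ 0 := by
    intro j h
    have := hw j
    rw [h] at this
    simp at this
  constructor
  · refine finrank_span_eq_card (Fintype.linearIndependent_iff.mpr fun c hc j => ?_)
    have h := hself c j
    rw [hc, hermForm_zero_left] at h
    exact (mul_eq_zero.mp h.symm).resolve_right (hne j)
  · intro v hv hv0
    obtain ⟨c, rfl⟩ := (Submodule.mem_span_range_iff_exists_fun ℂ).mp hv
    have h : hermForm M (∑ i, c i • w i) (∑ i, c i • w i) =
        ∑ i, ((‖c i‖ ^ 2 : ℝ) : ℂ) * hermForm M (w i) (w i) := by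
      rw [hermForm_sum_right]
      refine Finset.sum_congr rfl fun j _ => ?_
      rw [hermForm_smul_right, hself, ← mul_assoc]
      congr 1
      rw [mul_comm, Complex.star_def, Complex.mul_conj, Complex.normSq_eq_norm_sq]
    rw [h, Complex.re_sum, Finset.mul_sum]
    have hex : ∃ j, c j ≠ 0 := by
      by_contra! hall
      exact hv0 (Finset.sum_eq_zero fun i _ => by rw [hall i, zero_smul])
    obtain ⟨j, hj⟩ := hex
    have hterm : ∀ i, e * (((‖c i‖ ^ 2 : ℝ) : ℂ) * hermForm M (w i) (w i)).re =
        ‖c i‖ ^ 2 * (e * (hermForm M (w i) (w i)).re) := by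
      intro i
      rw [Complex.re_ofReal_mul]
      ring
    refine Finset.sum_pos' (fun i _ => ?_) ⟨j, Finset.mem_univ j, ?_⟩
    · rw [hterm]
      exact mul_nonneg (by positivity) (hw i).le
    · rw [hterm]
      have : 0 < ‖c j‖ := norm_pos_iff.mpr hj
      exact mul_pos (by positivity) (hw j)

/-- The signature is unique. -/
theorem HasSignature.unique {W : Submodule ℂ (Fin n → ℂ)} {p q p' q' : ℕ}
    (h : HasSignature M W p q) (h' : HasSignature M W p' q') : p = p' ∧ q = q' := by
  obtain ⟨hW, ⟨P, hPW, hP, hP'⟩, ⟨Q, hQW, hQ, hQ'⟩⟩ := h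
  obtain ⟨hW', ⟨R, hRW, hR, hR'⟩, ⟨S, hSW, hS, hS'⟩⟩ := h'
  have h1 := finrank_add_finrank_le (e := 1) (P := P) (Q := S) (M := M) hPW hSW
    (fun v hv h0 => by simpa using hP' v hv h0) (fun v hv => by
      rcases eq_or_ne v 0 with rfl | h0
      · simp [hermForm_zero_left]
      · simpa using (hS' v hv h0).le)
  have h2 := finrank_add_finrank_le (e := 1) (P := R) (Q := Q) (M := M) hRW hQW
    (fun v hv h0 => by simpa using hR' v hv h0) (fun v hv => by
      rcases eq_or_ne v 0 with rfl | h0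
      · simp [hermForm_zero_left]
      · simpa using (hQ' v hv h0).le)
  omega

theorem HasSignature.neg {W : Submodule ℂ (Fin n → ℂ)} {p q : ℕ}
    (h : HasSignature M W p q) : HasSignature (-M) W q p := by
  have hneg : ∀ v, (hermForm (-M) v v).re = -(hermForm M v v).re := by
    intro v
    rw [← neg_one_smul ℚ M, hermForm_smul_matrix]
    simp
  obtain ⟨hW, ⟨P, hPW, hP, hP'⟩, ⟨Q, hQW, hQ, hQ'⟩⟩ := h
  refine ⟨by omega, ⟨Q, hQW, hQ, fun v hv h0 => ?_⟩, ⟨P, hPW, hP, fun v hv h0 => ?_⟩⟩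
  · rw [hneg]
    have := hQ' v hv h0
    linarith
  · rw [hneg]
    have := hP' v hv h0
    linarith

/-- In a space of signature `(1, q)` a subspace on which the form is nonnegative is a line. -/
theorem HasSignature.finrank_le_one {W U : Submodule ℂ (Fin n → ℂ)} {q : ℕ}
    (h : HasSignature M W 1 q) (hU : U ≤ W) (hU' : ∀ v ∈ U, 0 ≤ (hermForm M v v).re) :
    Module.finrank ℂ U ≤ 1 := by
  obtain ⟨hW, -, ⟨Q, hQW, hQ, hQ'⟩⟩ := h
  have h1 := finrank_add_finrank_le (e := -1) (P := Q) (Q := U) (M := M) hQW hU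
    (fun v hv h0 => by have := hQ' v hv h0; linarith) (fun v hv => by
      have := hU' v hv; linarith)
  omega

/-- Two orthogonal vectors of nonnegative length in a space of signature `(1, q)` are linearly
dependent. -/
theorem HasSignature.not_linearIndependent {W : Submodule ℂ (Fin n → ℂ)} {q : ℕ}
    (hM : M.IsSymm) (h : HasSignature M W 1 q) {v w : Fin n → ℂ} (hv : v ∈ W) (hw : w ∈ W)
    (hvw : hermForm M v w = 0) (hv' : 0 ≤ (hermForm M v v).re)
    (hw' : 0 ≤ (hermForm M w w).re) : ¬LinearIndependent ℂ ![v, w] := by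
  intro hli
  have h1 := h.finrank_le_one (U := Submodule.span ℂ (Set.range ![v, w])) ?_ ?_
  · rw [finrank_span_eq_card hli] at h1
    simp at h1
  · rw [Submodule.span_le]
    rintro _ ⟨i, rfl⟩
    fin_cases i
    · exact hv
    · exact hw
  · intro x hx
    obtain ⟨c, rfl⟩ := (Submodule.mem_span_range_iff_exists_fun ℂ).mp hx
    simp only [Fin.sum_univ_two, Matrix.cons_val_zero, Matrix.cons_val_one]
    have hwv := hermForm_eq_zero_comm hM hvw
    simp only [hermForm_add_left, hermForm_add_right, hermForm_smul_left, hermForm_smul_right,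
      hvw, hwv, mul_zero, add_zero, zero_add]
    have e : ∀ (a : ℂ) (y : Fin n → ℂ), (a * (star a * hermForm M y y)).re =
        ‖a‖ ^ 2 * (hermForm M y y).re := by
      intro a y
      rw [← mul_assoc, Complex.star_def, Complex.mul_conj, Complex.normSq_eq_norm_sq,
        Complex.re_ofReal_mul]
    simp only [mul_left_comm, Complex.add_re] at e ⊢
    rw [e, e]
    positivity

end Hermitian

/-! ### The spectral condition and eigensystems -/

/-- The condition on the trace polynomials to which both sides of the equivalence reduce: one root
of `Ψ` exceeds `2`, the others lie in `(-2, 2)`, all are simple, and `ε Φ Ψ'` is positive at the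
root `τ` and negative at the other roots in `(-2, 2)`. -/
structure SpectralCondition (Φ Ψ : ℤ[X]) (ε τ : ℝ) : Prop where
  exists_gt : ∃ t₀ : ℝ, 2 < t₀ ∧ aeval (t₀ : ℂ) Ψ = 0 ∧
    ∀ z : ℂ, aeval z Ψ = 0 → z = t₀ ∨ ∃ t : ℝ, -2 < t ∧ t < 2 ∧ z = t
  simple : ∀ z : ℂ, aeval z Ψ = 0 → aeval z (derivative Ψ) ≠ 0
  mem : -2 < τ ∧ τ < 2
  root : aeval τ Ψ = 0
  pos : 0 < ε * (aeval τ Φ * aeval τ (derivative Ψ))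
  neg : ∀ t : ℝ, -2 < t → t < 2 → aeval t Ψ = 0 → t ≠ τ →
    ε * (aeval t Φ * aeval t (derivative Ψ)) < 0

/-- Eigenvectors `v μ` of an isometry `F` of the form `M`, one for each root `μ` of `ψ`, whose
pairings are given by the trace polynomials `Φ`, `Ψ`. These are the only properties of `B` and the
form that the analysis of Hodge structures uses; the sign `ε` stands for the renormalization. -/
structure IsEigenSystem (ψ Φ Ψ : ℤ[X]) (ε : ℝ) (M F : Matrix (Fin 22) (Fin 22) ℚ)
    (v : ℂ → Fin 22 → ℂ) : Prop where
  symm : M.IsSymm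
  isometry : F.transpose * M * F = M
  monic : ψ.Monic
  natDegree : ψ.natDegree = 22
  root_ne_zero : ∀ {μ : ℂ}, aeval μ ψ = 0 → μ ≠ 0
  root_sq_ne_one : ∀ {μ : ℂ}, aeval μ ψ = 0 → μ ^ 2 ≠ 1
  root_inv : ∀ {μ : ℂ}, aeval μ ψ = 0 → aeval μ⁻¹ ψ = 0
  root_iff : ∀ {μ : ℂ}, μ ≠ 0 → (aeval μ ψ = 0 ↔ aeval (μ + μ⁻¹) Ψ = 0)
  left_ne_zero : ∀ {z : ℂ}, aeval z Ψ = 0 → aeval z Φ ≠ 0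
  derivative_ne_zero : ∀ {μ : ℂ}, aeval μ ψ = 0 → aeval (μ + μ⁻¹) (derivative Ψ) ≠ 0 →
    aeval μ (derivative ψ) ≠ 0
  root_of_eigenvector : ∀ {μ : ℂ} {w : Fin 22 → ℂ}, w ≠ 0 → (toC F).mulVec w = μ • w →
    aeval μ ψ = 0
  eigen : ∀ {μ : ℂ}, aeval μ ψ = 0 → (toC F).mulVec (v μ) = μ • v μ
  ne_zero : ∀ {μ : ℂ}, aeval μ ψ = 0 → v μ ≠ 0
  unique : ∀ {μ : ℂ} {w : Fin 22 → ℂ}, aeval μ ψ = 0 → (toC F).mulVec w = μ • w →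
    ∃ a : ℂ, w = a • v μ
  star_vec : ∀ μ : ℂ, star (v μ) = v (star μ)
  herm : ∀ {μ : ℂ}, aeval μ ψ = 0 → hermForm M (v μ) (v (star μ)⁻¹) =
    ε * ((4 - (μ + μ⁻¹) ^ 2) * aeval (μ + μ⁻¹) Φ * aeval (μ + μ⁻¹) (derivative Ψ))

/-- The eigenvectors `v_μ` of `B` form an eigensystem of `ε` times the invariant form. -/
theorem isEigenSystem {φ ψ : ℤ[X]} (hp : IsHypergeometricPair 11 φ ψ) {r : Fin 22 → ℚ}
    (hr : IsReflectionVector 22 φ ψ r) {ε : ℚ} :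
    IsEigenSystem ψ (antiTracePolynomial 11 φ) (tracePolynomial 11 ψ) ε
      (ε • invariantForm 22 φ ψ r) (companion 22 ψ) (eigvec (m := 21) ψ r) where
  symm := by
    rw [Matrix.IsSymm, Matrix.transpose_smul,
      (IsReflectionVector.invariantForm_isSymm (m := 21)).eq]
  isometry := by
    rw [Matrix.mul_smul, Matrix.smul_mul,
      IsReflectionVector.right_invariant (m := 21) hp hr (by norm_num)]
  monic := hp.monic_right
  natDegree := hp.natDegree_right
  root_ne_zero := hp.root_ne_zero
  root_sq_ne_one := hp.root_sq_ne_one (by norm_num)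
  root_inv := hp.root_inv
  root_iff := hp.root_iff
  left_ne_zero := hp.trace_left_ne_zero (by norm_num)
  derivative_ne_zero := by
    intro μ hμ h
    have h0 := hp.root_ne_zero hμ
    have h1 := hp.root_sq_ne_one (by norm_num) hμ
    rw [hp.aeval_derivative_right hμ]
    refine mul_ne_zero (mul_ne_zero (pow_ne_zero _ h0) (sub_ne_zero.mpr fun h2 => h1 ?_)) h
    rw [← inv_inv (μ ^ 2), ← h2, inv_one]
  root_of_eigenvector := root_of_eigenvector (m := 21) hp (by norm_num)
  eigen := eigvec_eigen (m := 21) hp (by norm_num)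
  ne_zero := hr.eigvec_ne_zero (m := 21) hp (by norm_num)
  unique := fun hμ hw => hr.eq_smul_eigvec (m := 21) hp (by norm_num) hμ hw
  star_vec := star_eigvec
  herm := by
    intro μ hμ
    rw [hermForm_smul_matrix, hermForm_eq_bform, star_eigvec, star_inv₀, star_star]
    rw [hp.bform_eigvec_trace (m := 21) (by norm_num) hr hμ]
    push_cast
    rfl

theorem intersectionForm_eq (φ ψ : ℤ[X]) (r : Fin 22 → ℚ) :
    ∃ ε : ℚ, (ε = 1 ∨ ε = -1) ∧ intersectionForm φ ψ r = ε • invariantForm 22 φ ψ r := by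
  rw [intersectionForm, renormalized]
  split_ifs
  · exact ⟨-1, Or.inr rfl, by simp⟩
  · exact ⟨1, Or.inl rfl, by simp⟩

theorem aeval_ofReal (P : ℤ[X]) (t : ℝ) : aeval (t : ℂ) P = ((aeval t P : ℝ) : ℂ) :=
  aeval_algebraMap_apply ℂ t P

theorem aeval_star_eq_zero {P : ℤ[X]} {z : ℂ} (h : aeval z P = 0) : aeval (star z) P = 0 := by
  have h1 : aeval (star z) P = star (aeval z P) := by
    have := Polynomial.aeval_algHom_apply ((Complex.conjAe : ℂ →ₐ[ℝ] ℂ).restrictScalars ℤ) z P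
    exact this
  rw [h1, h, star_zero]

theorem star_eq_inv_of_norm_one {z : ℂ} (h : ‖z‖ = 1) : star z = z⁻¹ :=
  (Complex.inv_eq_conj h).symm

theorem mul_star_ne_one_of_norm {z : ℂ} (h : ‖z‖ ≠ 1) : z * star z ≠ 1 := by
  intro h1
  rw [Complex.star_def, Complex.mul_conj, Complex.normSq_eq_norm_sq] at h1
  have h2 : ‖z‖ ^ 2 = 1 := by exact_mod_cast h1
  exact h ((pow_eq_one_iff_of_nonneg (norm_nonneg z) two_ne_zero).mp h2)

/-- On the unit circle the trace `z + z⁻¹` is real, and inside `(-2, 2)` unless `z = ±1`. -/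
theorem trace_of_norm_one {z : ℂ} (h : ‖z‖ = 1) (h2 : z ^ 2 ≠ 1) :
    ∃ t : ℝ, -2 < t ∧ t < 2 ∧ z + z⁻¹ = t := by
  have hi := star_eq_inv_of_norm_one h
  have hsq : z.re * z.re + z.im * z.im = 1 := by
    rw [← Complex.normSq_apply, Complex.normSq_eq_norm_sq, h, one_pow]
  have him : z.im ≠ 0 := by
    intro h0
    apply h2
    have hz : z = z.re := Complex.ext rfl (by simpa using h0)
    rw [hz]
    norm_cast
    nlinarith
  have hpos : 0 < z.im * z.im := mul_self_pos.mpr him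
  refine ⟨2 * z.re, by nlinarith, by nlinarith, ?_⟩
  rw [← hi, Complex.star_def, Complex.add_conj]

/-- If `z + z⁻¹` is real and lies in `[-2, 2]` then `z` is on the unit circle. -/
theorem norm_one_of_trace {z : ℂ} (h0 : z ≠ 0) {t : ℝ} (h1 : -2 ≤ t) (h2 : t ≤ 2)
    (h : z + z⁻¹ = t) : ‖z‖ = 1 := by
  have hq : z ^ 2 - t * z + 1 = 0 := by
    have := congrArg (· * z) h
    simp only [add_mul, inv_mul_cancel₀ h0] at this
    linear_combination this
  have hre := congrArg Complex.re hq
  have him := congrArg Complex.im hq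
  simp [pow_two] at hre him
  have hn : z.re * z.re + z.im * z.im = 1 := by
    by_cases hi : z.im = 0
    · rw [hi] at hre ⊢
      have h3 : (2 * z.re - t) ^ 2 = t ^ 2 - 4 := by linear_combination 4 * hre
      have h4 : t ^ 2 - 4 ≤ 0 := by nlinarith
      have h5 : 2 * z.re - t = 0 := by
        have : (2 * z.re - t) ^ 2 ≤ 0 := by linarith
        exact pow_eq_zero_iff (two_ne_zero) |>.mp (le_antisymm this (sq_nonneg _))
      nlinarith
    · have h3 : t = 2 * z.re := by
        have : z.im * (2 * z.re - t) = 0 := by linear_combination him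
        have := (mul_eq_zero.mp this).resolve_left hi
        linarith
      rw [h3] at hre
      linear_combination -hre
  have h6 : ‖z‖ ^ 2 = 1 := by
    rw [← Complex.normSq_eq_norm_sq, Complex.normSq_apply, hn]
  exact (pow_eq_one_iff_of_nonneg (norm_nonneg z) two_ne_zero).mp h6

theorem eq_or_eq_inv_of_trace_eq {z w : ℂ} (hz : z ≠ 0) (hw : w ≠ 0)
    (h : z + z⁻¹ = w + w⁻¹) : z = w ∨ z = w⁻¹ := by
  have h1 : (z - w) * (z * w - 1) = 0 := by
    field_simp at h
    linear_combination h
  rcases mul_eq_zero.mp h1 with h2 | h2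
  · exact Or.inl (sub_eq_zero.mp h2)
  · exact Or.inr (eq_inv_of_mul_eq_one_left (sub_eq_zero.mp h2))

/-- Eigenvectors for distinct eigenvalues are linearly independent. -/
theorem linearIndependent_pair_of_eigenvectors {n : ℕ} {F : Matrix (Fin n) (Fin n) ℂ} {μ ν : ℂ}
    {v w : Fin n → ℂ} (hv : F.mulVec v = μ • v) (hw : F.mulVec w = ν • w) (hv0 : v ≠ 0)
    (hw0 : w ≠ 0) (h : μ ≠ ν) : LinearIndependent ℂ ![v, w] := by
  refine Module.End.eigenvectors_linearIndependent' (Matrix.toLin' F) ![μ, ν] ?_ _ ?_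
  · intro i j hij
    fin_cases i <;> fin_cases j <;> simp_all
  · intro i
    fin_cases i
    · exact Module.End.hasEigenvector_iff.mpr
        ⟨Module.End.mem_eigenspace_iff.mpr (by simpa using hv), hv0⟩
    · exact Module.End.hasEigenvector_iff.mpr
        ⟨Module.End.mem_eigenspace_iff.mpr (by simpa using hw), hw0⟩

theorem nodup_complexRoots_iff {P : ℤ[X]} (hP : P.Monic) :
    (complexRoots P).Nodup ↔ ∀ z : ℂ, aeval z P = 0 → aeval z (derivative P) ≠ 0 := by
  have h0 : P.map (Int.castRingHom ℂ) ≠ 0 := (hP.map _).ne_zero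
  have hroot : ∀ (Q : ℤ[X]) (z : ℂ), (Q.map (Int.castRingHom ℂ)).IsRoot z ↔ aeval z Q = 0 := by
    intro Q z
    rw [IsRoot, eval_map, ← algebraMap_int_eq, ← aeval_def]
  rw [complexRoots, Multiset.nodup_iff_count_le_one]
  refine forall_congr' fun z => ?_
  rw [count_roots, ← not_lt, one_lt_rootMultiplicity_iff_isRoot h0, derivative_map, hroot, hroot]
  tauto

/-! ### Hodge structures preserved by an isometry -/

section HodgeAnalysis

variable {ψ Φ Ψ : ℤ[X]} {ε : ℝ} {M F : Matrix (Fin 22) (Fin 22) ℚ} {v : ℂ → Fin 22 → ℂ}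

/-- The eigenvalue `δ` of a Hodge isometry on `H^{2,0}`: the Hodge structure is determined by the
corresponding eigenvector. -/
structure IsPeriodEigenvalue (ψ : ℤ[X]) (v : ℂ → Fin 22 → ℂ) (h : HodgeStructure M) (δ : ℂ) :
    Prop where
  norm_eq : ‖δ‖ = 1
  root : aeval δ ψ = 0
  H20_eq : h.H20 = Submodule.span ℂ {v δ}
  H02_eq : h.H02 = Submodule.span ℂ {v (star δ)}
  mem_H11 : ∀ x, x ∈ h.H11 ↔ hermForm M x (v δ) = 0 ∧ hermForm M x (v (star δ)) = 0
  pos : 0 < (hermForm M (v δ) (v δ)).re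

theorem HasSignature.pos_of_mem {W : Submodule ℂ (Fin 22 → ℂ)} {p : ℕ}
    (h : HasSignature M W p 0) {x : Fin 22 → ℂ} (hx : x ∈ W) (hx0 : x ≠ 0) :
    0 < (hermForm M x x).re := by
  obtain ⟨hW, ⟨P, hPW, hP, hP'⟩, -⟩ := h
  have : P = W := Submodule.eq_of_le_of_finrank_eq hPW (by omega)
  exact hP' x (this ▸ hx) hx0

theorem HodgeStructure.exists_add (h : HodgeStructure M) (x : Fin 22 → ℂ) :
    ∃ a ∈ h.H20, ∃ b ∈ h.H11, ∃ c ∈ h.H02, x = a + b + c := by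
  have h1 := h.isInternal.submodule_iSup_eq_top
  have h2 : (⊤ : Submodule ℂ (Fin 22 → ℂ)) ≤ h.H20 ⊔ h.H11 ⊔ h.H02 := by
    rw [← h1]
    refine iSup_le fun i => ?_
    fin_cases i
    · exact le_sup_left.trans le_sup_left
    · exact le_sup_right.trans le_sup_left
    · exact le_sup_right
  obtain ⟨y, hy, c, hc, hyc⟩ := Submodule.mem_sup.mp (h2 (Submodule.mem_top (x := x)))
  obtain ⟨a, ha, b, hb, hab⟩ := Submodule.mem_sup.mp hy
  exact ⟨a, ha, b, hb, c, hc, by rw [hab, hyc]⟩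

/-- The line `H^{2,0}` is spanned by an eigenvector of `F`, and `H^{1,1}` is the orthogonal
complement of it and its conjugate. -/
theorem IsEigenSystem.exists_periodEigenvalue (hS : IsEigenSystem ψ Φ Ψ ε M F v)
    (h : HodgeStructure M) (hF : h.H20.map (Matrix.toLin' (toC F)) = h.H20) :
    ∃ δ, IsPeriodEigenvalue ψ v h δ := by
  have h1 : Module.finrank ℂ h.H20 = 1 := h.signature_20.1
  obtain ⟨⟨w, hw⟩, hw0, hspan⟩ := finrank_eq_one_iff'.mp h1
  have hw0' : w ≠ 0 := fun h0 => hw0 (Subtype.ext h0)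
  have hFw : (toC F).mulVec w ∈ h.H20 := by
    rw [← hF]
    exact ⟨w, hw, by simp⟩
  obtain ⟨δ, hδ⟩ := hspan ⟨_, hFw⟩
  have hδ' : (toC F).mulVec w = δ • w := (congrArg Subtype.val hδ).symm
  have hpos := h.signature_20.pos_of_mem hw hw0'
  have hnorm : ‖δ‖ = 1 := by
    by_contra hn
    have := hermForm_eigenvectors hS.isometry hδ' hδ' (mul_star_ne_one_of_norm hn)
    rw [this] at hpos
    simp at hpos
  have hroot := hS.root_of_eigenvector hw0' hδ'
  obtain ⟨a, ha⟩ := hS.unique hroot hδ'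
  have ha0 : a ≠ 0 := by
    rintro rfl
    exact hw0' (by rw [ha, zero_smul])
  have hv : v δ = a⁻¹ • w := by rw [ha, inv_smul_smul₀ ha0]
  have hvmem : v δ ∈ h.H20 := by rw [hv]; exact Submodule.smul_mem _ _ hw
  have h20 : h.H20 = Submodule.span ℂ {v δ} := by
    refine le_antisymm (fun x hx => ?_) ?_
    · obtain ⟨c, hc⟩ := hspan ⟨x, hx⟩
      have hc' : x = c • w := (congrArg Subtype.val hc).symm
      rw [hc', ha, smul_smul]
      exact Submodule.smul_mem _ _ (Submodule.mem_span_singleton_self _)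
    · rw [Submodule.span_singleton_le_iff_mem]
      exact hvmem
  have h02 : h.H02 = Submodule.span ℂ {v (star δ)} := by
    ext x
    have h2 := h.conj_20 (star x)
    rw [star_star] at h2
    rw [h2, h20, Submodule.mem_span_singleton, Submodule.mem_span_singleton, ← hS.star_vec]
    constructor
    · rintro ⟨c, hc⟩
      exact ⟨star c, by rw [← star_star x, ← hc, star_smul]⟩
    · rintro ⟨c, hc⟩
      exact ⟨star c, by rw [← hc, star_smul, star_star]⟩
  have hv0 := hS.ne_zero hroot
  have hvpos := h.signature_20.pos_of_mem hvmem hv0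
  have hv2mem : v (star δ) ∈ h.H02 := by
    rw [h02]
    exact Submodule.mem_span_singleton_self _
  have hv2pos := h.signature_02.pos_of_mem hv2mem (hS.ne_zero (aeval_star_eq_zero hroot))
  refine ⟨δ, hnorm, hroot, h20, h02, fun x => ⟨fun hx => ⟨?_, ?_⟩, fun hx => ?_⟩, hvpos⟩
  · exact hermForm_eq_zero_comm hS.symm (h.orthogonal_20_11 _ hvmem _ hx)
  · exact h.orthogonal_11_02 _ hx _ hv2mem
  · obtain ⟨y, hy, b, hb, c, hc, rfl⟩ := h.exists_add x
    obtain ⟨hx1, hx2⟩ := hx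
    have e1 : hermForm M c (v δ) = 0 :=
      hermForm_eq_zero_comm hS.symm (h.orthogonal_20_02 _ hvmem _ hc)
    have e2 : hermForm M b (v δ) = 0 :=
      hermForm_eq_zero_comm hS.symm (h.orthogonal_20_11 _ hvmem _ hb)
    rw [hermForm_add_left, hermForm_add_left, e1, e2, add_zero, add_zero] at hx1
    rw [hermForm_add_left, hermForm_add_left, h.orthogonal_20_02 _ hy _ hv2mem,
      h.orthogonal_11_02 _ hb _ hv2mem, zero_add, zero_add] at hx2
    have hy0 : y = 0 := by
      rw [h20, Submodule.mem_span_singleton] at hy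
      obtain ⟨k, rfl⟩ := hy
      rw [hermForm_smul_left] at hx1
      rcases mul_eq_zero.mp hx1 with h3 | h3
      · rw [h3, zero_smul]
      · rw [h3] at hvpos
        simp at hvpos
    have hc0 : c = 0 := by
      rw [h02, Submodule.mem_span_singleton] at hc
      obtain ⟨k, rfl⟩ := hc
      rw [hermForm_smul_left] at hx2
      rcases mul_eq_zero.mp hx2 with h3 | h3
      · rw [h3, zero_smul]
      · rw [h3] at hv2pos
        simp at hv2pos
    rw [hy0, hc0, zero_add, add_zero]
    exact hb

/-- On the unit circle the Hermitian length of `v_μ` is `ε (4 - t²) Φ(t) Ψ'(t)` with `t = μ + μ⁻¹`.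
-/
theorem IsEigenSystem.herm_of_norm_one (hS : IsEigenSystem ψ Φ Ψ ε M F v) {μ : ℂ}
    (hμ : aeval μ ψ = 0) (hn : ‖μ‖ = 1) : ∃ t : ℝ, -2 < t ∧ t < 2 ∧ μ + μ⁻¹ = t ∧
      aeval t Ψ = 0 ∧ (hermForm M (v μ) (v μ)).re =
        (4 - t ^ 2) * (ε * (aeval t Φ * aeval t (derivative Ψ))) := by
  obtain ⟨t, h1, h2, h3⟩ := trace_of_norm_one hn (hS.root_sq_ne_one hμ)
  refine ⟨t, h1, h2, h3, ?_, ?_⟩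
  · have := (hS.root_iff (hS.root_ne_zero hμ)).mp hμ
    rw [h3, aeval_ofReal] at this
    exact_mod_cast this
  · have h4 := hS.herm hμ
    rw [star_eq_inv_of_norm_one hn, inv_inv, h3, aeval_ofReal, aeval_ofReal] at h4
    rw [h4]
    norm_cast
    ring

theorem IsEigenSystem.isotropic (hS : IsEigenSystem ψ Φ Ψ ε M F v) {μ : ℂ}
    (hμ : aeval μ ψ = 0) (hn : ‖μ‖ ≠ 1) : hermForm M (v μ) (v μ) = 0 :=
  hermForm_eigenvectors hS.isometry (hS.eigen hμ) (hS.eigen hμ) (mul_star_ne_one_of_norm hn)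

theorem IsPeriodEigenvalue.ne_of_norm {h : HodgeStructure M} {δ : ℂ}
    (hδ : IsPeriodEigenvalue ψ v h δ) {μ : ℂ} (hn : ‖μ‖ ≠ 1) : μ ≠ δ ∧ μ ≠ star δ := by
  constructor
  · rintro rfl
    exact hn hδ.norm_eq
  · rintro rfl
    rw [norm_star] at hn
    exact hn hδ.norm_eq

theorem IsEigenSystem.nodup_complexRoots (hS : IsEigenSystem ψ Φ Ψ ε M F v)
    (h : ∀ z : ℂ, aeval z Ψ = 0 → aeval z (derivative Ψ) ≠ 0) : (complexRoots ψ).Nodup := by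
  rw [nodup_complexRoots_iff hS.monic]
  exact fun z hz => hS.derivative_ne_zero hz (h _ ((hS.root_iff (hS.root_ne_zero hz)).mp hz))

theorem IsEigenSystem.mem_complexRoots (hS : IsEigenSystem ψ Φ Ψ ε M F v) (μ : ℂ) :
    μ ∈ complexRoots ψ ↔ aeval μ ψ = 0 := by
  rw [complexRoots, mem_roots (hS.monic.map _).ne_zero, IsRoot, eval_map, ← algebraMap_int_eq,
    ← aeval_def]

theorem IsEigenSystem.card_complexRoots (hS : IsEigenSystem ψ Φ Ψ ε M F v) :
    (complexRoots ψ).card = 22 := by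
  rw [complexRoots, IsAlgClosed.card_roots_eq_natDegree, hS.monic.natDegree_map, hS.natDegree]

section Period

variable {h : HodgeStructure M} {δ : ℂ} (hS : IsEigenSystem ψ Φ Ψ ε M F v)
  (hδ : IsPeriodEigenvalue ψ v h δ)

include hS hδ

theorem IsPeriodEigenvalue.mem_H11_of_root {μ : ℂ} (hμ : aeval μ ψ = 0) (h1 : μ ≠ δ)
    (h2 : μ ≠ star δ) : v μ ∈ h.H11 := by
  have hd := star_eq_inv_of_norm_one hδ.norm_eq
  have hd0 := hS.root_ne_zero hδ.root
  rw [hδ.mem_H11]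
  refine ⟨hermForm_eigenvectors hS.isometry (hS.eigen hμ) (hS.eigen hδ.root) fun h3 => h1 ?_,
    hermForm_eigenvectors hS.isometry (hS.eigen hμ)
      (hS.eigen (aeval_star_eq_zero hδ.root)) fun h3 => h2 ?_⟩
  · rw [hd] at h3
    rw [eq_inv_of_mul_eq_one_left h3, inv_inv]
  · rw [star_star] at h3
    rw [hd, eq_inv_of_mul_eq_one_left h3]

/-- On `H^{1,1}`, of signature `(1, 19)`, the eigenvectors on the unit circle have negative length:
otherwise such a vector and its conjugate would span a semidefinite plane. -/
theorem IsPeriodEigenvalue.neg_of_root {μ : ℂ} (hμ : aeval μ ψ = 0) (h1 : μ ≠ δ)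
    (h2 : μ ≠ star δ) (hn : ‖μ‖ = 1) : (hermForm M (v μ) (v μ)).re < 0 := by
  by_contra! hge
  have hμ' := aeval_star_eq_zero hμ
  have hi := star_eq_inv_of_norm_one hn
  have hsq := hS.root_sq_ne_one hμ
  have hne : μ ≠ star μ := by
    intro h3
    rw [hi] at h3
    apply hsq
    nth_rewrite 1 [sq, h3]
    exact inv_mul_cancel₀ (hS.root_ne_zero hμ)
  refine h.signature_11.not_linearIndependent hS.symm (hδ.mem_H11_of_root hS hμ h1 h2)
    (hδ.mem_H11_of_root hS hμ' (fun h3 => h2 ?_) (fun h3 => h1 ?_))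
    (hermForm_eigenvectors hS.isometry (hS.eigen hμ) (hS.eigen hμ') ?_) hge ?_
    (linearIndependent_pair_of_eigenvectors (hS.eigen hμ) (hS.eigen hμ') (hS.ne_zero hμ)
      (hS.ne_zero hμ') hne)
  · rw [← h3, star_star]
  · exact star_injective h3
  · rw [star_star, ← sq]
    exact hsq
  · rw [← hS.star_vec, hermForm_star_self hS.symm]
    exact hge

/-- Distinct eigenvalues off the unit circle are paired nontrivially, since there are no isotropic
planes in `H^{1,1}`. -/
theorem IsPeriodEigenvalue.herm_ne_zero {μ ν : ℂ} (hμ : aeval μ ψ = 0) (hν : aeval ν ψ = 0)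
    (hn : ‖μ‖ ≠ 1) (hn' : ‖ν‖ ≠ 1) (hne : μ ≠ ν) : hermForm M (v μ) (v ν) ≠ 0 := by
  intro h0
  obtain ⟨h1, h2⟩ := hδ.ne_of_norm hn
  obtain ⟨h3, h4⟩ := hδ.ne_of_norm hn'
  refine h.signature_11.not_linearIndependent hS.symm (hδ.mem_H11_of_root hS hμ h1 h2)
    (hδ.mem_H11_of_root hS hν h3 h4) h0 (by rw [hS.isotropic hμ hn]; simp)
    (by rw [hS.isotropic hν hn']; simp)
    (linearIndependent_pair_of_eigenvectors (hS.eigen hμ) (hS.eigen hν) (hS.ne_zero hμ)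
      (hS.ne_zero hν) hne)

theorem IsPeriodEigenvalue.eq_of_one_lt_norm {μ ν : ℂ} (hμ : aeval μ ψ = 0)
    (hν : aeval ν ψ = 0) (hn : 1 < ‖μ‖) (hn' : 1 < ‖ν‖) : μ = ν := by
  by_contra hne
  refine hδ.herm_ne_zero hS hμ hν hn.ne' hn'.ne' hne
    (hermForm_eigenvectors hS.isometry (hS.eigen hμ) (hS.eigen hν) fun h1 => ?_)
  have h2 := congrArg norm h1
  rw [norm_mul, norm_star, norm_one] at h2
  nlinarith

theorem IsPeriodEigenvalue.herm_star_inv_ne_zero {μ : ℂ} (hμ : aeval μ ψ = 0) :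
    hermForm M (v μ) (v (star μ)⁻¹) ≠ 0 := by
  by_cases hn : ‖μ‖ = 1
  · rw [star_eq_inv_of_norm_one hn, inv_inv]
    intro h0
    by_cases h1 : μ = δ
    · have := hδ.pos
      rw [← h1, h0] at this
      simp at this
    by_cases h2 : μ = star δ
    · have := hδ.pos
      rw [← hermForm_star_self hS.symm, hS.star_vec, ← h2, h0] at this
      simp at this
    · have := hδ.neg_of_root hS hμ h1 h2 hn
      rw [h0] at this
      simp at this
  · have hn0 : 0 < ‖μ‖ := norm_pos_iff.mpr (hS.root_ne_zero hμ)
    have hn2 : ‖(star μ)⁻¹‖ = ‖μ‖⁻¹ := by rw [norm_inv, norm_star]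
    refine hδ.herm_ne_zero hS hμ (hS.root_inv (aeval_star_eq_zero hμ)) hn ?_ fun h1 => hn ?_
    · rw [hn2]
      intro h3
      exact hn (inv_eq_one.mp h3)
    · have h3 := congrArg norm h1
      rw [hn2] at h3
      field_simp at h3
      exact (pow_eq_one_iff_of_nonneg hn0.le two_ne_zero).mp h3

/-- A multiple root of `Ψ` would make `v_μ` and its partner for the eigenvalue `(star μ)⁻¹`
orthogonal. -/
theorem IsPeriodEigenvalue.simple (z : ℂ) (hz : aeval z Ψ = 0) : aeval z (derivative Ψ) ≠ 0 := by
  obtain ⟨μ, h0, rfl⟩ := exists_add_inv_eq z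
  have hμ := (hS.root_iff h0).mpr hz
  intro h1
  have := hδ.herm_star_inv_ne_zero hS hμ
  rw [hS.herm hμ, h1] at this
  simp at this

theorem IsPeriodEigenvalue.ne_star : δ ≠ star δ := by
  intro h1
  rw [star_eq_inv_of_norm_one hδ.norm_eq] at h1
  apply hS.root_sq_ne_one hδ.root
  nth_rewrite 1 [sq, h1]
  exact inv_mul_cancel₀ (hS.root_ne_zero hδ.root)

/-- There is an eigenvalue off the unit circle, as otherwise `H^{1,1}` would be negative
definite. -/
theorem IsPeriodEigenvalue.exists_one_lt_norm : ∃ μ : ℂ, aeval μ ψ = 0 ∧ 1 < ‖μ‖ := by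
  classical
  by_contra! hle
  have hone : ∀ μ : ℂ, aeval μ ψ = 0 → ‖μ‖ = 1 := by
    intro μ hμ
    refine le_antisymm (hle μ hμ) ?_
    have h1 := hle _ (hS.root_inv hμ)
    have h0 : 0 < ‖μ‖ := norm_pos_iff.mpr (hS.root_ne_zero hμ)
    rw [norm_inv] at h1
    exact (inv_le_one₀ h0).mp h1
  have hnd := hS.nodup_complexRoots (hδ.simple hS)
  set Z : Finset ℂ := ((complexRoots ψ).toFinset.erase δ).erase (star δ) with hZ
  have hZc : Z.card = 20 := by
    rw [hZ, Finset.card_erase_of_mem, Finset.card_erase_of_mem, Multiset.toFinset_card_of_nodup hnd,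
      hS.card_complexRoots]
    · rw [Multiset.mem_toFinset, hS.mem_complexRoots]
      exact hδ.root
    · rw [Finset.mem_erase, Multiset.mem_toFinset, hS.mem_complexRoots]
      exact ⟨(hδ.ne_star hS).symm, aeval_star_eq_zero hδ.root⟩
  have hZm : ∀ μ ∈ Z, aeval μ ψ = 0 ∧ μ ≠ δ ∧ μ ≠ star δ := by
    intro μ hμ
    rw [hZ, Finset.mem_erase, Finset.mem_erase, Multiset.mem_toFinset, hS.mem_complexRoots] at hμ
    exact ⟨hμ.2.2, hμ.2.1, hμ.1⟩
  have hfam := orthogonal_family (M := M) (e := -1) (w := fun μ : Z => v μ)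
    (fun i j hij => hermForm_eigenvectors hS.isometry (hS.eigen (hZm i i.2).1)
      (hS.eigen (hZm j j.2).1) fun h1 => hij (Subtype.ext ?_))
    (fun i => by
      obtain ⟨h1, h2, h3⟩ := hZm i i.2
      have := hδ.neg_of_root hS h1 h2 h3 (hone _ h1)
      linarith)
  · rw [Fintype.card_coe, hZc] at hfam
    obtain ⟨hW, ⟨P, hPW, hP, hP'⟩, -⟩ := h.signature_11
    have h5 := finrank_add_finrank_le (e := -1) (M := M) (W := h.H11)
      (P := Submodule.span ℂ (Set.range fun μ : Z => v μ)) (Q := P) ?_ hPW hfam.2 ?_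
    · omega
    · rw [Submodule.span_le]
      rintro _ ⟨i, rfl⟩
      obtain ⟨h1, h2, h3⟩ := hZm i i.2
      exact hδ.mem_H11_of_root hS h1 h2 h3
    · intro x hx
      rcases eq_or_ne x 0 with rfl | hx0
      · simp [hermForm_zero_left]
      · have := hP' x hx hx0
        linarith
  · rw [star_eq_inv_of_norm_one (hone _ (hZm j j.2).1)] at h1
    exact eq_of_mul_inv_eq_one h1

/-- The eigenvalue off the unit circle is real. -/
theorem IsPeriodEigenvalue.exists_real : ∃ l : ℝ, 1 < |l| ∧ aeval (l : ℂ) ψ = 0 ∧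
    ∀ μ : ℂ, aeval μ ψ = 0 → ‖μ‖ = 1 ∨ μ = l ∨ μ = (l : ℂ)⁻¹ := by
  obtain ⟨μ, hμ, hn⟩ := hδ.exists_one_lt_norm hS
  have h1 := hδ.eq_of_one_lt_norm hS hμ (aeval_star_eq_zero hμ) hn (by rwa [norm_star])
  have h2 : ((μ.re : ℝ) : ℂ) = μ := Complex.conj_eq_iff_re.mp h1.symm
  refine ⟨μ.re, ?_, by rw [h2]; exact hμ, fun ν hν => ?_⟩
  · rw [← Real.norm_eq_abs, ← Complex.norm_real, h2]
    exact hn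
  · rw [h2]
    rcases lt_trichotomy ‖ν‖ 1 with h3 | h3 | h3
    · have h0 : 0 < ‖ν‖ := norm_pos_iff.mpr (hS.root_ne_zero hν)
      have h4 := hδ.eq_of_one_lt_norm hS (hS.root_inv hν) hμ
        (by rw [norm_inv]; exact (one_lt_inv₀ h0).mpr h3) hn
      exact Or.inr (Or.inr (by rw [← h4, inv_inv]))
    · exact Or.inl h3
    · exact Or.inr (Or.inl (hδ.eq_of_one_lt_norm hS hν hμ h3 hn))

end Period
end HodgeAnalysis

/-! ### Positivity on the time-like cone and necessity of the spectral condition -/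

/-- The complex vector with the given real coordinates. -/
def vecRC {n : ℕ} (a : Fin n → ℝ) : Fin n → ℂ := fun i => (a i : ℂ)

section Real

variable {n : ℕ} (M : Matrix (Fin n) (Fin n) ℚ)

theorem toC_mulVec_vecRC (a : Fin n → ℝ) :
    (toC M).mulVec (vecRC a) = vecRC ((toR M).mulVec a) := by
  ext i
  simp [toC, toR, vecRC, Matrix.mulVec, dotProduct]

theorem star_vecRC (a : Fin n → ℝ) : star (vecRC a) = vecRC a := by
  ext i
  simp [vecRC]

theorem hermForm_vecRC (a b : Fin n → ℝ) :
    hermForm M (vecRC a) (vecRC b) = ((a ⬝ᵥ (toR M).mulVec b : ℝ) : ℂ) := by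
  rw [hermForm, star_vecRC, toC_mulVec_vecRC]
  simp [vecRC, dotProduct]

theorem exists_vecRC {v : Fin n → ℂ} (hv : star v = v) : ∃ a, vecRC a = v := by
  refine ⟨fun i => (v i).re, ?_⟩
  ext i
  exact Complex.conj_eq_iff_re.mp (congrFun hv i)

theorem mem_cone {M : Matrix (Fin 22) (Fin 22) ℚ} (h : HodgeStructure M) (a : Fin 22 → ℝ) :
    a ∈ h.cone ↔ vecRC a ∈ h.H11 ∧ 0 < (hermForm M (vecRC a) (vecRC a)).re := by
  rw [hermForm_vecRC, Complex.ofReal_re]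
  rfl

end Real

section HodgeAnalysis

variable {ψ Φ Ψ : ℤ[X]} {ε : ℝ} {M F : Matrix (Fin 22) (Fin 22) ℚ} {v : ℂ → Fin 22 → ℂ}
  {L : Submodule ℤ (Fin 22 → ℚ)} {h : HodgeStructure M} {δ : ℂ}

/-- Two vectors in the same component of the set of time-like vectors have positive inner
product. -/
theorem HodgeStructure.pos_of_mem_component (hM : M.IsSymm) (h : HodgeStructure M)
    {a b : Fin 22 → ℝ} (ha : a ∈ h.cone) (hb : b ∈ connectedComponentIn h.cone a) :
    0 < (hermForm M (vecRC b) (vecRC a)).re := by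
  have hcont : Continuous fun b : Fin 22 → ℝ => b ⬝ᵥ (toR M).mulVec a := by fun_prop
  have hne : ∀ b ∈ h.cone, b ⬝ᵥ (toR M).mulVec a ≠ 0 := by
    intro b hb h0
    rw [mem_cone] at ha hb
    have hba : hermForm M (vecRC b) (vecRC a) = 0 := by rw [hermForm_vecRC, h0, Complex.ofReal_zero]
    have hab := hermForm_eq_zero_comm hM hba
    have hfam := orthogonal_family (M := M) (e := 1) (w := ![vecRC a, vecRC b])
      (fun i j hij => by fin_cases i <;> fin_cases j <;> simp_all)
      (fun i => by
        fin_cases i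
        · simpa using ha.2
        · simpa using hb.2)
    have h1 := h.signature_11.finrank_le_one
      (U := Submodule.span ℂ (Set.range ![vecRC a, vecRC b])) ?_ ?_
    · rw [hfam.1] at h1
      simp at h1
    · rw [Submodule.span_le]
      rintro _ ⟨i, rfl⟩
      fin_cases i
      · exact ha.1
      · exact hb.1
    · intro x hx
      rcases eq_or_ne x 0 with rfl | hx0
      · simp [hermForm_zero_left]
      · simpa using (hfam.2 x hx hx0).le
  rw [hermForm_vecRC, Complex.ofReal_re]
  by_contra! hle
  have haa : 0 < a ⬝ᵥ (toR M).mulVec a := ha.2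
  have hpre := (isPreconnected_connectedComponentIn (x := a) (F := h.cone)).intermediate_value hb
    (mem_connectedComponentIn ha) hcont.continuousOn
  obtain ⟨c, hc, hc0⟩ := hpre ⟨hle, haa.le⟩
  exact hne c (connectedComponentIn_subset _ _ hc) hc0

/-- The eigenvalue off the unit circle is positive: for `l < -1` the vector `a = v_l + g v_{1/l}`,
where `g` is the pairing of the two isotropic eigenvectors, is time-like with `(F a, a) < 0`, so `F`
would exchange the two components of the cone. -/
theorem IsPeriodEigenvalue.exists_one_lt (hS : IsEigenSystem ψ Φ Ψ ε M F v)
    (hδ : IsPeriodEigenvalue ψ v h δ) (hpos : ∀ a ∈ h.cone,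
      (toR F).mulVec '' connectedComponentIn h.cone a = connectedComponentIn h.cone a) :
    ∃ l : ℝ, 1 < l ∧ aeval (l : ℂ) ψ = 0 ∧
      ∀ μ : ℂ, aeval μ ψ = 0 → ‖μ‖ = 1 ∨ μ = l ∨ μ = (l : ℂ)⁻¹ := by
  obtain ⟨l, hl, hroot, hall⟩ := hδ.exists_real hS
  refine ⟨l, ?_, hroot, hall⟩
  rcases lt_abs.mp hl with h1 | h1
  · exact h1
  exfalso
  have hnl : ‖(l : ℂ)‖ ≠ 1 := by
    rw [Complex.norm_real, Real.norm_eq_abs]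
    exact hl.ne'
  have hnl' : ‖(l : ℂ)⁻¹‖ ≠ 1 := by
    rw [norm_inv]
    intro h2
    exact hnl (inv_eq_one.mp h2)
  have hroot' := hS.root_inv hroot
  have hne := hδ.herm_star_inv_ne_zero hS hroot
  have hstar : star (l : ℂ) = l := Complex.conj_ofReal l
  have hstar' : star (l : ℂ)⁻¹ = (l : ℂ)⁻¹ := by rw [star_inv₀, hstar]
  rw [hstar] at hne
  have sx : star (v l) = v l := by rw [hS.star_vec, hstar]
  have sy : star (v (l : ℂ)⁻¹) = v (l : ℂ)⁻¹ := by rw [hS.star_vec, hstar']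
  have hmx : v l ∈ h.H11 :=
    hδ.mem_H11_of_root hS hroot (hδ.ne_of_norm hnl).1 (hδ.ne_of_norm hnl).2
  have hmy : v (l : ℂ)⁻¹ ∈ h.H11 :=
    hδ.mem_H11_of_root hS hroot' (hδ.ne_of_norm hnl').1 (hδ.ne_of_norm hnl').2
  have hxx := hS.isotropic hroot hnl
  have hyy := hS.isotropic hroot' hnl'
  have hreal : star (hermForm M (v l) (v (l : ℂ)⁻¹)) = hermForm M (v l) (v (l : ℂ)⁻¹) := by
    conv_rhs => rw [← sx, hermForm_star_left, sy]
  have hyx : hermForm M (v (l : ℂ)⁻¹) (v l) = hermForm M (v l) (v (l : ℂ)⁻¹) := by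
    rw [← star_hermForm hS.symm, hreal]
  obtain ⟨g, hg⟩ : ∃ g : ℝ, hermForm M (v l) (v (l : ℂ)⁻¹) = g :=
    ⟨_, (Complex.conj_eq_iff_re.mp hreal).symm⟩
  have hg0 : g ≠ 0 := by
    rintro rfl
    exact hne (by rw [hg, Complex.ofReal_zero])
  have hsg : star (g : ℂ) = g := Complex.conj_ofReal g
  obtain ⟨a, ha⟩ : ∃ a, vecRC a = v l + (g : ℂ) • v (l : ℂ)⁻¹ := by
    refine exists_vecRC ?_
    rw [star_add, star_smul, sx, sy, hsg]
  have hcone : a ∈ h.cone := by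
    rw [mem_cone, ha]
    refine ⟨add_mem hmx (Submodule.smul_mem _ _ hmy), ?_⟩
    simp only [hermForm_add_left, hermForm_add_right, hermForm_smul_left, hermForm_smul_right,
      hxx, hyy, hyx, hg, hsg]
    norm_cast
    have : 0 < g * g := mul_self_pos.mpr hg0
    linarith
  have hmem : (toR F).mulVec a ∈ connectedComponentIn h.cone a := by
    rw [← hpos a hcone]
    exact ⟨a, mem_connectedComponentIn hcone, rfl⟩
  have h2 := h.pos_of_mem_component hS.symm hcone hmem
  rw [← toC_mulVec_vecRC, ha, Matrix.mulVec_add, Matrix.mulVec_smul, hS.eigen hroot,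
    hS.eigen hroot'] at h2
  simp only [hermForm_add_left, hermForm_add_right, hermForm_smul_left, hermForm_smul_right,
      hxx, hyy, hyx, hg, hsg] at h2
  norm_cast at h2
  have h3 : 0 < g * g := mul_self_pos.mpr hg0
  have h4 : l⁻¹ < 0 := inv_lt_zero.mpr (by linarith)
  nlinarith

/-- A positive Hodge isometry forces the spectral condition. -/
theorem IsPositiveHodgeIsometry.exists_spectralCondition (hS : IsEigenSystem ψ Φ Ψ ε M F v)
    (hF : IsPositiveHodgeIsometry L h F) : ∃ τ, SpectralCondition Φ Ψ ε τ := by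
  obtain ⟨δ, hδ⟩ := hS.exists_periodEigenvalue h hF.1.map_20
  obtain ⟨l, hl, hroot, hall⟩ := hδ.exists_one_lt hS hF.2
  obtain ⟨τ, h1, h2, h3, h4, h5⟩ := hS.herm_of_norm_one hδ.root hδ.norm_eq
  have hsq : ∀ t : ℝ, -2 < t → t < 2 → 0 < 4 - t ^ 2 := fun t _ _ => by nlinarith
  refine ⟨τ, ⟨l + l⁻¹, ?_, ?_, fun z hz => ?_⟩, hδ.simple hS, ⟨h1, h2⟩, h4, ?_, ?_⟩
  · have h6 : 0 < (l - 1) ^ 2 / l := by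
      have : 0 < l - 1 := by linarith
      positivity
    have h7 : l + l⁻¹ - 2 = (l - 1) ^ 2 / l := by
      field_simp
      ring
    linarith
  · have := (hS.root_iff (hS.root_ne_zero hroot)).mp hroot
    push_cast
    exact this
  · obtain ⟨μ, h0, rfl⟩ := exists_add_inv_eq z
    have hμ := (hS.root_iff h0).mpr hz
    rcases hall μ hμ with h6 | rfl | rfl
    · exact Or.inr (trace_of_norm_one h6 (hS.root_sq_ne_one hμ))
    · left
      push_cast
      rfl
    · left
      push_cast
      rw [inv_inv, add_comm]
  · have h6 := hδ.pos
    rw [h5] at h6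
    exact pos_of_mul_pos_right h6 (hsq τ h1 h2).le
  · intro t ht1 ht2 ht hne
    obtain ⟨μ, h0, hμt⟩ := exists_add_inv_eq (t : ℂ)
    have hμ : aeval μ ψ = 0 := by
      rw [hS.root_iff h0, hμt, aeval_ofReal, ht, Complex.ofReal_zero]
    have hn := norm_one_of_trace h0 ht1.le ht2.le hμt
    obtain ⟨t', _, _, h8, h9, h10⟩ := hS.herm_of_norm_one hμ hn
    have htt : t' = t := by
      rw [hμt] at h8
      exact_mod_cast h8.symm
    have h11 := hδ.neg_of_root hS hμ ?_ ?_ hn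
    · rw [h10, htt] at h11
      exact neg_of_mul_neg_right h11 (hsq t ht1 ht2).le
    · rintro rfl
      rw [h3] at hμt
      exact hne (by exact_mod_cast hμt.symm)
    · rintro rfl
      rw [star_eq_inv_of_norm_one hδ.norm_eq, inv_inv, add_comm, h3] at hμt
      exact hne (by exact_mod_cast hμt.symm)

/-- The period eigenvalue lies over the root `τ`, the only one at which the length is positive. -/
theorem IsPeriodEigenvalue.trace_eq (hS : IsEigenSystem ψ Φ Ψ ε M F v)
    (hδ : IsPeriodEigenvalue ψ v h δ) {τ : ℝ} (hτ : SpectralCondition Φ Ψ ε τ) :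
    δ + δ⁻¹ = τ := by
  obtain ⟨t, h1, h2, h3, h4, h5⟩ := hS.herm_of_norm_one hδ.root hδ.norm_eq
  rw [h3]
  by_contra hne
  have h6 := hτ.neg t h1 h2 h4 (fun h => hne (by rw [h]))
  have h7 := hδ.pos
  rw [h5] at h7
  have : 0 < 4 - t ^ 2 := by nlinarith
  nlinarith

theorem IsEigenSystem.isSpecialTrace_iff (hS : IsEigenSystem ψ Φ Ψ ε M F v) {τ : ℝ}
    (hτ : SpectralCondition Φ Ψ ε τ) (hF : IsHodgeIsometry L h F) (τ' : ℝ) :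
    IsSpecialTrace h F τ' ↔ τ' = τ := by
  obtain ⟨δ, hδ⟩ := hS.exists_periodEigenvalue h hF.map_20
  have hv0 := hS.ne_zero hδ.root
  have htr := hδ.trace_eq hS hτ
  constructor
  · rintro ⟨δ', -, h1, -, h2⟩
    have h3 := h1 (v δ) (by rw [hδ.H20_eq]; exact Submodule.mem_span_singleton_self _)
    rw [hS.eigen hδ.root] at h3
    have h4 : δ = δ' := smul_left_injective ℂ hv0 h3
    rw [← h4, htr] at h2
    exact_mod_cast h2
  · rintro rfl
    refine ⟨δ, hδ.norm_eq, fun x hx => ?_, fun x hx => ?_, htr.symm⟩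
    · rw [hδ.H20_eq, Submodule.mem_span_singleton] at hx
      obtain ⟨a, rfl⟩ := hx
      rw [Matrix.mulVec_smul, hS.eigen hδ.root, smul_comm]
    · rw [hδ.H02_eq, Submodule.mem_span_singleton] at hx
      obtain ⟨a, rfl⟩ := hx
      rw [Matrix.mulVec_smul, hS.eigen (aeval_star_eq_zero hδ.root), smul_comm,
        star_eq_inv_of_norm_one hδ.norm_eq]

theorem IsEigenSystem.eqUpToConj (hS : IsEigenSystem ψ Φ Ψ ε M F v) {τ : ℝ}
    (hτ : SpectralCondition Φ Ψ ε τ) {h h' : HodgeStructure M} (hF : IsHodgeIsometry L h F)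
    (hF' : IsHodgeIsometry L h' F) : h.EqUpToConj h' := by
  obtain ⟨δ, hδ⟩ := hS.exists_periodEigenvalue h hF.map_20
  obtain ⟨δ', hδ'⟩ := hS.exists_periodEigenvalue h' hF'.map_20
  have htr := (hδ.trace_eq hS hτ).trans (hδ'.trace_eq hS hτ).symm
  have hd := star_eq_inv_of_norm_one hδ'.norm_eq
  rcases eq_or_eq_inv_of_trace_eq (hS.root_ne_zero hδ.root) (hS.root_ne_zero hδ'.root) htr with
    h1 | h1
  · refine ⟨?_, Or.inl ⟨?_, ?_⟩⟩
    · ext x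
      rw [hδ'.mem_H11, hδ.mem_H11, h1]
    · rw [hδ'.H20_eq, hδ.H20_eq, h1]
    · rw [hδ'.H02_eq, hδ.H02_eq, h1]
  · rw [← hd] at h1
    refine ⟨?_, Or.inr ⟨?_, ?_⟩⟩
    · ext x
      rw [hδ'.mem_H11, hδ.mem_H11, h1, star_star, and_comm]
    · rw [hδ'.H20_eq, hδ.H02_eq, h1, star_star]
    · rw [hδ'.H02_eq, hδ.H20_eq, h1]

/-- A real number greater than `2` is the trace of a real number greater than `1`. -/
theorem exists_one_lt_trace {t : ℝ} (ht : 2 < t) : ∃ l : ℝ, 1 < l ∧ l + l⁻¹ = t := by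
  have h1 : 0 < t ^ 2 - 4 := by nlinarith
  have h2 := Real.sqrt_pos.mpr h1
  have h3 := Real.sq_sqrt h1.le
  refine ⟨(t + √(t ^ 2 - 4)) / 2, by linarith, ?_⟩
  have : t + √(t ^ 2 - 4) ≠ 0 := by linarith
  field_simp
  linear_combination h3

theorem SpectralCondition.exists_eigenvalue (hS : IsEigenSystem ψ Φ Ψ ε M F v) {τ : ℝ}
    (hτ : SpectralCondition Φ Ψ ε τ) : ∃ l : ℝ, 1 < l ∧ aeval (l : ℂ) ψ = 0 ∧
      ∀ μ : ℂ, aeval μ ψ = 0 → ‖μ‖ = 1 ∨ μ = l ∨ μ = (l : ℂ)⁻¹ := by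
  obtain ⟨t₀, ht₀, hroot, hall⟩ := hτ.exists_gt
  obtain ⟨l, hl, hlt⟩ := exists_one_lt_trace ht₀
  have hl0 : (l : ℂ) ≠ 0 := by
    norm_cast
    linarith
  have hlt' : (l : ℂ) + (l : ℂ)⁻¹ = t₀ := by exact_mod_cast congrArg (fun x : ℝ => (x : ℂ)) hlt
  refine ⟨l, hl, ?_, fun μ hμ => ?_⟩
  · rw [hS.root_iff hl0, hlt']
    exact hroot
  · have h0 := hS.root_ne_zero hμ
    rcases hall _ ((hS.root_iff h0).mp hμ) with h1 | ⟨t, h1, h2, h3⟩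
    · exact Or.inr (eq_or_eq_inv_of_trace_eq h0 hl0 (h1.trans hlt'.symm))
    · exact Or.inl (norm_one_of_trace h0 h1.le h2.le h3)

theorem SpectralCondition.isHyperbolic (hS : IsEigenSystem ψ Φ Ψ ε M F v) {τ : ℝ}
    (hτ : SpectralCondition Φ Ψ ε τ) : IsHyperbolic F := by
  obtain ⟨l, hl, hroot, hall⟩ := hτ.exists_eigenvalue hS
  have hev : ∀ μ : ℂ, aeval μ ψ = 0 → Module.End.HasEigenvalue (Matrix.toLin' (toC F)) μ :=
    fun μ hμ => Module.End.hasEigenvalue_of_hasEigenvector (x := v μ)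
      (Module.End.hasEigenvector_iff.mpr
        ⟨Module.End.mem_eigenspace_iff.mpr (by simpa using hS.eigen hμ), hS.ne_zero hμ⟩)
  have hnl : ‖(l : ℂ)‖ ≠ 1 := by
    rw [Complex.norm_real, Real.norm_eq_abs, abs_of_pos (by linarith)]
    exact hl.ne'
  refine ⟨l, hl, fun μ => ⟨?_, ?_⟩⟩
  · rintro ⟨h1, h2⟩
    obtain ⟨w, hw⟩ := h1.exists_hasEigenvector
    have hw' := Module.End.mem_eigenspace_iff.mp hw.1
    rw [Matrix.toLin'_apply] at hw'
    exact (hall μ (hS.root_of_eigenvector hw.2 hw')).resolve_left h2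
  · rintro (rfl | rfl)
    · exact ⟨hev _ hroot, hnl⟩
    · refine ⟨hev _ (hS.root_inv hroot), ?_⟩
      rw [norm_inv]
      intro h2
      exact hnl (inv_eq_one.mp h2)

end HodgeAnalysis

/-! ### The Hodge structure defined by a positive eigenvector -/

/-- An orthogonal system of eigenvectors of an isometry `F` that splits off a positive complex
line spanned by `p`, a hyperbolic plane spanned by `x` and `y`, and a negative definite space of
dimension `18` spanned by the `w i`. -/
structure HodgeFrame {ι : Type} [Fintype ι] (M F : Matrix (Fin 22) (Fin 22) ℚ)
    (p x y : Fin 22 → ℂ) (w : ι → Fin 22 → ℂ) (δ : ℂ) (l g : ℝ) : Prop where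
  symm : M.IsSymm
  isometry : F.transpose * M * F = M
  injective : Function.Injective (toC F).mulVec
  card : Fintype.card ι = 18
  norm_eq : ‖δ‖ = 1
  one_lt : 1 < l
  g_ne : g ≠ 0
  eigen_p : (toC F).mulVec p = δ • p
  eigen_x : (toC F).mulVec x = (l : ℂ) • x
  eigen_y : (toC F).mulVec y = (l : ℂ)⁻¹ • y
  eigen_w : ∀ i, ∃ ν : ℂ, (toC F).mulVec (w i) = ν • w i
  pp : 0 < (hermForm M p p).re
  pp' : hermForm M p (star p) = 0
  xx : hermForm M x x = 0
  yy : hermForm M y y = 0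
  xy : hermForm M x y = g
  xp : hermForm M x p = 0
  xp' : hermForm M x (star p) = 0
  yp : hermForm M y p = 0
  yp' : hermForm M y (star p) = 0
  wp : ∀ i, hermForm M (w i) p = 0
  wp' : ∀ i, hermForm M (w i) (star p) = 0
  wx : ∀ i, hermForm M (w i) x = 0
  wy : ∀ i, hermForm M (w i) y = 0
  ww : ∀ i j, i ≠ j → hermForm M (w i) (w j) = 0
  w_neg : ∀ i, (hermForm M (w i) (w i)).re < 0

/-- The orthogonal complement of a vector. -/
def orthC {n : ℕ} (M : Matrix (Fin n) (Fin n) ℚ) (p : Fin n → ℂ) :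
    Submodule ℂ (Fin n → ℂ) where
  carrier := {v | hermForm M v p = 0}
  add_mem' {a b} ha hb := by
    simp only [Set.mem_ofPred_eq] at ha hb ⊢
    rw [hermForm_add_left, ha, hb, add_zero]
  zero_mem' := hermForm_zero_left p
  smul_mem' c a ha := by
    simp only [Set.mem_ofPred_eq] at ha ⊢
    rw [hermForm_smul_left, ha, mul_zero]

namespace HodgeFrame

variable {ι : Type} [Fintype ι] {M F : Matrix (Fin 22) (Fin 22) ℚ} {p x y : Fin 22 → ℂ}
  {w : ι → Fin 22 → ℂ} {δ : ℂ} {l g : ℝ} (hf : HodgeFrame M F p x y w δ l g)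

/-- The orthogonal basis of the negative part. -/
def negFamily (x y : Fin 22 → ℂ) (w : ι → Fin 22 → ℂ) (g : ℝ) : Option ι → Fin 22 → ℂ
  | none => x - (g : ℂ) • y
  | some i => w i

include hf

theorem yx : hermForm M y x = g := by
  rw [← star_hermForm hf.symm, hf.xy]
  exact Complex.conj_ofReal g

theorem star_g : star (g : ℂ) = g := by
  exact Complex.conj_ofReal g

theorem star_p_p : hermForm M (star p) p = 0 := hermForm_eq_zero_comm hf.symm hf.pp'

theorem star_pp : 0 < (hermForm M (star p) (star p)).re := by
  rw [hermForm_star_self hf.symm]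
  exact hf.pp

theorem pp_ne : hermForm M p p ≠ 0 := by
  intro h
  have := hf.pp
  rw [h] at this
  simp at this

theorem plus_self : hermForm M (x + (g : ℂ) • y) (x + (g : ℂ) • y) = ((2 * (g * g) : ℝ) : ℂ) := by
  simp only [hermForm_add_left, hermForm_add_right, hermForm_smul_left, hermForm_smul_right,
    hf.xx, hf.yy, hf.yx, hf.xy, hf.star_g]
  push_cast
  ring

theorem minus_self :
    hermForm M (x - (g : ℂ) • y) (x - (g : ℂ) • y) = ((-(2 * (g * g)) : ℝ) : ℂ) := by
  simp only [hermForm_sub_left, hermForm_sub_right, hermForm_smul_left, hermForm_smul_right,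
    hf.xx, hf.yy, hf.yx, hf.xy, hf.star_g]
  push_cast
  ring

theorem gg_pos : 0 < g * g := mul_self_pos.mpr hf.g_ne

/-- The vectors `x - g y` and `w i` span a negative definite space of dimension `19`. -/
theorem neg_family :
    Module.finrank ℂ (Submodule.span ℂ (Set.range (negFamily x y w g))) = 19 ∧
      ∀ v ∈ Submodule.span ℂ (Set.range (negFamily x y w g)), v ≠ 0 →
        (hermForm M v v).re < 0 := by
  have h := orthogonal_family (M := M) (e := -1) (w := negFamily x y w g) ?_ ?_
  · rw [Fintype.card_option, hf.card] at h
    exact ⟨h.1, fun v hv hv0 => by have := h.2 v hv hv0; linarith⟩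
  · have h1 : ∀ i, hermForm M (w i) (x - (g : ℂ) • y) = 0 := by
      intro i
      rw [hermForm_sub_right, hermForm_smul_right, hf.wx, hf.wy]
      simp
    rintro (- | i) (- | j) hij
    · exact absurd rfl hij
    · exact hermForm_eq_zero_comm hf.symm (h1 j)
    · exact h1 i
    · exact hf.ww i j fun h => hij (by rw [h])
  · rintro (- | i)
    · change 0 < -1 * (hermForm M (x - (g : ℂ) • y) (x - (g : ℂ) • y)).re
      rw [hf.minus_self, Complex.ofReal_re]
      have := hf.gg_pos
      linarith
    · have := hf.w_neg i
      change 0 < -1 * (hermForm M (w i) (w i)).re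
      linarith

theorem plus_orth : hermForm M (x + (g : ℂ) • y) p = 0 ∧
    hermForm M (x + (g : ℂ) • y) (star p) = 0 := by
  constructor
  · rw [hermForm_add_left, hermForm_smul_left, hf.xp, hf.yp]
    simp
  · rw [hermForm_add_left, hermForm_smul_left, hf.xp', hf.yp']
    simp

theorem hasSignature : HasSignature M ⊤ 3 19 := by
  have h := orthogonal_family (M := M) (e := 1) (w := ![p, star p, x + (g : ℂ) • y]) ?_ ?_
  · refine ⟨by simp, ⟨_, le_top, by simpa using h.1, fun v hv hv0 => ?_⟩,
      ⟨_, le_top, hf.neg_family.1, hf.neg_family.2⟩⟩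
    simpa using h.2 v hv hv0
  · obtain ⟨h1, h2⟩ := hf.plus_orth
    have h3 := hermForm_eq_zero_comm hf.symm h1
    have h4 := hermForm_eq_zero_comm hf.symm h2
    intro i j hij
    fin_cases i <;> fin_cases j <;> simp_all [hf.pp', hf.star_p_p]
  · intro i
    fin_cases i
    · simpa using hf.pp
    · simpa using hf.star_pp
    · change 0 < 1 * (hermForm M (x + (g : ℂ) • y) (x + (g : ℂ) • y)).re
      rw [hf.plus_self, Complex.ofReal_re]
      have := hf.gg_pos
      linarith

theorem negFamily_le : Submodule.span ℂ (Set.range (negFamily x y w g)) ≤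
    orthC M p ⊓ orthC M (star p) := by
  rw [Submodule.span_le]
  rintro _ ⟨(- | i), rfl⟩
  · refine ⟨?_, ?_⟩
    · change hermForm M (x - (g : ℂ) • y) p = 0
      rw [hermForm_sub_left, hermForm_smul_left, hf.xp, hf.yp]
      simp
    · change hermForm M (x - (g : ℂ) • y) (star p) = 0
      rw [hermForm_sub_left, hermForm_smul_left, hf.xp', hf.yp']
      simp
  · exact ⟨hf.wp i, hf.wp' i⟩

theorem plus_span : Module.finrank ℂ (Submodule.span ℂ {x + (g : ℂ) • y}) = 1 ∧
    ∀ v ∈ Submodule.span ℂ {x + (g : ℂ) • y}, v ≠ 0 → 0 < (hermForm M v v).re := by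
  have h := orthogonal_family (M := M) (e := 1) (w := fun _ : Unit => x + (g : ℂ) • y)
    (fun i j hij => absurd (Subsingleton.elim i j) hij) (fun _ => by
      rw [hf.plus_self, Complex.ofReal_re]
      have := hf.gg_pos
      linarith)
  rw [Set.range_const] at h
  exact ⟨h.1, fun v hv hv0 => by simpa using h.2 v hv hv0⟩

theorem plus_le : Submodule.span ℂ {x + (g : ℂ) • y} ≤ orthC M p ⊓ orthC M (star p) := by
  rw [Submodule.span_singleton_le_iff_mem]
  exact hf.plus_orth

/-- A combination of `p` and its conjugate that is orthogonal to both vanishes. -/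
theorem eq_zero_of_mem_span {v : Fin 22 → ℂ} (hv : v ∈ Submodule.span ℂ {p} ⊔
    Submodule.span ℂ {star p}) (h1 : hermForm M v p = 0) (h2 : hermForm M v (star p) = 0) :
    v = 0 := by
  obtain ⟨a, ha, b, hb, rfl⟩ := Submodule.mem_sup.mp hv
  obtain ⟨c, rfl⟩ := Submodule.mem_span_singleton.mp ha
  obtain ⟨d, rfl⟩ := Submodule.mem_span_singleton.mp hb
  rw [hermForm_add_left, hermForm_smul_left, hermForm_smul_left, hf.star_p_p, mul_zero,
    add_zero] at h1
  rw [hermForm_add_left, hermForm_smul_left, hermForm_smul_left, hf.pp', mul_zero, zero_add,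
    hermForm_star_self hf.symm] at h2
  rw [(mul_eq_zero.mp h1).resolve_right hf.pp_ne, (mul_eq_zero.mp h2).resolve_right hf.pp_ne]
  simp

theorem finrank_orth : Module.finrank ℂ (orthC M p ⊓ orthC M (star p) : Submodule ℂ _) = 20 := by
  refine le_antisymm ?_ ?_
  · have h := orthogonal_family (M := M) (e := 1) (w := ![p, star p])
      (fun i j hij => by fin_cases i <;> fin_cases j <;> simp_all [hf.pp', hf.star_p_p])
      (fun i => by
        fin_cases i
        · simpa using hf.pp
        · simpa using hf.star_pp)
    have h1 := Submodule.finrank_sup_add_finrank_inf_eq (orthC M p ⊓ orthC M (star p))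
      (Submodule.span ℂ (Set.range ![p, star p]))
    have h2 : (orthC M p ⊓ orthC M (star p)) ⊓ Submodule.span ℂ (Set.range ![p, star p]) = ⊥ := by
      refine (Submodule.eq_bot_iff _).mpr fun v hv => ?_
      refine hf.eq_zero_of_mem_span ?_ hv.1.1 hv.1.2
      rw [← Submodule.span_union]
      have := hv.2
      rw [Matrix.range_cons, Matrix.range_cons, Matrix.range_empty, Set.union_empty] at this
      exact this
    rw [h2, finrank_bot, h.1, Fintype.card_fin] at h1
    have h3 := Submodule.finrank_le ((orthC M p ⊓ orthC M (star p)) ⊔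
      Submodule.span ℂ (Set.range ![p, star p]))
    rw [Module.finrank_fin_fun] at h3
    omega
  · have h := finrank_add_finrank_le (e := 1) (M := M) hf.plus_le hf.negFamily_le
      (fun v hv hv0 => by simpa using hf.plus_span.2 v hv hv0) (fun v hv => by
        rcases eq_or_ne v 0 with rfl | hv0
        · simp [hermForm_zero_left]
        · simpa using (hf.neg_family.2 v hv hv0).le)
    rw [hf.plus_span.1, hf.neg_family.1] at h
    exact h

theorem hasSignature_orth : HasSignature M (orthC M p ⊓ orthC M (star p)) 1 19 :=
  ⟨hf.finrank_orth, ⟨_, hf.plus_le, hf.plus_span⟩, ⟨_, hf.negFamily_le, hf.neg_family⟩⟩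

theorem isInternal : DirectSum.IsInternal
    ![Submodule.span ℂ {p}, orthC M p ⊓ orthC M (star p), Submodule.span ℂ {star p}] := by
  have hle1 : Submodule.span ℂ {p} ≤ orthC M (star p) := by
    rw [Submodule.span_singleton_le_iff_mem]
    exact hf.pp'
  have hle2 : Submodule.span ℂ {star p} ≤ orthC M p := by
    rw [Submodule.span_singleton_le_iff_mem]
    exact hf.star_p_p
  refine DirectSum.isInternal_submodule_of_iSupIndep_of_iSup_eq_top ?_ ?_
  · intro i
    rw [disjoint_iff, Submodule.eq_bot_iff]
    intro v hv
    obtain ⟨hv1, hv2⟩ := hv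
    fin_cases i
    · have h1 : v ∈ orthC M p := by
        refine (iSup₂_le fun j hj => ?_ : _ ≤ orthC M p) hv2
        fin_cases j
        · exact absurd rfl hj
        · exact inf_le_left
        · exact hle2
      exact hf.eq_zero_of_mem_span (Submodule.mem_sup_left hv1) h1 (hle1 hv1)
    · have h1 : v ∈ Submodule.span ℂ {p} ⊔ Submodule.span ℂ {star p} := by
        refine (iSup₂_le fun j hj => ?_ : _ ≤ Submodule.span ℂ {p} ⊔ Submodule.span ℂ {star p}) hv2
        fin_cases j
        · exact le_sup_left
        · exact absurd rfl hj
        · exact le_sup_right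
      exact hf.eq_zero_of_mem_span h1 hv1.1 hv1.2
    · have h1 : v ∈ orthC M (star p) := by
        refine (iSup₂_le fun j hj => ?_ : _ ≤ orthC M (star p)) hv2
        fin_cases j
        · exact hle1
        · exact inf_le_right
        · exact absurd rfl hj
      exact hf.eq_zero_of_mem_span (Submodule.mem_sup_right hv1) (hle2 hv1) h1
  · refine eq_top_iff.mpr fun v _ => ?_
    set a := hermForm M v p / hermForm M p p with ha
    set b := hermForm M v (star p) / hermForm M p p with hb
    have h1 : v = a • p + (v - a • p - b • star p) + b • star p := by abel
    have h2 := hf.pp_ne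
    rw [h1]
    refine add_mem (add_mem ?_ ?_) ?_
    · exact Submodule.mem_iSup_of_mem (0 : Fin 3)
        (Submodule.smul_mem _ _ (Submodule.mem_span_singleton_self _))
    · refine Submodule.mem_iSup_of_mem (1 : Fin 3) ⟨?_, ?_⟩
      · change hermForm M _ p = 0
        rw [hermForm_sub_left, hermForm_sub_left, hermForm_smul_left, hermForm_smul_left,
          hf.star_p_p, ha]
        field_simp
        ring
      · change hermForm M _ (star p) = 0
        rw [hermForm_sub_left, hermForm_sub_left, hermForm_smul_left, hermForm_smul_left,
          hf.pp', hermForm_star_self hf.symm, hb]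
        field_simp
        ring
    · exact Submodule.mem_iSup_of_mem (2 : Fin 3)
        (Submodule.smul_mem _ _ (Submodule.mem_span_singleton_self _))

omit hf in
theorem hasSignature_span {p : Fin 22 → ℂ} (hp : 0 < (hermForm M p p).re) :
    HasSignature M (Submodule.span ℂ {p}) 1 0 := by
  have h := orthogonal_family (M := M) (e := 1) (w := fun _ : Unit => p)
    (fun i j hij => absurd (Subsingleton.elim i j) hij) (fun _ => by simpa using hp)
  rw [Set.range_const] at h
  exact ⟨h.1, ⟨_, le_rfl, h.1, fun v hv hv0 => by simpa using h.2 v hv hv0⟩,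
    ⟨⊥, bot_le, finrank_bot _ _, fun v hv hv0 => absurd ((Submodule.mem_bot ℂ).mp hv) hv0⟩⟩

/-- The Hodge structure with `H^{2,0}` spanned by `p`. -/
def hodgeStructure : HodgeStructure M where
  H20 := Submodule.span ℂ {p}
  H11 := orthC M p ⊓ orthC M (star p)
  H02 := Submodule.span ℂ {star p}
  isInternal := hf.isInternal
  orthogonal_20_11 := by
    intro v hv w hw
    obtain ⟨c, rfl⟩ := Submodule.mem_span_singleton.mp hv
    rw [hermForm_smul_left, hermForm_eq_zero_comm hf.symm hw.1, mul_zero]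
  orthogonal_20_02 := by
    intro v hv w hw
    obtain ⟨c, rfl⟩ := Submodule.mem_span_singleton.mp hv
    obtain ⟨d, rfl⟩ := Submodule.mem_span_singleton.mp hw
    rw [hermForm_smul_left, hermForm_smul_right, hf.pp', mul_zero, mul_zero]
  orthogonal_11_02 := by
    intro v hv w hw
    obtain ⟨d, rfl⟩ := Submodule.mem_span_singleton.mp hw
    rw [hermForm_smul_right, hv.2, mul_zero]
  signature_20 := hasSignature_span hf.pp
  signature_11 := hf.hasSignature_orth
  signature_02 := hasSignature_span hf.star_pp
  conj_20 := by
    intro v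
    rw [Submodule.mem_span_singleton, Submodule.mem_span_singleton]
    constructor
    · rintro ⟨c, hc⟩
      exact ⟨star c, by rw [← star_star v, ← hc, star_smul, star_star]⟩
    · rintro ⟨c, hc⟩
      exact ⟨star c, by rw [← hc, star_smul]⟩
  conj_11 := by
    intro v
    change hermForm M (star v) p = 0 ∧ hermForm M (star v) (star p) = 0 ↔
      hermForm M v p = 0 ∧ hermForm M v (star p) = 0
    rw [hermForm_star_left, hermForm_star_left, star_star, star_eq_zero, star_eq_zero]
    exact and_comm

theorem eigen_star : (toC F).mulVec (star p) = star δ • star p := by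
  rw [← star_toC_mulVec, hf.eigen_p, star_smul]

theorem delta_ne : δ ≠ 0 := by
  rintro rfl
  have := hf.norm_eq
  simp at this

omit hf in
theorem map_span_eigen {F : Matrix (Fin 22) (Fin 22) ℂ} {p : Fin 22 → ℂ} {δ : ℂ}
    (h : F.mulVec p = δ • p) (hδ : δ ≠ 0) :
    (Submodule.span ℂ {p}).map (Matrix.toLin' F) = Submodule.span ℂ {p} := by
  rw [Submodule.map_span, Set.image_singleton, Matrix.toLin'_apply, h]
  exact Submodule.span_singleton_smul_eq (isUnit_iff_ne_zero.mpr hδ) p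

theorem mulVec_mem_orth_iff (v : Fin 22 → ℂ) :
    (toC F).mulVec v ∈ orthC M p ⊓ orthC M (star p) ↔ v ∈ orthC M p ⊓ orthC M (star p) := by
  have h1 : hermForm M ((toC F).mulVec v) p = δ⁻¹⁻¹ * hermForm M v p := by
    have h := hermForm_isometry hf.isometry v p
    rw [hf.eigen_p, hermForm_smul_right, star_eq_inv_of_norm_one hf.norm_eq] at h
    rw [← h, inv_inv, mul_inv_cancel_left₀ hf.delta_ne]
  have h2 : hermForm M ((toC F).mulVec v) (star p) = δ⁻¹ * hermForm M v (star p) := by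
    have h := hermForm_isometry hf.isometry v (star p)
    rw [hf.eigen_star, hermForm_smul_right, star_star] at h
    rw [← h, inv_mul_cancel_left₀ hf.delta_ne]
  change _ = _ ∧ _ = _ ↔ _ = _ ∧ _ = _
  rw [h1, h2]
  simp [hf.delta_ne]

theorem map_orth : (orthC M p ⊓ orthC M (star p)).map (Matrix.toLin' (toC F)) =
    orthC M p ⊓ orthC M (star p) := by
  have hsurj : Function.Surjective (Matrix.toLin' (toC F)) :=
    LinearMap.injective_iff_surjective.mp hf.injective
  refine le_antisymm ?_ fun v hv => ?_
  · rintro _ ⟨v, hv, rfl⟩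
    exact (hf.mulVec_mem_orth_iff v).mpr hv
  · obtain ⟨u, rfl⟩ := hsurj v
    exact ⟨u, (hf.mulVec_mem_orth_iff u).mp hv, rfl⟩

/-- The orthogonal complement of `p` and its conjugate is the sum of the hyperbolic plane and the
negative part. -/
theorem orth_le : orthC M p ⊓ orthC M (star p) ≤
    Submodule.span ℂ {x, y} ⊔ Submodule.span ℂ (Set.range w) := by
  have h1 : Submodule.span ℂ {x + (g : ℂ) • y} ⊔
      Submodule.span ℂ (Set.range (negFamily x y w g)) = orthC M p ⊓ orthC M (star p) := by
    refine Submodule.eq_of_le_of_finrank_le (sup_le hf.plus_le hf.negFamily_le) ?_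
    have h := finrank_add_finrank_le (e := 1) (M := M)
      (le_sup_left : Submodule.span ℂ {x + (g : ℂ) • y} ≤ _)
      (le_sup_right : Submodule.span ℂ (Set.range (negFamily x y w g)) ≤ _)
      (fun v hv hv0 => by simpa using hf.plus_span.2 v hv hv0) (fun v hv => by
        rcases eq_or_ne v 0 with rfl | hv0
        · simp [hermForm_zero_left]
        · simpa using (hf.neg_family.2 v hv hv0).le)
    rw [hf.plus_span.1, hf.neg_family.1] at h
    rw [hf.finrank_orth]
    exact h
  have hx : x ∈ Submodule.span ℂ {x, y} := Submodule.subset_span (by simp)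
  have hy : y ∈ Submodule.span ℂ {x, y} := Submodule.subset_span (by simp)
  rw [← h1]
  refine sup_le ?_ ?_
  · rw [Submodule.span_singleton_le_iff_mem]
    exact Submodule.mem_sup_left (add_mem hx (Submodule.smul_mem _ _ hy))
  · rw [Submodule.span_le]
    rintro _ ⟨(- | i), rfl⟩
    · exact Submodule.mem_sup_left (sub_mem hx (Submodule.smul_mem _ _ hy))
    · exact Submodule.mem_sup_right (Submodule.subset_span ⟨i, rfl⟩)

theorem w_family : ∀ v ∈ Submodule.span ℂ (Set.range w), (hermForm M v v).re ≤ 0 := by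
  have h := orthogonal_family (M := M) (e := -1) (w := w) hf.ww
    (fun i => by have := hf.w_neg i; linarith)
  intro v hv
  rcases eq_or_ne v 0 with rfl | hv0
  · simp [hermForm_zero_left]
  · have := h.2 v hv hv0
    linarith

omit hf in
/-- Hermitian lengths in the sum of a hyperbolic plane and a space orthogonal to it. -/
theorem re_hermForm_plane {x y n : Fin 22 → ℂ} (hM : M.IsSymm) (hxx : hermForm M x x = 0)
    (hyy : hermForm M y y = 0) (hxy : hermForm M x y = g) (hnx : hermForm M n x = 0)
    (hny : hermForm M n y = 0) (a b : ℂ) :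
    (hermForm M (a • x + b • y + n) (a • x + b • y + n)).re =
      2 * (a * star b).re * g + (hermForm M n n).re := by
  have hyx : hermForm M y x = g := by
    rw [← star_hermForm hM, hxy]
    exact Complex.conj_ofReal g
  simp only [hermForm_add_left, hermForm_add_right, hermForm_smul_left, hermForm_smul_right,
    hxx, hyy, hxy, hyx, hnx, hny, hermForm_eq_zero_comm hM hnx, hermForm_eq_zero_comm hM hny]
  simp
  ring

/-- The key inequality for positivity: on time-like vectors `(v, F v) ≥ (v, v)`, because `F` moves
a vector in the hyperbolic plane and in the negative definite part by a vector of nonpositive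
length. -/
theorem le_hermForm_mulVec {v : Fin 22 → ℂ} (hv : v ∈ orthC M p ⊓ orthC M (star p))
    (hpos : 0 < (hermForm M v v).re) :
    (hermForm M v v).re ≤ (hermForm M v ((toC F).mulVec v)).re := by
  obtain ⟨u, hu, n, hn, huv⟩ := Submodule.mem_sup.mp (hf.orth_le hv)
  obtain ⟨a, b, hab⟩ := Submodule.mem_span_pair.mp hu
  have hw : ∀ k ∈ Submodule.span ℂ (Set.range w), hermForm M k x = 0 ∧ hermForm M k y = 0 := by
    intro k hk
    have : Submodule.span ℂ (Set.range w) ≤ orthC M x ⊓ orthC M y := by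
      rw [Submodule.span_le]
      rintro _ ⟨i, rfl⟩
      exact ⟨hf.wx i, hf.wy i⟩
    exact this hk
  have hFn : n - (toC F).mulVec n ∈ Submodule.span ℂ (Set.range w) := by
    refine sub_mem hn ?_
    have : (Submodule.span ℂ (Set.range w)).map (Matrix.toLin' (toC F)) ≤
        Submodule.span ℂ (Set.range w) := by
      rw [Submodule.map_span, Submodule.span_le]
      rintro _ ⟨_, ⟨i, rfl⟩, rfl⟩
      obtain ⟨ν, hν⟩ := hf.eigen_w i
      rw [Matrix.toLin'_apply, hν]
      exact Submodule.smul_mem _ _ (Submodule.subset_span ⟨i, rfl⟩)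
    exact this ⟨n, hn, rfl⟩
  have hvd : v = a • x + b • y + n := by rw [hab, huv]
  have hd : v - (toC F).mulVec v =
      (a * (1 - l)) • x + (b * (1 - (l : ℂ)⁻¹)) • y + (n - (toC F).mulVec n) := by
    rw [hvd, Matrix.mulVec_add, Matrix.mulVec_add, Matrix.mulVec_smul, Matrix.mulVec_smul,
      hf.eigen_x, hf.eigen_y]
    module
  have h1 := re_hermForm_plane hf.symm hf.xx hf.yy hf.xy (hw n hn).1 (hw n hn).2 a b
  have h2 := re_hermForm_plane hf.symm hf.xx hf.yy hf.xy (hw _ hFn).1 (hw _ hFn).2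
    (a * (1 - l)) (b * (1 - (l : ℂ)⁻¹))
  rw [← hvd] at h1
  rw [← hd] at h2
  have h3 : (a * (1 - (l : ℂ)) * star (b * (1 - (l : ℂ)⁻¹))).re =
      (1 - l) * (1 - l⁻¹) * (a * star b).re := by
    have : a * (1 - (l : ℂ)) * star (b * (1 - (l : ℂ)⁻¹)) =
        (((1 - l) * (1 - l⁻¹) : ℝ) : ℂ) * (a * star b) := by
      rw [star_mul', star_sub, star_one, star_inv₀, Complex.star_def,
        Complex.conj_ofReal]
      push_cast
      ring
    rw [this, Complex.re_ofReal_mul]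
  have h4 := hf.w_family n hn
  have h5 := hf.w_family _ hFn
  have hl := hf.one_lt
  have h6 : (1 - l) * (1 - l⁻¹) ≤ 0 := by
    have : l⁻¹ < 1 := inv_lt_one_of_one_lt₀ hl
    exact mul_nonpos_of_nonpos_of_nonneg (by linarith) (by linarith)
  have h7 : (hermForm M (v - (toC F).mulVec v) (v - (toC F).mulVec v)).re =
      2 * (hermForm M v v).re - 2 * (hermForm M v ((toC F).mulVec v)).re := by
    have h8 : (hermForm M ((toC F).mulVec v) v).re = (hermForm M v ((toC F).mulVec v)).re := by
      rw [← star_hermForm hf.symm]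
      simp
    rw [hermForm_sub_left, hermForm_sub_right, hermForm_sub_right,
      hermForm_isometry hf.isometry]
    simp only [Complex.sub_re, h8]
    ring
  rw [h3] at h2
  nlinarith

theorem mulVec_mem_cone_iff (a : Fin 22 → ℝ) :
    (toR F).mulVec a ∈ hf.hodgeStructure.cone ↔ a ∈ hf.hodgeStructure.cone := by
  rw [mem_cone, mem_cone, ← toC_mulVec_vecRC, hermForm_isometry hf.isometry]
  exact and_congr_left fun _ => hf.mulVec_mem_orth_iff _

/-- The segment from `a` to `F a` stays inside the cone. -/
theorem mulVec_mem_component {a : Fin 22 → ℝ} (ha : a ∈ hf.hodgeStructure.cone) :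
    (toR F).mulVec a ∈ connectedComponentIn hf.hodgeStructure.cone a := by
  have hFa := (hf.mulVec_mem_cone_iff a).mpr ha
  have hsub : segment ℝ a ((toR F).mulVec a) ⊆ hf.hodgeStructure.cone := by
    rintro _ ⟨s, t, hs, ht, hst, rfl⟩
    rw [mem_cone] at ha hFa ⊢
    have h1 := hf.le_hermForm_mulVec ha.1 ha.2
    have e : vecRC (s • a + t • (toR F).mulVec a) =
        (s : ℂ) • vecRC a + (t : ℂ) • vecRC ((toR F).mulVec a) := by
      ext i
      simp [vecRC]
    rw [e]
    refine ⟨add_mem (Submodule.smul_mem _ _ ha.1) (Submodule.smul_mem _ _ hFa.1), ?_⟩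
    have h2 : (hermForm M (vecRC ((toR F).mulVec a)) (vecRC a)).re =
        (hermForm M (vecRC a) (vecRC ((toR F).mulVec a))).re := by
      rw [← star_hermForm hf.symm]
      simp
    rw [toC_mulVec_vecRC] at h1
    simp only [hermForm_add_left, hermForm_add_right, hermForm_smul_left, hermForm_smul_right,
      Complex.star_def, Complex.conj_ofReal, Complex.add_re, Complex.re_ofReal_mul, h2]
    have h3 := ha.2
    have h4 := hFa.2
    rcases hs.eq_or_lt with rfl | hs
    · have ht1 : t = 1 := by linarith
      rw [ht1]
      simpa using h4
    · have h5 : 0 < s * (s * (hermForm M (vecRC a) (vecRC a)).re) := by positivity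
      have h6 : 0 ≤ s * (t * (hermForm M (vecRC a) (vecRC ((toR F).mulVec a))).re) := by
        have : 0 ≤ (hermForm M (vecRC a) (vecRC ((toR F).mulVec a))).re := by linarith
        positivity
      have h7 : 0 ≤ t * (t * (hermForm M (vecRC ((toR F).mulVec a))
        (vecRC ((toR F).mulVec a))).re) := by positivity
      nlinarith
  exact (convex_segment _ _).isPreconnected.subset_connectedComponentIn
    (left_mem_segment ℝ _ _) hsub (right_mem_segment ℝ _ _)

theorem isUnit_det_toR : IsUnit (toR F).det := by
  rw [← Matrix.isUnit_iff_isUnit_det, ← Matrix.mulVec_injective_iff_isUnit]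
  intro a b hab
  have h1 : (toC F).mulVec (vecRC a) = (toC F).mulVec (vecRC b) := by
    rw [toC_mulVec_vecRC, toC_mulVec_vecRC]
    exact congrArg vecRC hab
  have h2 := hf.injective h1
  ext i
  exact Complex.ofReal_injective (congrFun h2 i)

theorem image_component {a : Fin 22 → ℝ} (ha : a ∈ hf.hodgeStructure.cone) :
    (toR F).mulVec '' connectedComponentIn hf.hodgeStructure.cone a =
      connectedComponentIn hf.hodgeStructure.cone a := by
  have hu := hf.isUnit_det_toR
  let e : (Fin 22 → ℝ) ≃ₜ (Fin 22 → ℝ) :=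
    { toFun := (toR F).mulVec
      invFun := ((toR F)⁻¹).mulVec
      left_inv := fun a => by
        rw [Matrix.mulVec_mulVec, Matrix.nonsing_inv_mul _ hu, Matrix.one_mulVec]
      right_inv := fun a => by
        rw [Matrix.mulVec_mulVec, Matrix.mul_nonsing_inv _ hu, Matrix.one_mulVec]
      continuous_toFun := by fun_prop
      continuous_invFun := by fun_prop }
  have h1 : e '' connectedComponentIn hf.hodgeStructure.cone a =
      connectedComponentIn (e '' hf.hodgeStructure.cone) (e a) :=
    e.image_connectedComponentIn ha
  have h2 : e '' hf.hodgeStructure.cone = hf.hodgeStructure.cone := by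
    ext b
    constructor
    · rintro ⟨c, hc, rfl⟩
      exact (hf.mulVec_mem_cone_iff c).mpr hc
    · intro hb
      obtain ⟨c, rfl⟩ := e.surjective b
      exact ⟨c, (hf.mulVec_mem_cone_iff c).mp hb, rfl⟩
  rw [h2] at h1
  exact h1.trans (connectedComponentIn_eq (hf.mulVec_mem_component ha)).symm

theorem isPositiveHodgeIsometry {L : Submodule ℤ (Fin 22 → ℚ)}
    (hL : L.map ((Matrix.toLin' F).restrictScalars ℤ) = L) :
    IsPositiveHodgeIsometry L hf.hodgeStructure F :=
  ⟨⟨⟨hL, hf.isometry⟩, map_span_eigen hf.eigen_p hf.delta_ne, hf.map_orth,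
    map_span_eigen hf.eigen_star (star_ne_zero.mpr hf.delta_ne)⟩, fun _ ha => hf.image_component ha⟩

end HodgeFrame

/-! ### Sufficiency of the spectral condition -/

section Construction

variable {ψ Φ Ψ : ℤ[X]} {ε : ℝ} {M F : Matrix (Fin 22) (Fin 22) ℚ} {v : ℂ → Fin 22 → ℂ}

/-- Under the spectral condition the eigenvectors split into `v_δ`, its conjugate, the pair for `l`,
`l⁻¹` and `18` negative vectors. -/
theorem SpectralCondition.exists_hodgeFrame (hS : IsEigenSystem ψ Φ Ψ ε M F v) (hε : ε ≠ 0)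
    {τ : ℝ} (hτ : SpectralCondition Φ Ψ ε τ) :
    ∃ (Z : Finset ℂ) (δ : ℂ) (l g : ℝ),
      HodgeFrame M F (v δ) (v l) (v (l : ℂ)⁻¹) (fun μ : Z => v μ) δ l g := by
  classical
  obtain ⟨l, hl, hroot, hall⟩ := hτ.exists_eigenvalue hS
  obtain ⟨δ, hδ0, hδτ⟩ := exists_add_inv_eq (τ : ℂ)
  have hδ : aeval δ ψ = 0 := by
    rw [hS.root_iff hδ0, hδτ, aeval_ofReal, hτ.root, Complex.ofReal_zero]
  have hδn := norm_one_of_trace hδ0 hτ.mem.1.le hτ.mem.2.le hδτ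
  have hδi := star_eq_inv_of_norm_one hδn
  have hδ' := aeval_star_eq_zero hδ
  have hroot' := hS.root_inv hroot
  have hδne : star δ ≠ δ := by
    intro h1
    apply hS.root_sq_ne_one hδ
    rw [sq]
    nth_rewrite 1 [← h1]
    rw [hδi, inv_mul_cancel₀ hδ0]
  have hln : ‖(l : ℂ)‖ = l := by
    rw [Complex.norm_real, Real.norm_eq_abs, abs_of_pos (by linarith)]
  have hlinv : l⁻¹ < 1 := inv_lt_one_of_one_lt₀ hl
  have hln' : ‖(l : ℂ)⁻¹‖ = l⁻¹ := by rw [norm_inv, hln]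
  have hstar : star (l : ℂ) = l := Complex.conj_ofReal l
  have hstar' : star (l : ℂ)⁻¹ = (l : ℂ)⁻¹ := by rw [star_inv₀, hstar]
  have hnd := hS.nodup_complexRoots hτ.simple
  have horth : ∀ {μ ν : ℂ}, aeval μ ψ = 0 → aeval ν ψ = 0 → μ * star ν ≠ 1 →
      hermForm M (v μ) (v ν) = 0 := fun h1 h2 h3 =>
    hermForm_eigenvectors hS.isometry (hS.eigen h1) (hS.eigen h2) h3
  have horthn : ∀ {μ ν : ℂ}, aeval μ ψ = 0 → aeval ν ψ = 0 → ‖μ‖ * ‖ν‖ ≠ 1 →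
      hermForm M (v μ) (v ν) = 0 := fun h1 h2 h3 => horth h1 h2 fun h4 => h3 (by
    rw [← norm_star (_ : ℂ), ← norm_mul] at *
    simpa using congrArg norm h4)
  set Z : Finset ℂ := ((((complexRoots ψ).toFinset.erase δ).erase (star δ)).erase (l : ℂ)).erase
    (l : ℂ)⁻¹ with hZ
  have hZc : Z.card = 18 := by
    have e1 : δ ≠ l := by
      rintro h1
      rw [h1, hln] at hδn
      exact hl.ne' hδn
    have e2 : δ ≠ (l : ℂ)⁻¹ := by
      rintro h1
      rw [h1, hln'] at hδn
      exact hlinv.ne hδn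
    have e3 : star δ ≠ l := fun h1 => e1 (by rw [← star_star δ, h1, hstar])
    have e4 : star δ ≠ (l : ℂ)⁻¹ := fun h1 => e2 (by rw [← star_star δ, h1, hstar'])
    have e5 : (l : ℂ)⁻¹ ≠ l := by
      intro h1
      have := congrArg norm h1
      rw [hln, hln'] at this
      linarith
    rw [hZ, Finset.card_erase_of_mem, Finset.card_erase_of_mem, Finset.card_erase_of_mem,
      Finset.card_erase_of_mem, Multiset.toFinset_card_of_nodup hnd, hS.card_complexRoots]
    all_goals
      simp only [Finset.mem_erase, Multiset.mem_toFinset, hS.mem_complexRoots]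
    · exact hδ
    · exact ⟨hδne, hδ'⟩
    · exact ⟨e3.symm, e1.symm, hroot⟩
    · exact ⟨e5, e4.symm, e2.symm, hroot'⟩
  have hZm : ∀ μ ∈ Z, aeval μ ψ = 0 ∧ ‖μ‖ = 1 ∧ μ ≠ δ ∧ μ ≠ star δ := by
    intro μ hμ
    simp only [hZ, Finset.mem_erase, Multiset.mem_toFinset, hS.mem_complexRoots] at hμ
    obtain ⟨h1, h2, h3, h4, h5⟩ := hμ
    refine ⟨h5, ?_, h4, h3⟩
    rcases hall μ h5 with h6 | h6 | h6
    · exact h6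
    · exact absurd h6 h2
    · exact absurd h6 h1
  have hsq : ∀ t : ℝ, -2 < t → t < 2 → 0 < 4 - t ^ 2 := fun t _ _ => by nlinarith
  have hxy0 : hermForm M (v l) (v (l : ℂ)⁻¹) ≠ 0 := by
    have h1 := hS.herm hroot
    have h2 := (hS.root_iff (hS.root_ne_zero hroot)).mp hroot
    rw [hstar] at h1
    rw [h1]
    have h0 := hS.root_ne_zero hroot
    refine mul_ne_zero (by exact_mod_cast hε) (mul_ne_zero (mul_ne_zero ?_ (hS.left_ne_zero h2))
      (hτ.simple _ h2))
    intro h3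
    have h4 : ((l : ℂ) ^ 2 - 1) ^ 2 = 0 := by
      field_simp at h3
      linear_combination -h3
    exact hS.root_sq_ne_one hroot (sub_eq_zero.mp (pow_eq_zero_iff two_ne_zero |>.mp h4))
  have sx : star (v l) = v l := by rw [hS.star_vec, hstar]
  have sy : star (v (l : ℂ)⁻¹) = v (l : ℂ)⁻¹ := by rw [hS.star_vec, hstar']
  have hreal : star (hermForm M (v l) (v (l : ℂ)⁻¹)) = hermForm M (v l) (v (l : ℂ)⁻¹) := by
    conv_rhs => rw [← sx, hermForm_star_left, sy]
  obtain ⟨g, hg⟩ : ∃ g : ℝ, hermForm M (v l) (v (l : ℂ)⁻¹) = g :=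
    ⟨_, (Complex.conj_eq_iff_re.mp hreal).symm⟩
  have hnδ' : ‖star δ‖ = 1 := by rw [norm_star, hδn]
  refine ⟨Z, δ, l, g, ?_⟩
  constructor
  · exact hS.symm
  · exact hS.isometry
  · intro a b hab
    by_contra hne
    have h1 : (toC F).mulVec (a - b) = (0 : ℂ) • (a - b) := by
      rw [Matrix.mulVec_sub, zero_smul, sub_eq_zero]
      exact hab
    exact hS.root_ne_zero (hS.root_of_eigenvector (sub_ne_zero.mpr hne) h1) rfl
  · rw [Fintype.card_coe, hZc]
  · exact hδn
  · exact hl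
  · rintro rfl
    exact hxy0 (by rw [hg, Complex.ofReal_zero])
  · exact hS.eigen hδ
  · exact hS.eigen hroot
  · exact hS.eigen hroot'
  · exact fun i => ⟨_, hS.eigen (hZm i i.2).1⟩
  · obtain ⟨t, h1, h2, h3, -, h5⟩ := hS.herm_of_norm_one hδ hδn
    have htτ : t = τ := by
      rw [hδτ] at h3
      exact_mod_cast h3.symm
    rw [h5, htτ]
    exact mul_pos (hsq τ hτ.mem.1 hτ.mem.2) hτ.pos
  · rw [hS.star_vec]
    exact horth hδ hδ' (by rw [star_star, ← sq]; exact hS.root_sq_ne_one hδ)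
  · exact hS.isotropic hroot (by rw [hln]; exact hl.ne')
  · exact hS.isotropic hroot' (by rw [hln']; exact hlinv.ne)
  · exact hg
  · exact horthn hroot hδ (by rw [hln, hδn, mul_one]; exact hl.ne')
  · rw [hS.star_vec]
    exact horthn hroot hδ' (by rw [hln, hnδ', mul_one]; exact hl.ne')
  · exact horthn hroot' hδ (by rw [hln', hδn, mul_one]; exact hlinv.ne)
  · rw [hS.star_vec]
    exact horthn hroot' hδ' (by rw [hln', hnδ', mul_one]; exact hlinv.ne)
  · intro i
    obtain ⟨h1, h2, h3, h4⟩ := hZm i i.2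
    exact horth h1 hδ fun h5 => h3 (by rw [hδi] at h5; exact eq_of_mul_inv_eq_one h5)
  · intro i
    obtain ⟨h1, h2, h3, h4⟩ := hZm i i.2
    rw [hS.star_vec]
    exact horth h1 hδ' fun h5 => h4 (by
      rw [star_star] at h5
      rw [hδi, eq_inv_of_mul_eq_one_left h5])
  · intro i
    obtain ⟨h1, h2, h3, h4⟩ := hZm i i.2
    exact horthn h1 hroot (by rw [hln, h2, one_mul]; exact hl.ne')
  · intro i
    obtain ⟨h1, h2, h3, h4⟩ := hZm i i.2
    exact horthn h1 hroot' (by rw [hln', h2, one_mul]; exact hlinv.ne)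
  · intro i j hij
    obtain ⟨h1, h2, h3, h4⟩ := hZm i i.2
    obtain ⟨h5, h6, h7, h8⟩ := hZm j j.2
    refine horth h1 h5 fun h9 => hij (Subtype.ext ?_)
    rw [star_eq_inv_of_norm_one h6] at h9
    exact eq_of_mul_inv_eq_one h9
  · intro i
    obtain ⟨h1, h2, h3, h4⟩ := hZm i i.2
    obtain ⟨t, ht1, ht2, ht3, ht4, ht5⟩ := hS.herm_of_norm_one h1 h2
    rw [ht5]
    refine mul_neg_of_pos_of_neg (hsq t ht1 ht2) (hτ.neg t ht1 ht2 ht4 ?_)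
    rintro rfl
    rcases eq_or_eq_inv_of_trace_eq (hS.root_ne_zero h1) hδ0 (ht3.trans hδτ.symm) with h5 | h5
    · exact h3 h5
    · exact h4 (by rw [hδi, h5])

end Construction

/-- Once the form `ε M` has signature `(3, 19)`, it is the one selected by renormalization. -/
theorem intersectionForm_of_hasSignature {φ ψ : ℤ[X]} {r : Fin 22 → ℚ} {ε : ℚ} (hε : ε = 1 ∨ ε = -1)
    (h : HasSignature (ε • invariantForm 22 φ ψ r) ⊤ 3 19) :
    intersectionForm φ ψ r = ε • invariantForm 22 φ ψ r := by
  rw [intersectionForm, renormalized]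
  rcases hε with rfl | rfl
  · rw [one_smul] at h ⊢
    rw [if_neg]
    rintro ⟨p, q, h1, h2⟩
    obtain ⟨rfl, rfl⟩ := h.unique h1
    omega
  · rw [neg_one_smul] at h ⊢
    rw [if_pos]
    have h1 := h.neg
    rw [neg_neg] at h1
    exact ⟨19, 3, h1, by norm_num⟩

section Equivalence

variable {φ ψ : ℤ[X]} {r : Fin 22 → ℚ} (hp : IsHypergeometricPair 11 φ ψ)
  (hr : IsReflectionVector 22 φ ψ r)

include hp hr

/-- Only the signature has to be supplied; the remaining properties hold for every unimodular
hypergeometric lattice of rank `22`. -/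
theorem isK3Lattice (hL : IsUnimodular (lattice 22 φ r) (invariantForm 22 φ ψ r)) {ε : ℚ}
    (hε : ε = 1 ∨ ε = -1) (h : HasSignature (ε • invariantForm 22 φ ψ r) ⊤ 3 19) :
    IsK3Lattice (lattice 22 φ r) (ε • invariantForm 22 φ ψ r) where
  fg := lattice_fg (m := 21)
  full := hr.span_lattice (m := 21) hp (by norm_num)
  rank := hr.finrank_lattice (m := 21) hp (by norm_num)
  symm := (isEigenSystem hp hr).symm
  even := by
    intro v hv
    obtain ⟨z, hz⟩ := hr.form_even (m := 21) hp (by norm_num) hL hv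
    rw [Matrix.smul_mulVec, dotProduct_smul, hz]
    rcases hε with rfl | rfl
    · exact ⟨z, by simp⟩
    · exact ⟨-z, by simp⟩
  unimodular := by
    rcases hε with rfl | rfl
    · rwa [one_smul]
    · rw [neg_one_smul, IsUnimodular]
      conv_rhs => rw [← hL]
      ext x
      rw [LinearMap.BilinForm.mem_dualSubmodule, LinearMap.BilinForm.mem_dualSubmodule]
      refine forall₂_congr fun y _ => ?_
      rw [map_neg, LinearMap.neg_apply, LinearMap.neg_apply]
      exact neg_mem_iff
  signature := h

/-- The spectral condition is equivalent to the geometric property. -/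
theorem isPositiveHodgeIsometryB_iff
    (hL : IsUnimodular (lattice 22 φ r) (invariantForm 22 φ ψ r)) :
    IsPositiveHodgeIsometryB φ ψ r ↔ ∃ ε τ : ℝ, (ε = 1 ∨ ε = -1) ∧
      SpectralCondition (antiTracePolynomial 11 φ) (tracePolynomial 11 ψ) ε τ := by
  constructor
  · rintro ⟨-, h, hh⟩
    obtain ⟨ε, hε, hM⟩ := intersectionForm_eq φ ψ r
    have hS := isEigenSystem hp hr (ε := ε)
    rw [← hM] at hS
    obtain ⟨τ, hτ⟩ := hh.exists_spectralCondition hS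
    refine ⟨ε, τ, ?_, hτ⟩
    rcases hε with rfl | rfl <;> simp
  · rintro ⟨ε, τ, hε, hτ⟩
    obtain ⟨q, rfl, hq⟩ : ∃ q : ℚ, (q : ℝ) = ε ∧ (q = 1 ∨ q = -1) := by
      rcases hε with rfl | rfl
      · exact ⟨1, by simp⟩
      · exact ⟨-1, by simp⟩
    have hS := isEigenSystem hp hr (ε := q)
    obtain ⟨Z, δ, l, g, hf⟩ := hτ.exists_hodgeFrame hS (by rcases hε with h | h <;> simp [h])
    have hM := intersectionForm_of_hasSignature hq hf.hasSignature
    rw [IsPositiveHodgeIsometryB, hM]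
    exact ⟨isK3Lattice hp hr hL hq hf.hasSignature, hf.hodgeStructure,
      hf.isPositiveHodgeIsometry (hr.map_right_lattice (m := 21) hp (by norm_num) hL)⟩

/-- The consequences of the spectral condition for arbitrary Hodge structures preserved by `B`. -/
theorem SpectralCondition.geometric {ε τ : ℝ} (hε : ε = 1 ∨ ε = -1)
    (hτ : SpectralCondition (antiTracePolynomial 11 φ) (tracePolynomial 11 ψ) ε τ) :
    (∀ h : HodgeStructure (intersectionForm φ ψ r),
        IsHodgeIsometry (lattice 22 φ r) h (companion 22 ψ) →
          ∀ τ' : ℝ, IsSpecialTrace h (companion 22 ψ) τ' ↔ τ' = τ) ∧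
      (∀ h h' : HodgeStructure (intersectionForm φ ψ r),
        IsHodgeIsometry (lattice 22 φ r) h (companion 22 ψ) →
        IsHodgeIsometry (lattice 22 φ r) h' (companion 22 ψ) → h.EqUpToConj h') ∧
      IsHyperbolic (companion 22 ψ) := by
  obtain ⟨q, rfl, hq⟩ : ∃ q : ℚ, (q : ℝ) = ε ∧ (q = 1 ∨ q = -1) := by
    rcases hε with rfl | rfl
    · exact ⟨1, by simp⟩
    · exact ⟨-1, by simp⟩
  have hS := isEigenSystem hp hr (ε := q)
  obtain ⟨Z, δ, l, g, hf⟩ := hτ.exists_hodgeFrame hS (by rcases hε with h | h <;> simp [h])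
  have hM := intersectionForm_of_hasSignature hq hf.hasSignature
  rw [hM]
  exact ⟨fun h hF τ' => hS.isSpecialTrace_iff hτ hF τ', fun h h' hF hF' => hS.eqUpToConj hτ hF hF',
    hτ.isHyperbolic hS⟩

end Equivalence

/-! ### Signs and parities at the trace roots -/

open Classical in
/-- The number of elements of a multiset above `t`. -/
noncomputable def above (S : Multiset ℝ) (t : ℝ) : ℕ := (S.filter fun x => t < x).card

theorem above_add (S T : Multiset ℝ) (t : ℝ) : above (S + T) t = above S t + above T t := by
  rw [above, Multiset.filter_add, Multiset.card_add]
  rfl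

/-- A monic real polynomial without real roots is positive. -/
theorem eval_pos_of_roots_eq_zero {Q : ℝ[X]} (hQ : Q.Monic) (h : Q.roots = 0) (x : ℝ) :
    0 < Q.eval x := by
  have hne : ∀ y, Q.eval y ≠ 0 := fun y hy => by
    have : y ∈ Q.roots := (mem_roots hQ.ne_zero).mpr hy
    rw [h] at this
    exact absurd this (Multiset.notMem_zero y)
  rcases eq_or_ne Q.natDegree 0 with h0 | h0
  · rw [hQ.natDegree_eq_zero.mp h0]
    simp
  · by_contra! hle
    have hdeg : 0 < Q.degree := natDegree_pos_iff_degree_pos.mp (Nat.pos_of_ne_zero h0)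
    have ht := Q.tendsto_atTop_of_leadingCoeff_nonneg hdeg (by rw [hQ]; exact zero_le_one)
    obtain ⟨y, hy1, hy2⟩ := ((ht.eventually_ge_atTop 0).and
      (Filter.eventually_ge_atTop x)).exists
    obtain ⟨z, -, hz⟩ := intermediate_value_Icc hy2 Q.continuous.continuousOn ⟨hle, hy1⟩
    exact hne z hz

/-- The sign of a monic real polynomial at `x` is the parity of the number of roots above `x`. -/
theorem sign_eval {P : ℝ[X]} (hP : P.Monic) {x : ℝ} (hx : P.eval x ≠ 0) :
    0 < (-1) ^ above P.roots x * P.eval x := by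
  obtain ⟨Q, hQ, -, hQr⟩ := exists_prod_multiset_X_sub_C_mul P
  have hQm : Q.Monic := by
    have h1 : (P.roots.map fun a => X - C a).prod.Monic :=
      monic_multiset_prod_of_monic _ _ fun a _ => monic_X_sub_C a
    rw [← hQ] at hP
    exact h1.of_mul_monic_left hP
  have hQx := eval_pos_of_roots_eq_zero hQm hQr x
  have key : ∀ S : Multiset ℝ, (∀ a ∈ S, a ≠ x) →
      0 < (-1) ^ above S x * ((S.map fun a => X - C a).prod.eval x) := by
    intro S
    induction S using Multiset.induction with
    | empty => intro _; simp [above]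
    | cons a S ih =>
      intro h
      have ih' := ih fun b hb => h b (Multiset.mem_cons_of_mem hb)
      rw [Multiset.map_cons, Multiset.prod_cons, eval_mul, eval_sub, eval_X, eval_C]
      rcases lt_or_gt_of_ne (h a (Multiset.mem_cons_self a S)) with hlt | hgt
      · have e : above (a ::ₘ S) x = above S x := by
          rw [above, Multiset.filter_cons_of_neg _ (not_lt.mpr hlt.le)]
          rfl
        rw [e]
        have : 0 < x - a := by linarith
        nlinarith [mul_pos this ih']
      · have e : above (a ::ₘ S) x = above S x + 1 := by
          rw [above, Multiset.filter_cons_of_pos _ hgt, Multiset.card_cons]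
          rfl
        rw [e, pow_succ]
        have : 0 < a - x := by linarith
        nlinarith [mul_pos this ih']
  have h1 := key P.roots fun a ha hax => hx (hax ▸ (mem_roots hP.ne_zero).mp ha)
  have h2 : P.eval x = ((P.roots.map fun a => X - C a).prod.eval x) * Q.eval x := by
    rw [← eval_mul, hQ]
  rw [h2, ← mul_assoc]
  exact mul_pos h1 hQx

section IntegerPolynomials

theorem eval_map_real (P : ℤ[X]) (t : ℝ) : (P.map (Int.castRingHom ℝ)).eval t = aeval t P := by
  rw [eval_map, ← algebraMap_int_eq, ← aeval_def]

theorem mem_realRoots {P : ℤ[X]} (hP : P.Monic) {t : ℝ} :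
    t ∈ (P.map (Int.castRingHom ℝ)).roots ↔ aeval t P = 0 := by
  rw [mem_roots (hP.map _).ne_zero, IsRoot, eval_map_real]

theorem mem_rootsOn {P : ℤ[X]} (hP : P.Monic) {t : ℝ} :
    t ∈ rootsOn P ↔ aeval t P = 0 ∧ -2 ≤ t ∧ t ≤ 2 := by
  rw [rootsOn, Multiset.mem_filter, mem_realRoots hP]

theorem mem_rootsGtTwo {P : ℤ[X]} (hP : P.Monic) {t : ℝ} :
    t ∈ rootsGtTwo P ↔ aeval t P = 0 ∧ 2 < t := by
  rw [rootsGtTwo, Multiset.mem_filter, mem_realRoots hP]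

theorem aeval_ofReal_eq_zero {P : ℤ[X]} {t : ℝ} : aeval (t : ℂ) P = 0 ↔ aeval t P = 0 := by
  rw [aeval_ofReal, Complex.ofReal_eq_zero]

theorem nodup_realRoots {P : ℤ[X]} (hP : P.Monic)
    (h : ∀ t : ℝ, aeval t P = 0 → aeval t (derivative P) ≠ 0) :
    ((P.map (Int.castRingHom ℝ)).roots).Nodup := by
  rw [Multiset.nodup_iff_count_le_one]
  intro t
  rw [count_roots, ← not_lt, one_lt_rootMultiplicity_iff_isRoot (hP.map _).ne_zero, derivative_map,
    IsRoot, IsRoot, eval_map_real, eval_map_real]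
  exact fun h1 => h t h1.1 h1.2

theorem above_roots {P : ℤ[X]} {t : ℝ} (h1 : -2 ≤ t) (h2 : t ≤ 2) :
    above (P.map (Int.castRingHom ℝ)).roots t =
      above (rootsOn P) t + (rootsGtTwo P).card := by
  classical
  rw [above, above, rootsOn, rootsGtTwo, ← Multiset.card_add, Multiset.filter_filter]
  congr 1
  rw [← Multiset.filter_add_not (fun x => x ≤ 2) (Multiset.filter (fun x => t < x) _),
    Multiset.filter_filter, Multiset.filter_filter]
  congr 1
  · refine Multiset.filter_congr fun x _ => ?_
    constructor
    · rintro ⟨h3, h4⟩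
      exact ⟨h4, by linarith, h3⟩
    · rintro ⟨h3, -, h4⟩
      exact ⟨h4, h3⟩
  · refine Multiset.filter_congr fun x _ => ?_
    rw [not_le]
    exact ⟨fun h => h.1, fun h => ⟨h, by linarith⟩⟩

/-- The sign of `Φ Ψ'` at a simple root of `Ψ` on `[-2, 2]`. -/
theorem sign_mul_derivative {Φ Ψ : ℤ[X]} (hΦ : Φ.Monic) (hΨ : Ψ.Monic) {t : ℝ}
    (ht : t ∈ rootsOn Ψ) (h1 : aeval t (derivative Ψ) ≠ 0) (h2 : aeval t Φ ≠ 0) :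
    0 < (-1) ^ ((rootsGtTwo Φ).card + (rootsGtTwo Ψ).card + above (rootsOn Φ + rootsOn Ψ) t) *
      (aeval t Φ * aeval t (derivative Ψ)) := by
  obtain ⟨h3, h4, h5⟩ := (mem_rootsOn hΨ).mp ht
  have hroot : (Ψ.map (Int.castRingHom ℝ)).IsRoot t := by rw [IsRoot, eval_map_real, h3]
  have hmul := mul_divByMonic_eq_iff_isRoot.mpr hroot
  set Q := Ψ.map (Int.castRingHom ℝ) /ₘ (X - C t) with hQ
  have hQm : Q.Monic := by
    have h := hΨ.map (Int.castRingHom ℝ)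
    rw [← hmul] at h
    exact (monic_X_sub_C t).of_mul_monic_left h
  have hQt : Q.eval t = aeval t (derivative Ψ) := by
    have h := congrArg (fun p => eval t (derivative p)) hmul
    simp only [derivative_mul, derivative_map, derivative_sub, derivative_X, derivative_C, sub_zero,
      one_mul, eval_add, eval_mul, eval_sub, eval_X, eval_C, sub_self, zero_mul, add_zero] at h
    rw [h, eval_map_real]
  have hab : above Q.roots t = above (Ψ.map (Int.castRingHom ℝ)).roots t := by
    rw [← hmul, roots_mul (by rw [hmul]; exact (hΨ.map _).ne_zero), roots_X_sub_C, above_add]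
    simp [above]
  have s1 := sign_eval hQm (x := t) (by rw [hQt]; exact h1)
  have s2 := sign_eval (hΦ.map (Int.castRingHom ℝ)) (x := t) (by rw [eval_map_real]; exact h2)
  rw [hab, above_roots h4 h5, hQt] at s1
  rw [above_roots h4 h5, eval_map_real] at s2
  have := mul_pos s1 s2
  rw [above_add]
  refine this.trans_eq ?_
  rw [pow_add, pow_add, pow_add, pow_add, pow_add]
  ring

/-- The combinatorial form of the sign condition: the parity of the number of trace roots above
`t`, for `t` in `S`, singles out one element `τ`. -/
def ParityCondition (R S : Multiset ℝ) (τ : ℝ) : Prop :=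
  τ ∈ S ∧ ∀ t ∈ S, t ≠ τ → Odd (above (R + S) t + above (R + S) τ)

/-- With at least three elements the exceptional one is unique. -/
theorem ParityCondition.unique {R S : Multiset ℝ} {τ τ' : ℝ} (h : ParityCondition R S τ)
    (h' : ParityCondition R S τ') (hS : S.Nodup) (hc : 3 ≤ S.card) : τ = τ' := by
  classical
  by_contra hne
  obtain ⟨t, ht, ht1, ht2⟩ : ∃ t ∈ S, t ≠ τ ∧ t ≠ τ' := by
    by_contra! hall
    have h1 : S ⊆ ({τ, τ'} : Multiset ℝ) := by
      intro t ht
      by_cases h1 : t = τ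
      · simp [h1]
      · simp [hall t ht h1]
    have h2 := Multiset.card_le_card ((Multiset.le_iff_subset hS).mpr h1)
    simp at h2
    omega
  have h1 := h.2 t ht ht1
  have h2 := h'.2 t ht ht2
  have h3 := h.2 τ' h'.1 (Ne.symm hne)
  rw [Nat.odd_iff] at h1 h2 h3
  omega

variable {Φ Ψ : ℤ[X]} {τ : ℝ}

theorem nodup_rootsOn (hΨ : Ψ.Monic) (h : (complexRoots Ψ).Nodup) : (rootsOn Ψ).Nodup := by
  classical
  rw [nodup_complexRoots_iff hΨ] at h
  refine (nodup_realRoots hΨ fun t ht h1 => ?_).filter _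
  exact h t (aeval_ofReal_eq_zero.mpr ht) (aeval_ofReal_eq_zero.mpr h1)

theorem nodup_rootsGtTwo (hΨ : Ψ.Monic) (h : (complexRoots Ψ).Nodup) :
    (rootsGtTwo Ψ).Nodup := by
  classical
  rw [nodup_complexRoots_iff hΨ] at h
  refine (nodup_realRoots hΨ fun t ht h1 => ?_).filter _
  exact h t (aeval_ofReal_eq_zero.mpr ht) (aeval_ofReal_eq_zero.mpr h1)

/-- A polynomial all of whose complex roots are real has as many real roots as its degree. -/
theorem card_realRoots_of_real (hΨ : Ψ.Monic)
    (h : ∀ z : ℂ, aeval z Ψ = 0 → ∃ t : ℝ, z = t) :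
    ((Ψ.map (Int.castRingHom ℝ)).roots).card = Ψ.natDegree := by
  obtain ⟨Q, hQ, hc, hQr⟩ := exists_prod_multiset_X_sub_C_mul (Ψ.map (Int.castRingHom ℝ))
  rw [hΨ.natDegree_map] at hc
  suffices Q.natDegree = 0 by omega
  by_contra h0
  have hQ0 : Q ≠ 0 := by
    rintro rfl
    simp at h0
  have hd : (Q.map (algebraMap ℝ ℂ)).degree ≠ 0 := by
    rw [degree_map]
    intro h1
    exact h0 (natDegree_eq_of_degree_eq_some h1)
  obtain ⟨z, hz⟩ := IsAlgClosed.exists_root _ hd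
  have hz' : aeval z Ψ = 0 := by
    have h1 : (Ψ.map (Int.castRingHom ℂ)).eval z = 0 := by
      have e : Ψ.map (Int.castRingHom ℂ) =
          (Ψ.map (Int.castRingHom ℝ)).map (algebraMap ℝ ℂ) := by
        rw [Polynomial.map_map]
        congr 1
      rw [e, ← hQ, Polynomial.map_mul, eval_mul, hz, mul_zero]
    rwa [eval_map, ← algebraMap_int_eq, ← aeval_def] at h1
  obtain ⟨t, rfl⟩ := h z hz'
  have h2 : t ∈ Q.roots := by
    rw [mem_roots hQ0, IsRoot]
    rw [IsRoot, eval_map, show (t : ℂ) = algebraMap ℝ ℂ t from rfl, eval₂_at_apply] at hz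
    exact Complex.ofReal_eq_zero.mp hz
  rw [hQr] at h2
  exact Multiset.notMem_zero t h2

/-- The spectral condition in terms of the multisets of trace roots. -/
theorem SpectralCondition.combinatorial (hΦ : Φ.Monic) (hΨ : Ψ.Monic) (hd : Ψ.natDegree = 11)
    (hco : ∀ t : ℝ, aeval t Ψ = 0 → aeval t Φ ≠ 0) {ε : ℝ} (h : SpectralCondition Φ Ψ ε τ) :
    (complexRoots Ψ).Nodup ∧ aeval (2 : ℝ) Ψ ≠ 0 ∧ aeval (-2 : ℝ) Ψ ≠ 0 ∧
      (rootsGtTwo Ψ).card = 1 ∧ (rootsOn Ψ).card = 10 ∧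
      ParityCondition (rootsOn Φ) (rootsOn Ψ) τ := by
  classical
  obtain ⟨t₀, ht₀, hroot, hall⟩ := h.exists_gt
  rw [aeval_ofReal_eq_zero] at hroot
  have hreal : ∀ t : ℝ, aeval t Ψ = 0 → t = t₀ ∨ (-2 < t ∧ t < 2) := by
    intro t ht
    rcases hall t (aeval_ofReal_eq_zero.mpr ht) with h1 | ⟨s, h1, h2, h3⟩
    · exact Or.inl (Complex.ofReal_injective h1)
    · rw [Complex.ofReal_injective h3]
      exact Or.inr ⟨h1, h2⟩
  have hnd := (nodup_complexRoots_iff hΨ).mpr h.simple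
  have hcard := card_realRoots_of_real hΨ (fun z hz => by
    rcases hall z hz with h1 | ⟨s, -, -, h3⟩
    · exact ⟨t₀, h1⟩
    · exact ⟨s, h3⟩)
  have hgt : rootsGtTwo Ψ = {t₀} := by
    rw [(nodup_rootsGtTwo hΨ hnd).ext (Multiset.nodup_singleton t₀)]
    intro t
    rw [mem_rootsGtTwo hΨ, Multiset.mem_singleton]
    constructor
    · rintro ⟨h1, h2⟩
      rcases hreal t h1 with h3 | h3
      · exact h3
      · linarith [h3.2]
    · rintro rfl
      exact ⟨hroot, ht₀⟩
  have hsum : (Ψ.map (Int.castRingHom ℝ)).roots = rootsOn Ψ + rootsGtTwo Ψ := by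
    rw [rootsOn, rootsGtTwo]
    conv_lhs => rw [← Multiset.filter_add_not (fun x => -2 ≤ x ∧ x ≤ 2)
      (Ψ.map (Int.castRingHom ℝ)).roots]
    congr 1
    refine Multiset.filter_congr fun t ht => ?_
    rw [mem_realRoots hΨ] at ht
    rcases hreal t ht with h3 | h3
    · rw [h3]
      exact ⟨fun _ => ht₀, fun _ h4 => by linarith [h4.2]⟩
    · exact ⟨fun h4 => absurd ⟨h3.1.le, h3.2.le⟩ h4, fun h4 => by linarith [h3.2]⟩
  have hmem : τ ∈ rootsOn Ψ := (mem_rootsOn hΨ).mpr ⟨h.root, h.mem.1.le, h.mem.2.le⟩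
  refine ⟨hnd, fun h1 => ?_, fun h1 => ?_, by rw [hgt]; rfl, ?_, hmem, fun t ht hne => ?_⟩
  · rcases hreal 2 h1 with h2 | h2 <;> linarith
  · rcases hreal (-2) h1 with h2 | h2 <;> linarith
  · rw [hsum, Multiset.card_add, hgt, Multiset.card_singleton, hd] at hcard
    omega
  · obtain ⟨h1, h2, h3⟩ := (mem_rootsOn hΨ).mp ht
    have hs : ∀ t : ℝ, aeval t Ψ = 0 → aeval t (derivative Ψ) ≠ 0 := fun t ht h4 =>
      h.simple t (aeval_ofReal_eq_zero.mpr ht) (aeval_ofReal_eq_zero.mpr h4)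
    have h4 := sign_mul_derivative hΦ hΨ ht (hs t h1) (hco t h1)
    have h5 := sign_mul_derivative hΦ hΨ hmem (hs τ h.root) (hco τ h.root)
    have h6 := h.pos
    have h8 : -2 < t ∧ t < 2 := by
      rcases hreal t h1 with h3 | h3
      · linarith
      · exact h3
    have h7 := h.neg t h8.1 h8.2 h1 hne
    by_contra hev
    rw [Nat.not_odd_iff_even] at hev
    have e : (-1 : ℝ) ^ above (rootsOn Φ + rootsOn Ψ) t =
        (-1) ^ above (rootsOn Φ + rootsOn Ψ) τ := by
      have h9 := hev.neg_one_pow (α := ℝ)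
      rw [pow_add] at h9
      rcases neg_one_pow_eq_or ℝ (above (rootsOn Φ + rootsOn Ψ) t) with h10 | h10 <;>
        rcases neg_one_pow_eq_or ℝ (above (rootsOn Φ + rootsOn Ψ) τ) with h11 | h11 <;>
        rw [h10, h11] at h9 ⊢ <;> norm_num at h9
    rw [pow_add, e, ← pow_add] at h4
    set s : ℝ := (-1) ^ ((rootsGtTwo Φ).card + (rootsGtTwo Ψ).card +
      above (rootsOn Φ + rootsOn Ψ) τ) with hs
    have h9 := mul_pos h4 h5
    have h10 := mul_neg_of_neg_of_pos h7 h6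
    have h11 : 0 ≤ ((aeval t Φ * aeval t (derivative Ψ)) * (aeval τ Φ * aeval τ (derivative Ψ)))
        * s ^ 2 := by nlinarith
    have h12 : ((aeval t Φ * aeval t (derivative Ψ)) * (aeval τ Φ * aeval τ (derivative Ψ)))
        * ε ^ 2 < 0 := by nlinarith
    have h13 : 0 < s ^ 2 := by
      have h0 : s ≠ 0 := by
        rw [hs]
        exact pow_ne_zero _ (by norm_num)
      positivity
    have h14 : 0 ≤ ((aeval t Φ * aeval t (derivative Ψ)) *
        (aeval τ Φ * aeval τ (derivative Ψ))) := nonneg_of_mul_nonneg_left h11 h13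
    nlinarith [sq_nonneg ε]

/-- Conversely the parity condition gives the spectral condition, where the sign `ε` is the sign of
`Φ Ψ'` at `τ`. -/
theorem spectralCondition_of_parity (hΦ : Φ.Monic) (hΨ : Ψ.Monic) (hd : Ψ.natDegree = 11)
    (hco : ∀ t : ℝ, aeval t Ψ = 0 → aeval t Φ ≠ 0) (hnd : (complexRoots Ψ).Nodup)
    (h2 : aeval (2 : ℝ) Ψ ≠ 0) (h2' : aeval (-2 : ℝ) Ψ ≠ 0) (hgt : (rootsGtTwo Ψ).card = 1)
    (hon : (rootsOn Ψ).card = 10) (hpar : ParityCondition (rootsOn Φ) (rootsOn Ψ) τ) :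
    ∃ ε : ℝ, (ε = 1 ∨ ε = -1) ∧ SpectralCondition Φ Ψ ε τ := by
  classical
  obtain ⟨t₀, ht₀⟩ := Multiset.card_eq_one.mp hgt
  have ht₀m : aeval t₀ Ψ = 0 ∧ 2 < t₀ := by
    rw [← mem_rootsGtTwo hΨ, ht₀]
    exact Multiset.mem_singleton_self t₀
  have hsimple := (nodup_complexRoots_iff hΨ).mp hnd
  have hsr : ∀ t : ℝ, aeval t Ψ = 0 → aeval t (derivative Ψ) ≠ 0 := fun t ht h4 =>
    hsimple t (aeval_ofReal_eq_zero.mpr ht) (aeval_ofReal_eq_zero.mpr h4)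
  have hIoo : ∀ t ∈ rootsOn Ψ, -2 < t ∧ t < 2 := by
    intro t ht
    obtain ⟨h3, h4, h5⟩ := (mem_rootsOn hΨ).mp ht
    refine ⟨lt_of_le_of_ne h4 ?_, lt_of_le_of_ne h5 ?_⟩
    · rintro rfl
      exact h2' h3
    · rintro rfl
      exact h2 h3
  have hall : ∀ z : ℂ, aeval z Ψ = 0 → z = t₀ ∨ ∃ t : ℝ, -2 < t ∧ t < 2 ∧ z = t := by
    -- the eleven known real roots exhaust the roots, by the degree
    set T : Finset ℂ := ((rootsOn Ψ).toFinset ∪ {t₀}).image (fun t : ℝ => (t : ℂ)) with hT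
    have hTc : T.card = 11 := by
      rw [hT, Finset.card_image_of_injective _ Complex.ofReal_injective,
        Finset.card_union_of_disjoint, Finset.card_singleton,
        Multiset.toFinset_card_of_nodup (nodup_rootsOn hΨ hnd), hon]
      rw [Finset.disjoint_singleton_right, Multiset.mem_toFinset]
      intro h3
      have := hIoo t₀ h3
      linarith [ht₀m.2]
    have hmemc : ∀ z, z ∈ (complexRoots Ψ).toFinset ↔ aeval z Ψ = 0 := by
      intro z
      rw [Multiset.mem_toFinset, complexRoots, mem_roots (hΨ.map _).ne_zero, IsRoot, eval_map,
        ← algebraMap_int_eq, ← aeval_def]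
    have hsub : T ⊆ (complexRoots Ψ).toFinset := by
      intro z hz
      rw [hT, Finset.mem_image] at hz
      obtain ⟨t, ht, rfl⟩ := hz
      rw [hmemc, aeval_ofReal_eq_zero]
      rw [Finset.mem_union, Multiset.mem_toFinset, Finset.mem_singleton] at ht
      rcases ht with ht | rfl
      · exact ((mem_rootsOn hΨ).mp ht).1
      · exact ht₀m.1
    have heq := Finset.eq_of_subset_of_card_le hsub (by
      rw [hTc, Multiset.toFinset_card_of_nodup hnd, complexRoots,
        IsAlgClosed.card_roots_eq_natDegree, hΨ.natDegree_map, hd])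
    intro z hz
    rw [← hmemc, ← heq, hT, Finset.mem_image] at hz
    obtain ⟨t, ht, rfl⟩ := hz
    rw [Finset.mem_union, Multiset.mem_toFinset, Finset.mem_singleton] at ht
    rcases ht with ht | rfl
    · exact Or.inr ⟨t, (hIoo t ht).1, (hIoo t ht).2, rfl⟩
    · exact Or.inl rfl
  have hτ := (mem_rootsOn hΨ).mp hpar.1
  set c := (rootsGtTwo Φ).card + (rootsGtTwo Ψ).card with hc
  refine ⟨(-1) ^ (c + above (rootsOn Φ + rootsOn Ψ) τ), neg_one_pow_eq_or ℝ _,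
    ⟨t₀, ht₀m.2, aeval_ofReal_eq_zero.mpr ht₀m.1, hall⟩, hsimple, hIoo τ hpar.1, hτ.1,
    sign_mul_derivative hΦ hΨ hpar.1 (hsr τ hτ.1) (hco τ hτ.1), fun t h3 h4 h5 hne => ?_⟩
  have ht : t ∈ rootsOn Ψ := (mem_rootsOn hΨ).mpr ⟨h5, h3.le, h4.le⟩
  have h6 := sign_mul_derivative hΦ hΨ ht (hsr t h5) (hco t h5)
  have h7 := hpar.2 t ht hne
  have h8 : (-1 : ℝ) ^ (c + above (rootsOn Φ + rootsOn Ψ) τ) =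
      -(-1) ^ (c + above (rootsOn Φ + rootsOn Ψ) t) := by
    have h9 := h7.neg_one_pow (α := ℝ)
    rw [pow_add] at h9
    rw [pow_add _ c, pow_add _ c]
    rcases neg_one_pow_eq_or ℝ (above (rootsOn Φ + rootsOn Ψ) t) with h10 | h10 <;>
      rcases neg_one_pow_eq_or ℝ (above (rootsOn Φ + rootsOn Ψ) τ) with h11 | h11 <;>
      rw [h10, h11] at h9 ⊢ <;> first | (exfalso; revert h9; norm_num; done) | norm_num
  rw [h8]
  linarith

end IntegerPolynomials

/-! ### Ranks and depths of trace clusters -/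

section Ranks

theorem above_zero (t : ℝ) : above 0 t = 0 := by
  simp [above]

theorem above_sum (I : Finset ℕ) (K : ℕ → Multiset ℝ) (t : ℝ) :
    above (∑ i ∈ I, K i) t = ∑ i ∈ I, above (K i) t := by
  classical
  induction I using Finset.induction_on with
  | empty => simp [above_zero]
  | insert i I hi ih => rw [Finset.sum_insert hi, Finset.sum_insert hi, above_add, ih]

theorem above_eq_card {K : Multiset ℝ} {t : ℝ} (h : ∀ x ∈ K, t < x) : above K t = K.card := by
  rw [above, Multiset.filter_eq_self.mpr h]

theorem above_eq_zero {K : Multiset ℝ} {t : ℝ} (h : ∀ x ∈ K, x ≤ t) : above K t = 0 := by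
  rw [above, Multiset.filter_eq_nil.mpr fun x hx => not_lt.mpr (h x hx), Multiset.card_zero]

theorem above_antitone (K : Multiset ℝ) {t t' : ℝ} (h : t ≤ t') : above K t' ≤ above K t :=
  Multiset.card_le_card (Multiset.monotone_filter_right K fun _ hx => lt_of_le_of_lt h hx)

theorem above_lt_above {K : Multiset ℝ} {t t' : ℝ} (h : t < t') (ht : t' ∈ K) :
    above K t' < above K t := by
  refine Multiset.card_lt_card (lt_of_le_of_ne
    (Multiset.monotone_filter_right K fun _ hx => h.trans hx) fun he => ?_)
  have h1 : t' ∈ K.filter fun x => t < x := Multiset.mem_filter.mpr ⟨ht, h⟩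
  rw [← he, Multiset.mem_filter] at h1
  exact lt_irrefl _ h1.2

theorem above_lt_card {K : Multiset ℝ} {t : ℝ} (ht : t ∈ K) : above K t < K.card := by
  refine Multiset.card_lt_card (lt_of_le_of_ne (Multiset.filter_le _ _) fun he => ?_)
  rw [← he, Multiset.mem_filter] at ht
  exact lt_irrefl _ ht.2

/-- The elements of a multiset without repetitions have the ranks `0, …, n - 1`, counted from
the largest one. -/
theorem exists_above_eq {K : Multiset ℝ} (hK : K.Nodup) {k : ℕ} (hk : k < K.card) :
    ∃ t ∈ K, above K t = k := by
  classical
  have h1 : K.toFinset.image (above K) = Finset.range K.card := by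
    refine Finset.eq_of_subset_of_card_le (fun n hn => ?_) ?_
    · obtain ⟨t, ht, rfl⟩ := Finset.mem_image.mp hn
      exact Finset.mem_range.mpr (above_lt_card (Multiset.mem_toFinset.mp ht))
    · rw [Finset.card_range, Finset.card_image_of_injOn, Multiset.toFinset_card_of_nodup hK]
      intro t ht t' ht' he
      simp only [Finset.mem_coe, Multiset.mem_toFinset] at ht ht'
      rcases lt_trichotomy t t' with hlt | heq | hgt
      · exact absurd he (above_lt_above hlt ht').ne'
      · exact heq
      · exact absurd he (above_lt_above hgt ht).ne
  have h2 : k ∈ K.toFinset.image (above K) := by rw [h1]; exact Finset.mem_range.mpr hk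
  obtain ⟨t, ht, h⟩ := Finset.mem_image.mp h2
  exact ⟨t, Multiset.mem_toFinset.mp ht, h⟩

theorem lt_of_above_lt {K : Multiset ℝ} {t t' : ℝ} (h : above K t' < above K t) : t < t' := by
  by_contra hle
  exact absurd h (not_lt.mpr (above_antitone K (not_lt.mp hle)))

theorem exists_eq_pair {K : Multiset ℝ} (hK : K.Nodup) (hc : K.card = 2) :
    ∃ x y : ℝ, y < x ∧ K = {x, y} ∧ above K x = 0 ∧ above K y = 1 := by
  obtain ⟨x, hx, hx'⟩ := exists_above_eq hK (k := 0) (by omega)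
  obtain ⟨y, hy, hy'⟩ := exists_above_eq hK (k := 1) (by omega)
  have h : y < x := lt_of_above_lt (K := K) (by omega)
  refine ⟨x, y, h, (Multiset.eq_of_le_of_card_le ?_ (by simp [hc])).symm, hx', hy'⟩
  refine (Multiset.le_iff_subset (by simp [h.ne'])).mpr fun z hz => ?_
  simp only [Multiset.insert_eq_cons, Multiset.mem_cons, Multiset.mem_singleton] at hz
  rcases hz with rfl | rfl <;> assumption

theorem exists_eq_triple {K : Multiset ℝ} (hK : K.Nodup) (hc : K.card = 3) :
    ∃ x y z : ℝ, z < y ∧ y < x ∧ K = {z, y, x} ∧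
      above K x = 0 ∧ above K y = 1 ∧ above K z = 2 := by
  obtain ⟨x, hx, hx'⟩ := exists_above_eq hK (k := 0) (by omega)
  obtain ⟨y, hy, hy'⟩ := exists_above_eq hK (k := 1) (by omega)
  obtain ⟨z, hz, hz'⟩ := exists_above_eq hK (k := 2) (by omega)
  have h : y < x := lt_of_above_lt (K := K) (by omega)
  have h1 : z < y := lt_of_above_lt (K := K) (by omega)
  refine ⟨x, y, z, h1, h, (Multiset.eq_of_le_of_card_le ?_ (by simp [hc])).symm, hx', hy', hz'⟩
  refine (Multiset.le_iff_subset (by simp [h.ne, h1.ne, (h1.trans h).ne])).mpr fun w hw => ?_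
  simp only [Multiset.insert_eq_cons, Multiset.mem_cons, Multiset.mem_singleton] at hw
  rcases hw with rfl | rfl | rfl <;> assumption

end Ranks

section Clusters

variable {Φ Ψ : ℤ[X]} {s : ℕ} {A B : ℕ → Multiset ℝ}

/-- `B_j` lies below `A_i` for `i ≤ j`; the inner `A`-clusters between them are nonempty. -/
theorem IsTraceClusters.right_lt (h : IsTraceClusters Φ Ψ s A B) {i j : ℕ} (hi : 1 ≤ i)
    (hij : i ≤ j) (hj : j ≤ s) {a b : ℝ} (ha : a ∈ A i) (hb : b ∈ B j) : b < a := by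
  induction j, hij using Nat.le_induction generalizing b with
  | base => exact h.right_lt_left i (Finset.mem_Icc.mpr ⟨hi, hj⟩) b hb a ha
  | succ j hij ih =>
    obtain ⟨a', ha'⟩ := Multiset.exists_mem_of_ne_zero
      (h.left_ne (j + 1) (Finset.mem_Icc.mpr ⟨by omega, hj⟩))
    obtain ⟨b', hb'⟩ := Multiset.exists_mem_of_ne_zero
      (h.right_ne j (Finset.mem_Icc.mpr ⟨by omega, by omega⟩))
    exact ((h.right_lt_left (j + 1) (Finset.mem_Icc.mpr ⟨by omega, hj⟩) b hb a' ha').trans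
      (h.left_lt_right j (Finset.mem_Icc.mpr ⟨by omega, by omega⟩) a' ha' b' hb')).trans
      (ih (by omega) hb')

/-- `A_i` lies below `B_j` for `j < i`. -/
theorem IsTraceClusters.left_lt (h : IsTraceClusters Φ Ψ s A B) {i j : ℕ} (hj : 1 ≤ j)
    (hij : j + 1 ≤ i) (hi : i ≤ s + 1) {a b : ℝ} (ha : a ∈ A i) (hb : b ∈ B j) : a < b := by
  induction i, hij using Nat.le_induction generalizing a with
  | base => exact h.left_lt_right j (Finset.mem_Icc.mpr ⟨hj, by omega⟩) a ha b hb
  | succ i hij ih =>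
    obtain ⟨a', ha'⟩ := Multiset.exists_mem_of_ne_zero
      (h.left_ne i (Finset.mem_Icc.mpr ⟨by omega, by omega⟩))
    obtain ⟨b', hb'⟩ := Multiset.exists_mem_of_ne_zero
      (h.right_ne i (Finset.mem_Icc.mpr ⟨by omega, by omega⟩))
    exact ((h.left_lt_right i (Finset.mem_Icc.mpr ⟨by omega, by omega⟩) a ha b' hb').trans
      (h.right_lt_left i (Finset.mem_Icc.mpr ⟨by omega, by omega⟩) b' hb' a' ha')).trans
      (ih (by omega) ha')

theorem IsTraceClusters.right_lt_right (h : IsTraceClusters Φ Ψ s A B) {i j : ℕ} (hi : 1 ≤ i)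
    (hij : i + 1 ≤ j) (hj : j ≤ s) {b b' : ℝ} (hb : b ∈ B j) (hb' : b' ∈ B i) : b < b' := by
  obtain ⟨a, ha⟩ := Multiset.exists_mem_of_ne_zero
    (h.left_ne (i + 1) (Finset.mem_Icc.mpr ⟨by omega, by omega⟩))
  exact (h.right_lt (by omega) hij hj ha hb).trans (h.left_lt hi le_rfl (by omega) ha hb')

/-- The number of elements of the clusters `A_1, B_1, A_2, …, B_{j-1}, A_j` above `B_j`. -/
def depth (A B : ℕ → Multiset ℝ) (j : ℕ) : ℕ :=
  ∑ i ∈ Finset.Icc 1 j, (A i).card + ∑ i ∈ Finset.Ico 1 j, (B i).card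

theorem depth_succ (A B : ℕ → Multiset ℝ) {j : ℕ} (hj : 1 ≤ j) :
    depth A B (j + 1) = depth A B j + (A (j + 1)).card + (B j).card := by
  rw [depth, depth, Finset.sum_Icc_succ_top (by omega), Finset.sum_Ico_succ_top hj]
  ring

theorem sum_ite_lt {I J : Finset ℕ} {f : ℕ → ℕ} (hIJ : J ⊆ I) (g : ℕ → ℕ)
    (h1 : ∀ i ∈ J, g i = f i) (h2 : ∀ i ∈ I, i ∉ J → g i = 0) : ∑ i ∈ I, g i = ∑ i ∈ J, f i := by
  rw [← Finset.sum_subset hIJ h2]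
  exact Finset.sum_congr rfl h1

/-- The number of trace roots above an element of `B_j` is the depth of the cluster plus the rank
inside the cluster. -/
theorem IsTraceClusters.above_eq (h : IsTraceClusters Φ Ψ s A B) {j : ℕ} (hj : j ∈ Finset.Icc 1 s)
    {τ : ℝ} (hτ : τ ∈ B j) :
    above (rootsOn Φ + rootsOn Ψ) τ = depth A B j + above (B j) τ := by
  obtain ⟨hj1, hjs⟩ := Finset.mem_Icc.mp hj
  have h1 : above (rootsOn Φ) τ = ∑ i ∈ Finset.Icc 1 j, (A i).card := by
    rw [← h.sum_left, above_sum]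
    refine sum_ite_lt (Finset.Icc_subset_Icc_right (by omega)) _ (fun i hi => ?_)
      fun i hi hij => ?_
    · obtain ⟨h2, h3⟩ := Finset.mem_Icc.mp hi
      exact above_eq_card fun x hx => h.right_lt h2 h3 hjs hx hτ
    · rw [Finset.mem_Icc] at hi hij
      exact above_eq_zero fun x hx => (h.left_lt hj1 (by omega) hi.2 hx hτ).le
  have h2 : above (rootsOn Ψ) τ =
      ∑ i ∈ Finset.Ico 1 j, (B i).card + above (B j) τ := by
    have e : Finset.Icc 1 s = insert j ((Finset.Icc 1 s).erase j) :=
      (Finset.insert_erase hj).symm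
    rw [← h.sum_right, above_sum, e, Finset.sum_insert (Finset.notMem_erase _ _), add_comm]
    congr 1
    refine sum_ite_lt (fun i hi => ?_) _ (fun i hi => ?_) fun i hi hij => ?_
    · rw [Finset.mem_Ico] at hi
      rw [Finset.mem_erase, Finset.mem_Icc]
      omega
    · obtain ⟨h2, h3⟩ := Finset.mem_Ico.mp hi
      exact above_eq_card fun x hx => h.right_lt_right h2 h3 hjs hτ hx
    · rw [Finset.mem_erase, Finset.mem_Icc] at hi
      rw [Finset.mem_Ico] at hij
      exact above_eq_zero fun x hx => (h.right_lt_right hj1 (by omega) hi.2.2 hx hτ).le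
  rw [above_add, h1, h2, depth]
  ring

theorem IsTraceClusters.mem_right (h : IsTraceClusters Φ Ψ s A B) {t : ℝ} :
    t ∈ rootsOn Ψ ↔ ∃ j ∈ Finset.Icc 1 s, t ∈ B j := by
  rw [← h.sum_right, Multiset.mem_sum]

theorem IsTraceClusters.right_le (h : IsTraceClusters Φ Ψ s A B) {j : ℕ}
    (hj : j ∈ Finset.Icc 1 s) : B j ≤ rootsOn Ψ := by
  rw [← h.sum_right]
  exact Finset.single_le_sum (f := B) (fun i _ => Multiset.zero_le _) hj

theorem IsTraceClusters.card_right (h : IsTraceClusters Φ Ψ s A B) :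
    (rootsOn Ψ).card = (clusterType (Finset.Icc 1 s) B).sum := by
  rw [← h.sum_right, Multiset.card_sum]
  rfl

/-- A criterion for the parity condition in terms of the parities of the depths. -/
theorem IsTraceClusters.parityCondition (h : IsTraceClusters Φ Ψ s A B) {j₀ c : ℕ}
    (hj₀ : j₀ ∈ Finset.Icc 1 s) {τ : ℝ} (hτ : τ ∈ B j₀)
    (hc : (depth A B j₀ + above (B j₀) τ) % 2 = (c + 1) % 2)
    (h1 : ∀ t ∈ B j₀, t ≠ τ → (depth A B j₀ + above (B j₀) t) % 2 = c % 2)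
    (h2 : ∀ j ∈ Finset.Icc 1 s, j ≠ j₀ → (B j).card = 1 ∧ depth A B j % 2 = c % 2) :
    ParityCondition (rootsOn Φ) (rootsOn Ψ) τ := by
  refine ⟨h.mem_right.mpr ⟨j₀, hj₀, hτ⟩, fun t ht hne => ?_⟩
  obtain ⟨j, hj, htj⟩ := h.mem_right.mp ht
  rw [h.above_eq hj htj, h.above_eq hj₀ hτ, Nat.odd_iff]
  rcases eq_or_ne j j₀ with rfl | hjne
  · have := h1 t htj hne
    omega
  · obtain ⟨h3, h4⟩ := h2 j hj hjne
    have h5 := above_lt_card htj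
    omega

/-- The converse of the criterion: away from the cluster of `τ` all `B`-clusters are singletons,
and the cluster of `τ` has at most three elements. -/
theorem IsTraceClusters.of_parityCondition (h : IsTraceClusters Φ Ψ s A B)
    (hnd : (rootsOn Ψ).Nodup) {τ : ℝ} (hτ : ParityCondition (rootsOn Φ) (rootsOn Ψ) τ) :
    ∃ j₀ ∈ Finset.Icc 1 s, ∃ c : ℕ,
      (∀ j ∈ Finset.Icc 1 s, j ≠ j₀ → (B j).card = 1 ∧ depth A B j % 2 = c % 2) ∧
      (((B j₀).card = 3 ∧ depth A B j₀ % 2 = c % 2) ∨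
        ((B j₀).card = 2 ∧ depth A B j₀ % 2 = c % 2) ∨
        ((B j₀).card = 2 ∧ depth A B j₀ % 2 = (c + 1) % 2) ∨
        ((B j₀).card = 1 ∧ depth A B j₀ % 2 = (c + 1) % 2)) := by
  obtain ⟨j₀, hj₀, hτj⟩ := h.mem_right.mp hτ.1
  have hn := h.above_eq hj₀ hτj
  have key : ∀ j ∈ Finset.Icc 1 s, ∀ k < (B j).card, (j = j₀ → k ≠ above (B j) τ) →
      (depth A B j + k) % 2 = (above (rootsOn Φ + rootsOn Ψ) τ + 1) % 2 := by
    intro j hj k hk hkn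
    obtain ⟨t, ht, rfl⟩ := exists_above_eq (Multiset.nodup_of_le (h.right_le hj) hnd) hk
    have h1 := hτ.2 t (h.mem_right.mpr ⟨j, hj, ht⟩) ?_
    · rw [h.above_eq hj ht, Nat.odd_iff] at h1
      omega
    · rintro rfl
      rcases eq_or_ne j j₀ with he | hne
      · exact hkn he rfl
      · rw [Finset.mem_Icc] at hj hj₀
        rcases lt_or_gt_of_ne hne with h2 | h2
        · exact lt_irrefl _ (h.right_lt_right hj.1 h2 hj₀.2 hτj ht)
        · exact lt_irrefl _ (h.right_lt_right hj₀.1 h2 hj.2 ht hτj)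
  refine ⟨j₀, hj₀, above (rootsOn Φ + rootsOn Ψ) τ + 1, fun j hj hne => ?_, ?_⟩
  · have h0 : 0 < (B j).card := Multiset.card_pos.mpr (h.right_ne j hj)
    have h1 := key j hj 0 h0 fun he => absurd he hne
    refine ⟨?_, by simpa using h1⟩
    by_contra hc
    have h2 := key j hj 1 (by omega) fun he => absurd he hne
    omega
  · have hlt := above_lt_card hτj
    have k0 := key j₀ hj₀ 0
    have k1 := key j₀ hj₀ 1
    have k2 := key j₀ hj₀ 2
    have k3 := key j₀ hj₀ 3
    simp only [true_imp_iff] at k0 k1 k2 k3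
    omega

end Clusters

/-! ### Cluster types and the rows of the table -/

section Types

variable {I : Finset ℕ} {K : ℕ → Multiset ℝ}

theorem clusterType_eq_replicate (h : ∀ i ∈ I, (K i).card = 1) :
    clusterType I K = Multiset.replicate I.card 1 := by
  rw [clusterType, Multiset.map_congr rfl (fun i hi => h i hi), Multiset.map_const']
  rfl

theorem clusterType_eq_cons {i₀ : ℕ} (hi₀ : i₀ ∈ I)
    (h : ∀ i ∈ I, i ≠ i₀ → (K i).card = 1) :
    clusterType I K = (K i₀).card ::ₘ Multiset.replicate (I.card - 1) 1 := by
  have e : I.val = i₀ ::ₘ (I.erase i₀).val := (Multiset.cons_erase hi₀).symm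
  rw [← Finset.card_erase_of_mem hi₀, ← clusterType_eq_replicate (I := I.erase i₀) (K := K)
    fun i hi => h i (Finset.mem_of_mem_erase hi) (Finset.ne_of_mem_erase hi),
    clusterType, e, Multiset.map_cons]
  rfl

theorem card_eq_one_of_clusterType {m : ℕ} (h : clusterType I K = Multiset.replicate m 1) :
    ∀ i ∈ I, (K i).card = 1 := fun i hi =>
  Multiset.eq_of_mem_replicate (h ▸ Multiset.mem_map_of_mem _ hi :
    (K i).card ∈ Multiset.replicate m 1)

theorem exists_of_clusterType {m c : ℕ} (h : clusterType I K = c ::ₘ Multiset.replicate m 1) :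
    ∃ i₀ ∈ I, (K i₀).card = c ∧ ∀ i ∈ I, i ≠ i₀ → (K i).card = 1 := by
  obtain ⟨i₀, hi₀, hc⟩ : ∃ i₀ ∈ I, (K i₀).card = c := by
    have h1 : c ∈ clusterType I K := by rw [h]; exact Multiset.mem_cons_self _ _
    obtain ⟨i, hi, h2⟩ := Multiset.mem_map.mp h1
    exact ⟨i, hi, h2⟩
  refine ⟨i₀, hi₀, hc, fun i hi hne => ?_⟩
  have e : I.val = i₀ ::ₘ (I.erase i₀).val := (Multiset.cons_erase hi₀).symm
  rw [clusterType, e, Multiset.map_cons, hc, Multiset.cons_inj_right] at h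
  exact card_eq_one_of_clusterType (I := I.erase i₀) h i (Finset.mem_erase.mpr ⟨hne, hi⟩)

theorem ctype_ones (m : ℕ) : ctype 0 m 0 0 = Multiset.replicate m 1 := by
  simp [ctype]

theorem ctype_double (m : ℕ) : ctype 0 m 1 0 = 2 ::ₘ Multiset.replicate m 1 := by
  simp [ctype, add_comm _ ({2} : Multiset ℕ)]

theorem ctype_triple (m : ℕ) : ctype 0 m 0 1 = 3 ::ₘ Multiset.replicate m 1 := by
  simp [ctype, add_comm _ ({3} : Multiset ℕ)]

theorem sum_card_eq_sum_clusterType : ∑ i ∈ I, (K i).card = (clusterType I K).sum := rfl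

theorem card_le_sum {ι : Type*} {I : Finset ι} {f : ι → ℕ} (h : ∀ i ∈ I, 1 ≤ f i) : I.card ≤ ∑ i ∈ I, f i := by
  simpa using Finset.card_nsmul_le_sum I f 1 h

/-- Odd cluster sizes with a small sum are all `1`, except possibly for one `3`. -/
theorem clusterType_of_odd (h : ∀ i ∈ I, (K i).card % 2 = 1)
    (hs : ∑ i ∈ I, (K i).card ≤ I.card + 3) :
    clusterType I K = Multiset.replicate I.card 1 ∨
      clusterType I K = 3 ::ₘ Multiset.replicate (I.card - 1) 1 := by
  by_cases h1 : ∀ i ∈ I, (K i).card = 1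
  · exact Or.inl (clusterType_eq_replicate h1)
  right
  push Not at h1
  obtain ⟨i₀, hi₀, h2⟩ := h1
  have h3 : ∀ i ∈ I, 1 ≤ (K i).card := fun i hi => by have := h i hi; omega
  have hc := Finset.card_erase_of_mem hi₀
  have hpos := Finset.card_pos.mpr ⟨i₀, hi₀⟩
  have e := Finset.add_sum_erase I (fun i => (K i).card) hi₀
  have h4 := card_le_sum (I := I.erase i₀) fun i hi => h3 i (Finset.mem_of_mem_erase hi)
  have h5 := h i₀ hi₀
  rw [clusterType_eq_cons hi₀ fun i hi hne => ?_, show (K i₀).card = 3 by omega]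
  by_contra h6
  have hi' : i ∈ I.erase i₀ := Finset.mem_erase.mpr ⟨hne, hi⟩
  have hc' := Finset.card_erase_of_mem hi'
  have hpos' := Finset.card_pos.mpr ⟨i, hi'⟩
  have e' := Finset.add_sum_erase (I.erase i₀) (fun i => (K i).card) hi'
  have h7 := card_le_sum (I := (I.erase i₀).erase i) fun i hi =>
    h3 i (Finset.mem_of_mem_erase (Finset.mem_of_mem_erase hi))
  have h8 := h i hi
  omega

/-- If one cluster size is even and positive and the others are odd, then a small sum forces one
`2` and otherwise `1`. -/
theorem card_of_even {i₀ : ℕ} (hi₀ : i₀ ∈ I) (h0 : (K i₀).card % 2 = 0) (h1 : 1 ≤ (K i₀).card)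
    (h : ∀ i ∈ I, i ≠ i₀ → (K i).card % 2 = 1) (hs : ∑ i ∈ I, (K i).card ≤ I.card + 2) :
    (K i₀).card = 2 ∧ ∀ i ∈ I, i ≠ i₀ → (K i).card = 1 := by
  have h3 : ∀ i ∈ I.erase i₀, 1 ≤ (K i).card := fun i hi => by
    have := h i (Finset.mem_of_mem_erase hi) (Finset.ne_of_mem_erase hi)
    omega
  have hc := Finset.card_erase_of_mem hi₀
  have hpos := Finset.card_pos.mpr ⟨i₀, hi₀⟩
  have e := Finset.add_sum_erase I (fun i => (K i).card) hi₀
  have h4 := card_le_sum h3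
  refine ⟨by omega, fun i hi hne => ?_⟩
  by_contra h6
  have hi' : i ∈ I.erase i₀ := Finset.mem_erase.mpr ⟨hne, hi⟩
  have hc' := Finset.card_erase_of_mem hi'
  have hpos' := Finset.card_pos.mpr ⟨i, hi'⟩
  have e' := Finset.add_sum_erase (I.erase i₀) (fun i => (K i).card) hi'
  have h7 := card_le_sum (I := (I.erase i₀).erase i) fun i hi =>
    h3 i (Finset.mem_of_mem_erase hi)
  have h8 := h i hi hne
  omega

end Types

section Cases

variable {Φ Ψ : ℤ[X]} {s : ℕ} {A B : ℕ → Multiset ℝ}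

/-- Ten elements in `s` clusters, all singletons but one. -/
theorem card_right_of_clusterType (h : IsTraceClusters Φ Ψ s A B)
    (hΨ : (rootsOn Ψ).card = 10) {j₀ : ℕ} (hj₀ : j₀ ∈ Finset.Icc 1 s)
    (h1 : ∀ j ∈ Finset.Icc 1 s, j ≠ j₀ → (B j).card = 1) : s + (B j₀).card = 11 := by
  rw [h.card_right, clusterType_eq_cons hj₀ h1] at hΨ
  rw [Finset.mem_Icc] at hj₀
  simp at hΨ
  omega

theorem IsTraceClusters.sum_card_left_le (h : IsTraceClusters Φ Ψ s A B) :
    ∑ i ∈ Finset.Icc 2 s, (A i).card ≤ (rootsOn Φ).card := by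
  rw [← h.sum_left, Multiset.card_sum]
  exact Finset.sum_le_sum_of_subset (Finset.Icc_subset_Icc (by omega) (by omega))

/-- The parity condition forces one of the rows of the table. -/
theorem IsTraceClusters.exists_inCase (h : IsTraceClusters Φ Ψ s A B) (hnd : (rootsOn Ψ).Nodup)
    (hΨ : (rootsOn Ψ).card = 10) (hΦ : (rootsOn Φ).card ≤ 10) (hgt : (rootsGtTwo Ψ).card = 1)
    {τ : ℝ} (hτ : ParityCondition (rootsOn Φ) (rootsOn Ψ) τ) : ∃ k, InCase Ψ s A B k := by
  obtain ⟨j₀, hj₀, c, hother, hcase⟩ := h.of_parityCondition hnd hτ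
  have hcard := card_right_of_clusterType h hΨ hj₀ fun j hj hne => (hother j hj hne).1
  have hsum := h.sum_card_left_le.trans hΦ
  have htype := clusterType_eq_cons hj₀ fun j hj hne => (hother j hj hne).1
  rw [Nat.card_Icc] at htype
  have hmem := Finset.mem_Icc.mp hj₀
  have hpos : ∀ i ∈ Finset.Icc 2 s, 1 ≤ (A i).card := fun i hi =>
    Multiset.card_pos.mpr (h.left_ne i hi)
  have hodd : ∀ i ∈ Finset.Icc 2 s, i ≠ j₀ → i ≠ j₀ + 1 → (A i).card % 2 = 1 := by
    intro i hi h1 h2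
    rw [Finset.mem_Icc] at hi
    have h3 := hother (i - 1) (Finset.mem_Icc.mpr ⟨by omega, by omega⟩) (by omega)
    have h4 := hother i (Finset.mem_Icc.mpr ⟨by omega, by omega⟩) (by omega)
    have h5 := depth_succ A B (j := i - 1) (by omega)
    rw [show i - 1 + 1 = i by omega] at h5
    omega
  have hat : 2 ≤ j₀ →
      depth A B j₀ % 2 = (c + 1 + (A j₀).card) % 2 := by
    intro h2
    have h3 := hother (j₀ - 1) (Finset.mem_Icc.mpr ⟨by omega, by omega⟩) (by omega)
    have h5 := depth_succ A B (j := j₀ - 1) (by omega)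
    rw [show j₀ - 1 + 1 = j₀ by omega] at h5
    omega
  have hnext : j₀ + 1 ≤ s →
      (depth A B j₀ + (B j₀).card + (A (j₀ + 1)).card) % 2 = c % 2 := by
    intro h2
    have h3 := hother (j₀ + 1) (Finset.mem_Icc.mpr ⟨by omega, by omega⟩) (by omega)
    have h5 := depth_succ A B (j := j₀) (by omega)
    omega
  rcases hcase with ⟨hb, hd⟩ | ⟨hb, hd⟩ | ⟨hb, hd⟩ | ⟨hb, hd⟩
  · obtain rfl : s = 8 := by omega
    have hall : ∀ i ∈ Finset.Icc 2 8, (A i).card % 2 = 1 := by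
      intro i hi
      rcases eq_or_ne i j₀ with rfl | h1
      · have := hat (Finset.mem_Icc.mp hi).1
        omega
      rcases eq_or_ne i (j₀ + 1) with rfl | h2
      · have := hnext (Finset.mem_Icc.mp hi).2
        omega
      exact hodd i hi h1 h2
    rw [hb] at htype
    rcases clusterType_of_odd hall (by simpa using hsum) with hA | hA
    · refine ⟨1, rfl, ?_, ?_, ?_, hgt⟩
      · rw [hA, ctype_ones]; rfl
      · rw [htype, ctype_triple]
      · rw [sum_card_eq_sum_clusterType, hA]; rfl
    · refine ⟨2, rfl, ?_, ?_, ?_, hgt⟩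
      · rw [hA, ctype_triple]; rfl
      · rw [htype, ctype_triple]
      · rw [sum_card_eq_sum_clusterType, hA]; rfl
  · obtain rfl : s = 9 := by omega
    rw [hb] at htype
    rcases Nat.lt_or_ge j₀ 9 with hlt | hge
    · have hm : j₀ + 1 ∈ Finset.Icc 2 9 := Finset.mem_Icc.mpr ⟨by omega, by omega⟩
      have hA := card_of_even hm (by have := hnext (by omega); omega) (hpos _ hm)
        (fun i hi hne => by
          rcases eq_or_ne i j₀ with rfl | h1
          · have := hat (Finset.mem_Icc.mp hi).1
            omega
          exact hodd i hi h1 hne) (by simpa using hsum)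
      have hA' := clusterType_eq_cons hm hA.2
      rw [hA.1] at hA'
      refine ⟨3, ⟨rfl, ?_, ?_, ?_, hgt⟩, j₀ + 1, j₀, hm, hj₀, hA.1, hb, Or.inr rfl⟩
      · rw [hA', ctype_double]; rfl
      · rw [htype, ctype_double]
      · rw [sum_card_eq_sum_clusterType, hA']; rfl
    · obtain rfl : j₀ = 9 := by omega
      have hall : ∀ i ∈ Finset.Icc 2 9, (A i).card % 2 = 1 := by
        intro i hi
        have := Finset.mem_Icc.mp hi
        rcases eq_or_ne i 9 with rfl | h1
        · have := hat (Finset.mem_Icc.mp hi).1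
          omega
        exact hodd i hi h1 (by omega)
      rcases clusterType_of_odd hall (by simp; omega) with hA | hA
      · refine ⟨5, ⟨rfl, ?_, ?_, ?_, hgt⟩, hb⟩
        · rw [hA, ctype_ones]; rfl
        · rw [htype, ctype_double]
        · rw [sum_card_eq_sum_clusterType, hA]; rfl
      · refine ⟨7, ⟨rfl, ?_, ?_, ?_, hgt⟩, hb⟩
        · rw [hA, ctype_triple]; rfl
        · rw [htype, ctype_double]
        · rw [sum_card_eq_sum_clusterType, hA]; rfl
  · obtain rfl : s = 9 := by omega
    rw [hb] at htype
    rcases Nat.lt_or_ge 1 j₀ with hlt | hge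
    · have hm : j₀ ∈ Finset.Icc 2 9 := Finset.mem_Icc.mpr ⟨by omega, by omega⟩
      have hA := card_of_even hm (by have := hat (by omega); omega) (hpos _ hm)
        (fun i hi hne => by
          rcases eq_or_ne i (j₀ + 1) with rfl | h1
          · have := hnext (Finset.mem_Icc.mp hi).2
            omega
          exact hodd i hi hne h1) (by simpa using hsum)
      have hA' := clusterType_eq_cons hm hA.2
      rw [hA.1] at hA'
      refine ⟨3, ⟨rfl, ?_, ?_, ?_, hgt⟩, j₀, j₀, hm, hj₀, hA.1, hb, Or.inl rfl⟩
      · rw [hA', ctype_double]; rfl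
      · rw [htype, ctype_double]
      · rw [sum_card_eq_sum_clusterType, hA']; rfl
    · obtain rfl : j₀ = 1 := by omega
      have hall : ∀ i ∈ Finset.Icc 2 9, (A i).card % 2 = 1 := by
        intro i hi
        have := Finset.mem_Icc.mp hi
        rcases eq_or_ne i 2 with rfl | h1
        · have h3 : (depth A B 1 + (B 1).card + (A 2).card) % 2 = c % 2 := hnext (by omega)
          omega
        exact hodd i hi (by omega) (by omega)
      rcases clusterType_of_odd hall (by simp; omega) with hA | hA
      · refine ⟨4, ⟨rfl, ?_, ?_, ?_, hgt⟩, hb⟩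
        · rw [hA, ctype_ones]; rfl
        · rw [htype, ctype_double]
        · rw [sum_card_eq_sum_clusterType, hA]; rfl
      · refine ⟨6, ⟨rfl, ?_, ?_, ?_, hgt⟩, hb⟩
        · rw [hA, ctype_triple]; rfl
        · rw [htype, ctype_double]
        · rw [sum_card_eq_sum_clusterType, hA]; rfl
  · obtain rfl : s = 10 := by omega
    rw [hb] at htype
    have hB : clusterType (Finset.Icc 1 10) B = ctype 0 10 0 0 := by
      rw [htype, ctype_ones]; rfl
    rcases Nat.lt_or_ge 1 j₀ with hlt | hge
    · have hm : j₀ ∈ Finset.Icc 2 10 := Finset.mem_Icc.mpr ⟨by omega, by omega⟩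
      rcases Nat.lt_or_ge j₀ 10 with hlt' | hge'
      · -- both neighbours of `B_{j₀}` are even, hence too large
        exfalso
        have hm' : j₀ + 1 ∈ (Finset.Icc 2 10).erase j₀ :=
          Finset.mem_erase.mpr ⟨by omega, Finset.mem_Icc.mpr ⟨by omega, by omega⟩⟩
        have e := Finset.add_sum_erase _ (fun i => (A i).card) hm
        have e' := Finset.add_sum_erase _ (fun i => (A i).card) hm'
        have h3 := card_le_sum (I := ((Finset.Icc 2 10).erase j₀).erase (j₀ + 1))
          (f := fun i => (A i).card) fun i hi =>
            hpos i (Finset.mem_of_mem_erase (Finset.mem_of_mem_erase hi))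
        rw [Finset.card_erase_of_mem hm', Finset.card_erase_of_mem hm, Nat.card_Icc] at h3
        have h4 := hat (by omega)
        have h5 := hnext (by omega)
        have h6 := hpos _ hm
        have h7 := hpos _ (Finset.mem_of_mem_erase hm')
        omega
      · obtain rfl : j₀ = 10 := by omega
        have hA := card_of_even hm (by have := hat (by omega); omega) (hpos _ hm)
          (fun i hi hne => hodd i hi hne (by have := Finset.mem_Icc.mp hi; omega))
          (by simp; omega)
        have hA' := clusterType_eq_cons hm hA.2
        rw [hA.1] at hA'
        refine ⟨9, ⟨rfl, ?_, hB, ?_, hgt⟩, hA.1⟩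
        · rw [hA', ctype_double]; rfl
        · rw [sum_card_eq_sum_clusterType, hA']; rfl
    · obtain rfl : j₀ = 1 := by omega
      have hm : 2 ∈ Finset.Icc 2 10 := by simp
      have h3 : (depth A B 1 + (B 1).card + (A 2).card) % 2 = c % 2 := hnext (by omega)
      have hA := card_of_even hm (by omega) (hpos _ hm)
        (fun i hi hne => hodd i hi (by have := Finset.mem_Icc.mp hi; omega) hne)
        (by simp; omega)
      have hA' := clusterType_eq_cons hm hA.2
      rw [hA.1] at hA'
      refine ⟨8, ⟨rfl, ?_, hB, ?_, hgt⟩, hA.1⟩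
      · rw [hA', ctype_double]; rfl
      · rw [sum_card_eq_sum_clusterType, hA']; rfl

end Cases

/-! ### The location of the special trace -/

section Locations

variable {Φ Ψ : ℤ[X]} {s : ℕ} {A B : ℕ → Multiset ℝ}

/-- The parity of the depth is constant as long as consecutive cluster sizes have an even sum. -/
theorem depth_mod {u v : ℕ} (hu : 1 ≤ u)
    (h : ∀ j, u ≤ j → j + 1 ≤ v → ((A (j + 1)).card + (B j).card) % 2 = 0) {j : ℕ} (hj : u ≤ j)
    (hjv : j ≤ v) : depth A B j % 2 = depth A B u % 2 := by
  induction j, hj using Nat.le_induction with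
  | base => rfl
  | succ j hj ih =>
    have h1 := h j hj hjv
    have h2 := ih (by omega)
    rw [depth_succ A B (by omega)]
    omega

theorem odd_card_of_clusterType {I : Finset ℕ} {K : ℕ → Multiset ℝ} {m : ℕ}
    (h : clusterType I K = Multiset.replicate m 1 ∨
      clusterType I K = 3 ::ₘ Multiset.replicate m 1) :
    ∀ i ∈ I, (K i).card % 2 = 1 := by
  intro i hi
  rcases h with h | h
  · rw [card_eq_one_of_clusterType h i hi]
  · obtain ⟨i₀, -, h1, h2⟩ := exists_of_clusterType h
    rcases eq_or_ne i i₀ with rfl | hne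
    · rw [h1]
    · rw [h2 i hi hne]

/-- If the depth of the only double `B`-cluster has the exceptional parity, then its larger element
is exceptional. -/
theorem IsTraceClusters.parityCondition_max (h : IsTraceClusters Φ Ψ s A B)
    (hnd : (rootsOn Ψ).Nodup) {j₀ c : ℕ} (hj₀ : j₀ ∈ Finset.Icc 1 s) (hb : (B j₀).card = 2)
    (hc : depth A B j₀ % 2 = (c + 1) % 2)
    (h2 : ∀ j ∈ Finset.Icc 1 s, j ≠ j₀ → (B j).card = 1 ∧ depth A B j % 2 = c % 2) :
    ∃ x y : ℝ, y < x ∧ B j₀ = {x, y} ∧ ParityCondition (rootsOn Φ) (rootsOn Ψ) x := by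
  obtain ⟨x, y, hyx, e, hx, hy⟩ := exists_eq_pair (Multiset.nodup_of_le (h.right_le hj₀) hnd) hb
  refine ⟨x, y, hyx, e, h.parityCondition hj₀ (by simp [e]) (c := c) (by omega)
    (fun t ht hne => ?_) h2⟩
  simp only [e, Multiset.insert_eq_cons, Multiset.mem_cons, Multiset.mem_singleton] at ht
  obtain rfl := ht.resolve_left hne
  omega

/-- If the depth of the only double `B`-cluster has the common parity, then its smaller element is
exceptional. -/
theorem IsTraceClusters.parityCondition_min (h : IsTraceClusters Φ Ψ s A B)
    (hnd : (rootsOn Ψ).Nodup) {j₀ c : ℕ} (hj₀ : j₀ ∈ Finset.Icc 1 s) (hb : (B j₀).card = 2)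
    (hc : depth A B j₀ % 2 = c % 2)
    (h2 : ∀ j ∈ Finset.Icc 1 s, j ≠ j₀ → (B j).card = 1 ∧ depth A B j % 2 = c % 2) :
    ∃ x y : ℝ, y < x ∧ B j₀ = {x, y} ∧ ParityCondition (rootsOn Φ) (rootsOn Ψ) y := by
  obtain ⟨x, y, hyx, e, hx, hy⟩ := exists_eq_pair (Multiset.nodup_of_le (h.right_le hj₀) hnd) hb
  refine ⟨x, y, hyx, e, h.parityCondition hj₀ (by simp [e]) (c := c) (by omega)
    (fun t ht hne => ?_) h2⟩
  simp only [e, Multiset.insert_eq_cons, Multiset.mem_cons, Multiset.mem_singleton] at ht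
  obtain rfl := ht.resolve_right hne
  omega

theorem IsTraceClusters.parityCondition_singleton (h : IsTraceClusters Φ Ψ s A B)
    {j₀ c : ℕ} (hj₀ : j₀ ∈ Finset.Icc 1 s) (hb : (B j₀).card = 1)
    (hc : depth A B j₀ % 2 = (c + 1) % 2)
    (h2 : ∀ j ∈ Finset.Icc 1 s, j ≠ j₀ → (B j).card = 1 ∧ depth A B j % 2 = c % 2) :
    ∃ x ∈ B j₀, ParityCondition (rootsOn Φ) (rootsOn Ψ) x := by
  obtain ⟨x, e⟩ := Multiset.card_eq_one.mp hb
  have hx : x ∈ B j₀ := by simp [e]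
  have h1 := above_lt_card hx
  refine ⟨x, hx, h.parityCondition hj₀ hx (c := c) (by omega) (fun t ht hne => ?_) h2⟩
  rw [e, Multiset.mem_singleton] at ht
  exact absurd ht hne

/-- All cluster sizes are odd, so all depths have the same parity, and the middle of the triple
cluster is exceptional. -/
theorem IsTraceClusters.exists_triple (h : IsTraceClusters Φ Ψ s A B)
    (hnd : (rootsOn Ψ).Nodup) {m : ℕ} (hA : ∀ i ∈ Finset.Icc 2 s, (A i).card % 2 = 1)
    (hB : clusterType (Finset.Icc 1 s) B = ctype 0 m 0 1) :
    ∃ τ, ParityCondition (rootsOn Φ) (rootsOn Ψ) τ ∧ IsMiddleOfTriple s B τ := by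
  rw [ctype_triple] at hB
  have hodd := odd_card_of_clusterType (Or.inr hB)
  obtain ⟨j₀, hj₀, hb, hB'⟩ := exists_of_clusterType hB
  have hd : ∀ j ∈ Finset.Icc 1 s, depth A B j % 2 = depth A B 1 % 2 := fun j hj => by
    obtain ⟨h1, h2⟩ := Finset.mem_Icc.mp hj
    refine depth_mod le_rfl (v := s) (fun j h3 h4 => ?_) h1 h2
    have := hA (j + 1) (Finset.mem_Icc.mpr ⟨by omega, h4⟩)
    have := hodd j (Finset.mem_Icc.mpr ⟨h3, by omega⟩)
    omega
  obtain ⟨x, y, z, hzy, hyx, e, hx, hy, hz⟩ :=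
    exists_eq_triple (Multiset.nodup_of_le (h.right_le hj₀) hnd) hb
  have hd0 := hd j₀ hj₀
  refine ⟨y, h.parityCondition hj₀ (by simp [e]) (c := depth A B 1) (by omega)
    (fun t ht hne => ?_) fun j hj hne => ⟨hB' j hj hne, hd j hj⟩, j₀, hj₀, z, x, hzy, hyx, e⟩
  simp only [e, Multiset.insert_eq_cons, Multiset.mem_cons, Multiset.mem_singleton] at ht
  rcases ht with rfl | rfl | rfl
  · omega
  · exact absurd rfl hne
  · omega

theorem exists_eq_pair_le {K : Multiset ℝ} (h : K.card = 2) : ∃ p q : ℝ, q ≤ p ∧ K = {q, p} := by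
  obtain ⟨p, q, e⟩ := Multiset.card_eq_two.mp h
  rcases le_total q p with hle | hle
  · exact ⟨p, q, hle, by rw [e, Multiset.pair_comm]⟩
  · exact ⟨q, p, hle, e⟩

/-- For `i = j` the double `A`-cluster lies above `B_j` and the larger element of `B_j` is
exceptional; for `i = j + 1` it lies below and the smaller one is. -/
theorem IsTraceClusters.exists_inner (h : IsTraceClusters Φ Ψ s A B)
    (hnd : (rootsOn Ψ).Nodup) {m m' : ℕ} (hA : clusterType (Finset.Icc 2 s) A = ctype 0 m' 1 0)
    (hB : clusterType (Finset.Icc 1 s) B = ctype 0 m 1 0)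
    (hij : ∃ i j, IsAdjacentDoublePair s A B i j) :
    ∃ τ, ParityCondition (rootsOn Φ) (rootsOn Ψ) τ ∧ IsInnerOfAdjacentPair s A B τ := by
  rw [ctype_double] at hA hB
  obtain ⟨i₀, hi₀, ha, hA'⟩ := exists_of_clusterType hA
  obtain ⟨j₀, hj₀, hb, hB'⟩ := exists_of_clusterType hB
  obtain ⟨i, j, hadj⟩ := hij
  obtain ⟨hi, hj, hai, hbj, hor⟩ := id hadj
  obtain rfl : i = i₀ := by
    by_contra hne
    have := hA' i hi hne
    omega
  obtain rfl : j = j₀ := by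
    by_contra hne
    have := hB' j hj hne
    omega
  obtain ⟨p, q, hqp, eA⟩ := exists_eq_pair_le hai
  have hq : q ∈ A i := by simp [eA]
  have hp : p ∈ A i := by simp [eA]
  rw [Finset.mem_Icc] at hi hj
  have hA1 : ∀ k, 2 ≤ k → k ≤ s → k ≠ i → (A k).card = 1 := fun k h1 h2 h3 =>
    hA' k (Finset.mem_Icc.mpr ⟨h1, h2⟩) h3
  have hB1 : ∀ k, 1 ≤ k → k ≤ s → k ≠ j → (B k).card = 1 := fun k h1 h2 h3 =>
    hB' k (Finset.mem_Icc.mpr ⟨h1, h2⟩) h3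
  rcases hor with rfl | rfl
  · have hlow : ∀ k, 1 ≤ k → k ≤ i - 1 → depth A B k % 2 = depth A B 1 % 2 := fun k h1 h2 =>
      depth_mod le_rfl (v := i - 1) (fun k h3 h4 => by
        rw [hA1 (k + 1) (by omega) (by omega) (by omega), hB1 k h3 (by omega) (by omega)]) h1 h2
    have hd := depth_succ A B (j := i - 1) (by omega)
    rw [show i - 1 + 1 = i by omega, hai, hB1 (i - 1) (by omega) (by omega) (by omega)] at hd
    have hl := hlow (i - 1) (by omega) le_rfl
    have hhigh : ∀ k, i + 1 ≤ k → k ≤ s → depth A B k % 2 = depth A B 1 % 2 := by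
      intro k h1 h2
      have h3 := depth_succ A B (j := i) (by omega)
      rw [hbj, hA1 (i + 1) (by omega) (by omega) (by omega)] at h3
      have h4 : depth A B k % 2 = depth A B (i + 1) % 2 :=
        depth_mod (by omega) (v := s) (fun k h3 h4 => by
          rw [hA1 (k + 1) (by omega) (by omega) (by omega),
            hB1 k (by omega) (by omega) (by omega)]) h1 h2
      omega
    obtain ⟨x, y, hyx, e, hpar⟩ := h.parityCondition_max hnd hj₀ hbj (c := depth A B 1) (by omega)
      fun k hk hne => ⟨hB' k hk hne, by
        rw [Finset.mem_Icc] at hk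
        rcases Nat.lt_or_ge k i with hlt | hge
        · exact hlow k hk.1 (by omega)
        · exact hhigh k (by omega) hk.2⟩
    have hx : x ∈ B i := by simp [e]
    refine ⟨x, hpar, i, i, hadj, hx, y, x, q, p, hyx.le,
      (h.right_lt (by omega) le_rfl hi.2 hq hx).le, hqp, ?_, Or.inl rfl⟩
    rw [eA, e, Multiset.pair_comm x y, add_comm]
    rfl
  · have hd : ∀ k, 1 ≤ k → k ≤ s → depth A B k % 2 = depth A B 1 % 2 := fun k h1 h2 =>
      depth_mod le_rfl (v := s) (fun k h3 h4 => by
        rcases eq_or_ne k j with rfl | hne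
        · rw [hai, hbj]
        · rw [hA1 (k + 1) (by omega) (by omega) (by omega), hB1 k h3 (by omega) hne]) h1 h2
    obtain ⟨x, y, hyx, e, hpar⟩ := h.parityCondition_min hnd hj₀ hbj (c := depth A B 1)
      (hd j hj.1 hj.2) fun k hk hne => ⟨hB' k hk hne, by
        rw [Finset.mem_Icc] at hk
        exact hd k hk.1 hk.2⟩
    have hy : y ∈ B j := by simp [e]
    refine ⟨y, hpar, j + 1, j, hadj, hy, q, p, y, x, hqp,
      (h.left_lt hj.1 le_rfl (by omega) hp hy).le, hyx.le, ?_, Or.inr rfl⟩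
    rw [eA, e, Multiset.pair_comm x y]
    rfl

theorem IsTraceClusters.exists_max (h : IsTraceClusters Φ Ψ s A B)
    (hnd : (rootsOn Ψ).Nodup) {m : ℕ} (hs : 1 ≤ s)
    (hA : ∀ i ∈ Finset.Icc 2 s, (A i).card % 2 = 1)
    (hB : clusterType (Finset.Icc 1 s) B = ctype 0 m 1 0) (hb : (B 1).card = 2) :
    ∃ τ, ParityCondition (rootsOn Φ) (rootsOn Ψ) τ ∧ IsMaxOf (B 1) τ := by
  rw [ctype_double] at hB
  obtain ⟨j₀, hj₀, -, hB'⟩ := exists_of_clusterType hB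
  have h1s : 1 ∈ Finset.Icc 1 s := Finset.mem_Icc.mpr ⟨le_rfl, hs⟩
  obtain rfl : 1 = j₀ := by
    by_contra hne
    have := hB' 1 h1s hne
    omega
  have hd : ∀ k, 2 ≤ k → k ≤ s → depth A B k % 2 = (depth A B 1 + 1) % 2 := by
    intro k h1 h2
    have h3 : depth A B 2 = depth A B 1 + (A 2).card + (B 1).card := depth_succ A B le_rfl
    have h4 := hA 2 (Finset.mem_Icc.mpr ⟨le_rfl, by omega⟩)
    have h5 : depth A B k % 2 = depth A B 2 % 2 :=
      depth_mod (by omega) (v := s) (fun k h3 h4 => by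
        have h6 := hA (k + 1) (Finset.mem_Icc.mpr ⟨by omega, h4⟩)
        have h7 := hB' k (Finset.mem_Icc.mpr ⟨by omega, by omega⟩) (by omega)
        omega) h1 h2
    omega
  obtain ⟨x, y, hyx, e, hpar⟩ := h.parityCondition_max hnd h1s hb (c := depth A B 1 + 1) (by omega)
    fun k hk hne => ⟨hB' k hk hne, by
      rw [Finset.mem_Icc] at hk
      exact hd k (by omega) hk.2⟩
  refine ⟨x, hpar, by simp [e], fun b hb => ?_⟩
  simp only [e, Multiset.insert_eq_cons, Multiset.mem_cons, Multiset.mem_singleton] at hb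
  rcases hb with rfl | rfl
  · exact le_rfl
  · exact hyx.le

theorem IsTraceClusters.exists_min (h : IsTraceClusters Φ Ψ s A B)
    (hnd : (rootsOn Ψ).Nodup) {m : ℕ} (hs : 1 ≤ s)
    (hA : ∀ i ∈ Finset.Icc 2 s, (A i).card % 2 = 1)
    (hB : clusterType (Finset.Icc 1 s) B = ctype 0 m 1 0) (hb : (B s).card = 2) :
    ∃ τ, ParityCondition (rootsOn Φ) (rootsOn Ψ) τ ∧ IsMinOf (B s) τ := by
  rw [ctype_double] at hB
  obtain ⟨j₀, hj₀, -, hB'⟩ := exists_of_clusterType hB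
  have h1s : s ∈ Finset.Icc 1 s := Finset.mem_Icc.mpr ⟨hs, le_rfl⟩
  obtain rfl : s = j₀ := by
    by_contra hne
    have := hB' s h1s hne
    omega
  have hd : ∀ k, 1 ≤ k → k ≤ s → depth A B k % 2 = depth A B 1 % 2 := fun k h1 h2 =>
    depth_mod le_rfl (v := s) (fun k h3 h4 => by
      have h6 := hA (k + 1) (Finset.mem_Icc.mpr ⟨by omega, h4⟩)
      have h7 := hB' k (Finset.mem_Icc.mpr ⟨by omega, by omega⟩) (by omega)
      omega) h1 h2
  obtain ⟨x, y, hyx, e, hpar⟩ := h.parityCondition_min hnd h1s hb (c := depth A B 1)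
    (hd s hs le_rfl) fun k hk hne => ⟨hB' k hk hne, by
      rw [Finset.mem_Icc] at hk
      exact hd k hk.1 hk.2⟩
  refine ⟨y, hpar, by simp [e], fun b hb => ?_⟩
  simp only [e, Multiset.insert_eq_cons, Multiset.mem_cons, Multiset.mem_singleton] at hb
  rcases hb with rfl | rfl
  · exact hyx.le
  · exact le_rfl

theorem IsTraceClusters.exists_first (h : IsTraceClusters Φ Ψ s A B) {m m' : ℕ} (hs : 2 ≤ s)
    (hA : clusterType (Finset.Icc 2 s) A = ctype 0 m' 1 0)
    (hB : clusterType (Finset.Icc 1 s) B = ctype 0 m 0 0) (ha : (A 2).card = 2) :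
    ∃ τ, ParityCondition (rootsOn Φ) (rootsOn Ψ) τ ∧ τ ∈ B 1 := by
  rw [ctype_double] at hA
  rw [ctype_ones] at hB
  obtain ⟨i₀, hi₀, -, hA'⟩ := exists_of_clusterType hA
  have hB' := card_eq_one_of_clusterType hB
  have h1s : 1 ∈ Finset.Icc 1 s := Finset.mem_Icc.mpr ⟨le_rfl, by omega⟩
  obtain rfl : 2 = i₀ := by
    by_contra hne
    have := hA' 2 (Finset.mem_Icc.mpr ⟨le_rfl, hs⟩) hne
    omega
  have hd : ∀ k, 2 ≤ k → k ≤ s → depth A B k % 2 = (depth A B 1 + 1) % 2 := by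
    intro k h1 h2
    have h3 : depth A B 2 = depth A B 1 + (A 2).card + (B 1).card := depth_succ A B le_rfl
    have h4 := hB' 1 h1s
    have h5 : depth A B k % 2 = depth A B 2 % 2 :=
      depth_mod (by omega) (v := s) (fun k h3 h4 => by
        rw [hA' (k + 1) (Finset.mem_Icc.mpr ⟨by omega, h4⟩) (by omega),
          hB' k (Finset.mem_Icc.mpr ⟨by omega, by omega⟩)]) h1 h2
    omega
  obtain ⟨x, hx, hpar⟩ := h.parityCondition_singleton h1s (hB' 1 h1s) (c := depth A B 1 + 1)
    (by omega) fun k hk hne => ⟨hB' k hk, by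
      rw [Finset.mem_Icc] at hk
      exact hd k (by omega) hk.2⟩
  exact ⟨x, hpar, hx⟩

theorem IsTraceClusters.exists_last (h : IsTraceClusters Φ Ψ s A B) {m m' : ℕ} (hs : 2 ≤ s)
    (hA : clusterType (Finset.Icc 2 s) A = ctype 0 m' 1 0)
    (hB : clusterType (Finset.Icc 1 s) B = ctype 0 m 0 0) (ha : (A s).card = 2) :
    ∃ τ, ParityCondition (rootsOn Φ) (rootsOn Ψ) τ ∧ τ ∈ B s := by
  rw [ctype_double] at hA
  rw [ctype_ones] at hB
  obtain ⟨i₀, hi₀, -, hA'⟩ := exists_of_clusterType hA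
  have hB' := card_eq_one_of_clusterType hB
  have h1s : s ∈ Finset.Icc 1 s := Finset.mem_Icc.mpr ⟨by omega, le_rfl⟩
  obtain rfl : s = i₀ := by
    by_contra hne
    have := hA' s (Finset.mem_Icc.mpr ⟨hs, le_rfl⟩) hne
    omega
  have hd : ∀ k, 1 ≤ k → k ≤ s - 1 → depth A B k % 2 = depth A B 1 % 2 := fun k h1 h2 =>
    depth_mod le_rfl (v := s - 1) (fun k h3 h4 => by
      rw [hA' (k + 1) (Finset.mem_Icc.mpr ⟨by omega, by omega⟩) (by omega),
        hB' k (Finset.mem_Icc.mpr ⟨by omega, by omega⟩)]) h1 h2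
  have hds := depth_succ A B (j := s - 1) (by omega)
  rw [show s - 1 + 1 = s by omega, ha,
    hB' (s - 1) (Finset.mem_Icc.mpr ⟨by omega, by omega⟩)] at hds
  have hds' := hd (s - 1) (by omega) le_rfl
  obtain ⟨x, hx, hpar⟩ := h.parityCondition_singleton h1s (hB' s h1s) (c := depth A B 1)
    (by omega) fun k hk hne => ⟨hB' k hk, by
      rw [Finset.mem_Icc] at hk
      exact hd k hk.1 (by omega)⟩
  exact ⟨x, hpar, hx⟩

/-- In every row of the table the parity condition holds at the element with the location
stated there. -/
theorem IsTraceClusters.exists_hasLocation (h : IsTraceClusters Φ Ψ s A B)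
    (hnd : (rootsOn Ψ).Nodup) {k : ℕ} (hk : InCase Ψ s A B k) :
    ∃ τ, ParityCondition (rootsOn Φ) (rootsOn Ψ) τ ∧ HasLocation s A B k τ := by
  match k, hk with
  | 1, hk =>
    obtain ⟨rfl, hA, hB, _⟩ := hk
    exact h.exists_triple hnd (odd_card_of_clusterType (Or.inl (hA.trans (ctype_ones 7)))) hB
  | 2, hk =>
    obtain ⟨rfl, hA, hB, _⟩ := hk
    exact h.exists_triple hnd (odd_card_of_clusterType (Or.inr (hA.trans (ctype_triple 6)))) hB
  | 3, hk =>
    obtain ⟨⟨rfl, hA, hB, _⟩, hij⟩ := hk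
    exact h.exists_inner hnd hA hB hij
  | 4, hk =>
    obtain ⟨⟨rfl, hA, hB, _⟩, hb⟩ := hk
    exact h.exists_max hnd (by omega)
      (odd_card_of_clusterType (Or.inl (hA.trans (ctype_ones 8)))) hB hb
  | 5, hk =>
    obtain ⟨⟨rfl, hA, hB, _⟩, hb⟩ := hk
    exact h.exists_min hnd (by omega)
      (odd_card_of_clusterType (Or.inl (hA.trans (ctype_ones 8)))) hB hb
  | 6, hk =>
    obtain ⟨⟨rfl, hA, hB, _⟩, hb⟩ := hk
    exact h.exists_max hnd (by omega)
      (odd_card_of_clusterType (Or.inr (hA.trans (ctype_triple 7)))) hB hb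
  | 7, hk =>
    obtain ⟨⟨rfl, hA, hB, _⟩, hb⟩ := hk
    exact h.exists_min hnd (by omega)
      (odd_card_of_clusterType (Or.inr (hA.trans (ctype_triple 7)))) hB hb
  | 8, hk =>
    obtain ⟨⟨rfl, hA, hB, _⟩, ha⟩ := hk
    exact h.exists_first (by omega) hA hB ha
  | 9, hk =>
    obtain ⟨⟨rfl, hA, hB, _⟩, ha⟩ := hk
    exact h.exists_last (by omega) hA hB ha

/-- In every row of the table `Ψ` has `10` trace roots on `[-2, 2]` and one beyond `2`, and at
least seven inner `A`-clusters have odd size. -/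
theorem IsTraceClusters.card_of_inCase (h : IsTraceClusters Φ Ψ s A B) {k : ℕ}
    (hk : InCase Ψ s A B k) : (rootsOn Ψ).card = 10 ∧ (rootsGtTwo Ψ).card = 1 ∧
      7 ≤ ((Finset.Icc 2 s).filter fun i => (A i).card % 2 = 1).card := by
  have hcard : ((Finset.Icc 2 s).filter fun i => (A i).card % 2 = 1).card =
      (clusterType (Finset.Icc 2 s) A).countP fun n => n % 2 = 1 := by
    rw [clusterType, Multiset.countP_map]
    rfl
  rw [h.card_right, hcard]
  match k, hk with
  | 1, hk =>
    obtain ⟨rfl, hA, hB, _, hc⟩ := hk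
    rw [hA, hB]
    exact ⟨by decide, hc, by decide⟩
  | 2, hk =>
    obtain ⟨rfl, hA, hB, _, hc⟩ := hk
    rw [hA, hB]
    exact ⟨by decide, hc, by decide⟩
  | 3, hk =>
    obtain ⟨⟨rfl, hA, hB, _, hc⟩, _⟩ := hk
    rw [hA, hB]
    exact ⟨by decide, hc, by decide⟩
  | 4, hk =>
    obtain ⟨⟨rfl, hA, hB, _, hc⟩, _⟩ := hk
    rw [hA, hB]
    exact ⟨by decide, hc, by decide⟩
  | 5, hk =>
    obtain ⟨⟨rfl, hA, hB, _, hc⟩, _⟩ := hk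
    rw [hA, hB]
    exact ⟨by decide, hc, by decide⟩
  | 6, hk =>
    obtain ⟨⟨rfl, hA, hB, _, hc⟩, _⟩ := hk
    rw [hA, hB]
    exact ⟨by decide, hc, by decide⟩
  | 7, hk =>
    obtain ⟨⟨rfl, hA, hB, _, hc⟩, _⟩ := hk
    rw [hA, hB]
    exact ⟨by decide, hc, by decide⟩
  | 8, hk =>
    obtain ⟨⟨rfl, hA, hB, _, hc⟩, _⟩ := hk
    rw [hA, hB]
    exact ⟨by decide, hc, by decide⟩
  | 9, hk =>
    obtain ⟨⟨rfl, hA, hB, _, hc⟩, _⟩ := hk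
    rw [hA, hB]
    exact ⟨by decide, hc, by decide⟩

end Locations

/-! ### Existence of clusters and multiplicities of roots -/

section Existence

theorem sum_filter_eq {I : Finset ℕ} {M : Multiset ℝ} {γ : ℝ → ℕ} (h : ∀ x ∈ M, γ x ∈ I) :
    ∑ i ∈ I, M.filter (fun x => γ x = i) = M := by
  induction M using Multiset.induction with
  | empty => simp
  | cons a M ih =>
    have h1 := ih fun x hx => h x (Multiset.mem_cons_of_mem hx)
    have h2 := h a (Multiset.mem_cons_self a M)
    simp only [Multiset.filter_cons, Finset.sum_add_distrib, h1, Finset.sum_ite_eq, h2, if_true]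
    rfl

/-- Trace clusters exist as soon as the two multisets of roots are disjoint: a cut is made below
every element of `rootsOn Ψ` that is separated from all smaller ones by `rootsOn Φ`. -/
theorem exists_isTraceClusters {Φ Ψ : ℤ[X]} (hdis : ∀ t ∈ rootsOn Φ, t ∉ rootsOn Ψ)
    (hne : rootsOn Ψ ≠ 0) : ∃ s A B, IsTraceClusters Φ Ψ s A B := by
  classical
  set R := rootsOn Φ
  set S := rootsOn Ψ
  let T : Finset ℝ := S.toFinset.filter fun b => ∀ b' ∈ S, b' < b → ∃ a ∈ R, b' < a ∧ a < b
  have hT : ∀ b, b ∈ T ↔ b ∈ S ∧ ∀ b' ∈ S, b' < b → ∃ a ∈ R, b' < a ∧ a < b := fun b => by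
    simp [T]
  let γ : ℝ → ℕ := fun x => above T.val x + 1
  have hmin : ∃ t ∈ T, ∀ b ∈ S, t ≤ b := by
    obtain ⟨b₀, hb₀⟩ := Multiset.exists_mem_of_ne_zero hne
    obtain ⟨t, ht, hle⟩ := S.toFinset.exists_min_image id ⟨b₀, by simpa using hb₀⟩
    simp only [Multiset.mem_toFinset, id] at ht hle
    exact ⟨t, (hT t).mpr ⟨ht, fun b' hb' hlt => absurd (hle b' hb') (not_le.mpr hlt)⟩, hle⟩
  refine ⟨T.card, fun i => R.filter fun x => γ x = i, fun i => S.filter fun x => γ x = i, ?_, ?_,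
    ?_, ?_, ?_, ?_⟩
  · refine sum_filter_eq fun x _ => Finset.mem_Icc.mpr ⟨by simp [γ], ?_⟩
    exact Nat.succ_le_succ (Multiset.card_le_card (Multiset.filter_le _ _))
  · refine sum_filter_eq fun x hx => Finset.mem_Icc.mpr ⟨by simp [γ], ?_⟩
    obtain ⟨t, ht, hle⟩ := hmin
    exact (Nat.succ_le_succ (above_antitone T.val (hle x hx))).trans
      (above_lt_card (K := T.val) ht)
  · intro i hi
    obtain ⟨h1, h2⟩ := Finset.mem_Icc.mp hi
    obtain ⟨t, ht, hti⟩ := exists_above_eq T.nodup (k := i - 2)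
      (show i - 2 < T.card by omega)
    obtain ⟨t', ht', hti'⟩ := exists_above_eq T.nodup (k := i - 1)
      (show i - 1 < T.card by omega)
    have hlt : t' < t := lt_of_above_lt (K := T.val) (by omega)
    have hS' : t' ∈ S := ((hT t').mp ht').1
    -- the next element of `S` below `t`
    obtain ⟨b, hb, hmax⟩ := (S.toFinset.filter fun b => b < t).exists_max_image id
      ⟨t', by simp [hS', hlt]⟩
    simp only [Finset.mem_filter, Multiset.mem_toFinset, id, and_imp] at hb hmax
    obtain ⟨a, ha, hba, hat⟩ := ((hT t).mp ht).2 b hb.1 hb.2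
    have h3 := above_lt_above (K := T.val) hat ht
    have h4 := above_antitone T.val ((hmax t' hS' hlt).trans hba.le)
    refine Multiset.card_pos.mp (Multiset.card_pos_iff_exists_mem.mpr
      ⟨a, Multiset.mem_filter.mpr ⟨ha, ?_⟩⟩)
    simp only [γ]
    omega
  · intro i hi
    obtain ⟨h1, h2⟩ := Finset.mem_Icc.mp hi
    obtain ⟨t, ht, hti⟩ := exists_above_eq T.nodup (k := i - 1)
      (show i - 1 < T.card by omega)
    refine Multiset.card_pos.mp (Multiset.card_pos_iff_exists_mem.mpr
      ⟨t, Multiset.mem_filter.mpr ⟨((hT t).mp ht).1, ?_⟩⟩)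
    simp only [γ]
    omega
  · intro i _ b hb a ha
    rw [Multiset.mem_filter] at ha hb
    by_contra hle
    have hlt : a < b := lt_of_le_of_ne (not_lt.mp hle) fun h => hdis a ha.1 (h ▸ hb.1)
    obtain ⟨t, ht, hmin⟩ := (S.toFinset.filter fun b => a < b).exists_min_image id
      ⟨b, by simp [hb.1, hlt]⟩
    simp only [Finset.mem_filter, Multiset.mem_toFinset, id, and_imp] at ht hmin
    have htT : t ∈ T := (hT t).mpr ⟨ht.1, fun b' hb' hlt' => ⟨a, ha.1, ?_, ht.2⟩⟩
    · have h1 := above_lt_above (K := T.val) ht.2 htT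
      have h2 := above_antitone T.val (hmin b hb.1 hlt)
      have h3 := ha.2.trans hb.2.symm
      simp only [γ] at h3
      omega
    · refine lt_of_le_of_ne (not_lt.mp fun h => ?_) fun h => hdis a ha.1 (h ▸ hb')
      exact absurd (hmin b' hb' h) (not_le.mpr hlt')
  · intro i _ a ha b hb
    rw [Multiset.mem_filter] at ha hb
    by_contra hle
    have h1 := above_antitone T.val (not_lt.mp hle)
    have h2 := ha.2
    have h3 := hb.2
    simp only [γ] at h2 h3
    omega

end Existence

section Multiplicities

theorem exists_odd_count {K : Multiset ℝ} (h : K.card % 2 = 1) : ∃ x ∈ K, K.count x % 2 = 1 := by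
  classical
  by_contra! hall
  have h1 : 2 ∣ K.card := by
    rw [← Multiset.toFinset_sum_count_eq]
    refine Finset.dvd_sum fun x hx => ?_
    have := hall x (Multiset.mem_toFinset.mp hx)
    omega
  omega

/-- An element of an inner cluster belongs to no other one, so its multiplicity is counted there. -/
theorem IsTraceClusters.count_left {Φ Ψ : ℤ[X]} {s : ℕ} {A B : ℕ → Multiset ℝ}
    (h : IsTraceClusters Φ Ψ s A B) {i : ℕ} (hi : i ∈ Finset.Icc 2 s) {x : ℝ} (hx : x ∈ A i) :
    (rootsOn Φ).count x = (A i).count x ∧ ∀ j ∈ Finset.Icc 1 (s + 1), x ∈ A j → j = i := by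
  have hd : ∀ j ∈ Finset.Icc 1 (s + 1), x ∈ A j → j = i := by
    intro j hj hxj
    rw [Finset.mem_Icc] at hi hj
    by_contra hne
    rcases lt_or_gt_of_ne hne with hlt | hgt
    · obtain ⟨b, hb⟩ := Multiset.exists_mem_of_ne_zero
        (h.right_ne (i - 1) (Finset.mem_Icc.mpr ⟨by omega, by omega⟩))
      have h1 := h.left_lt (i := i) (by omega) (by omega) (by omega) hx hb
      have h2 := h.right_lt (j := i - 1) hj.1 (by omega) (by omega) hxj hb
      exact absurd (h1.trans h2) (lt_irrefl _)
    · obtain ⟨b, hb⟩ := Multiset.exists_mem_of_ne_zero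
        (h.right_ne i (Finset.mem_Icc.mpr ⟨by omega, by omega⟩))
      have h1 := h.left_lt (i := j) (by omega) (by omega) (by omega) hxj hb
      have h2 := h.right_lt (j := i) (by omega) le_rfl (by omega) hx hb
      exact absurd (h1.trans h2) (lt_irrefl _)
  refine ⟨?_, hd⟩
  rw [← h.sum_left, Multiset.count_sum']
  refine Finset.sum_eq_single i (fun j hj hne => ?_) fun hi' => ?_
  · exact Multiset.count_eq_zero_of_notMem fun hxj => hne (hd j hj hxj)
  · rw [Finset.mem_Icc] at hi hi'
    omega

theorem count_rootsOn {P : ℤ[X]} {x : ℝ} (h1 : -2 ≤ x) (h2 : x ≤ 2) :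
    (rootsOn P).count x = (complexRoots P).count (x : ℂ) := by
  have e : P.map (Int.castRingHom ℂ) = (P.map (Int.castRingHom ℝ)).map (algebraMap ℝ ℂ) := by
    rw [Polynomial.map_map]
    congr 1
  rw [rootsOn, Multiset.count_filter_of_pos ⟨h1, h2⟩, complexRoots, count_roots, count_roots, e]
  exact eq_rootMultiplicity_map (algebraMap ℝ ℂ).injective x

/-- The odd inner `A`-clusters produce at least seven roots of odd multiplicity. -/
theorem IsTraceClusters.exists_odd_roots {Φ Ψ : ℤ[X]} {s : ℕ} {A B : ℕ → Multiset ℝ}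
    (h : IsTraceClusters Φ Ψ s A B)
    (h7 : 7 ≤ ((Finset.Icc 2 s).filter fun i => (A i).card % 2 = 1).card) :
    ∃ O : Finset ℂ, 7 ≤ O.card ∧ ∀ z ∈ O, (complexRoots Φ).count z % 2 = 1 := by
  classical
  have key : ∀ i ∈ (Finset.Icc 2 s).filter (fun i => (A i).card % 2 = 1),
      ∃ x ∈ A i, (A i).count x % 2 = 1 := fun i hi =>
    exists_odd_count (Finset.mem_filter.mp hi).2
  choose! f hf hodd using key
  refine ⟨((Finset.Icc 2 s).filter fun i => (A i).card % 2 = 1).image fun i => (f i : ℂ), ?_, ?_⟩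
  · rwa [Finset.card_image_of_injOn]
    intro i hi j hj hij
    have hi' := hf i hi
    have hj' := hf j hj
    have e : f i = f j := Complex.ofReal_injective hij
    have hm := Finset.mem_Icc.mp (Finset.mem_filter.mp hi).1
    exact (h.count_left (Finset.mem_filter.mp hj).1 hj').2 i
      (Finset.mem_Icc.mpr ⟨by omega, by omega⟩) (e ▸ hi')
  · intro z hz
    obtain ⟨i, hi, rfl⟩ := Finset.mem_image.mp hz
    have hm := (Finset.mem_filter.mp hi).1
    have hr : f i ∈ rootsOn Φ := by
      rw [← h.sum_left, Multiset.mem_sum]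
      have := Finset.mem_Icc.mp hm
      exact ⟨i, Finset.mem_Icc.mpr ⟨by omega, by omega⟩, hf i hi⟩
    have hb := (Multiset.mem_filter.mp hr).2
    rw [← count_rootsOn hb.1 hb.2, (h.count_left hm (hf i hi)).1]
    exact hodd i hi

theorem sum_count_le_card {M : Multiset ℂ} (N : Finset ℂ) : ∑ z ∈ N, M.count z ≤ M.card := by
  classical
  rw [← Multiset.toFinset_sum_count_eq]
  calc ∑ z ∈ N, M.count z ≤ ∑ z ∈ N ∪ M.toFinset, M.count z :=
        Finset.sum_le_sum_of_subset Finset.subset_union_left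
    _ = ∑ z ∈ M.toFinset, M.count z := by
        refine (Finset.sum_subset Finset.subset_union_right fun z _ hz => ?_).symm
        exact Multiset.count_eq_zero_of_notMem fun h => hz (Multiset.mem_toFinset.mpr h)

/-- Among ten roots, at least seven of which have odd multiplicity, there is room for one multiple
root only, of multiplicity at most three. -/
theorem count_unique_of_odd {M : Multiset ℂ} (hM : M.card ≤ 10) {O : Finset ℂ}
    (hO : 7 ≤ O.card) (hodd : ∀ z ∈ O, M.count z % 2 = 1) {α : ℂ} (hα : 2 ≤ M.count α) :
    M.count α ≤ 3 ∧ ∀ β, β ≠ α → M.count β ≤ 1 := by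
  classical
  constructor
  · have h1 := sum_count_le_card (M := M) (insert α O)
    by_cases hαO : α ∈ O
    · rw [Finset.insert_eq_of_mem hαO, ← Finset.add_sum_erase _ _ hαO] at h1
      have h2 := card_le_sum (I := O.erase α) (f := fun z => M.count z) fun z hz => by
        have := hodd z (Finset.mem_of_mem_erase hz)
        omega
      rw [Finset.card_erase_of_mem hαO] at h2
      have := hodd α hαO
      omega
    · rw [Finset.sum_insert hαO] at h1
      have h2 := card_le_sum (I := O) (f := fun z => M.count z) fun z hz => by
        have := hodd z hz
        omega
      omega
  · intro β hne
    by_contra! hβ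
    -- a root of odd multiplicity at least `2` has multiplicity at least `3`
    have h1 := sum_count_le_card (M := M) (O ∪ {α, β})
    have h2 : ∑ z ∈ O ∪ {α, β}, ((if z ∈ O then 1 else 0) + ((if z = α then 2 else 0) +
        (if z = β then 2 else 0))) ≤ ∑ z ∈ O ∪ {α, β}, M.count z := by
      refine Finset.sum_le_sum fun z _ => ?_
      rcases eq_or_ne z α with rfl | hzα
      · rw [if_pos rfl, if_neg hne.symm]
        split_ifs with hz
        · have := hodd z hz
          omega
        · omega
      rcases eq_or_ne z β with rfl | hzβ
      · rw [if_pos rfl, if_neg hne]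
        split_ifs with hz
        · have := hodd z hz
          omega
        · omega
      rw [if_neg hzα, if_neg hzβ]
      split_ifs with hz
      · have := hodd z hz
        omega
      · omega
    rw [Finset.sum_add_distrib, Finset.sum_add_distrib, Finset.sum_ite_eq', Finset.sum_ite_eq',
      if_pos (by simp), if_pos (by simp), ← Finset.sum_filter,
      Finset.filter_mem_eq_inter, Finset.inter_eq_right.mpr Finset.subset_union_left] at h2
    simp only [Finset.sum_const, smul_eq_mul, mul_one] at h2
    omega

theorem two_le_count_iff {P : ℤ[X]} (hP : P.Monic) {z : ℂ} :
    2 ≤ (complexRoots P).count z ↔ aeval z P = 0 ∧ aeval z (derivative P) = 0 := by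
  have e : ∀ Q : ℤ[X], (Q.map (Int.castRingHom ℂ)).eval z = aeval z Q := fun Q => by
    rw [eval_map, ← algebraMap_int_eq, ← aeval_def]
  rw [complexRoots, count_roots, Nat.succ_le_iff,
    one_lt_rootMultiplicity_iff_isRoot (hP.map _).ne_zero, derivative_map, IsRoot, IsRoot, e, e]

/-- A multiple root of a monic integer polynomial is an integer if it is the only one: its
conjugates over `ℚ` are multiple roots as well. -/
theorem exists_int_of_unique_multiple_root {P : ℤ[X]} (hP : P.Monic) {α : ℂ}
    (hα : aeval α P = 0 ∧ aeval α (derivative P) = 0)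
    (h : ∀ β : ℂ, aeval β P = 0 → aeval β (derivative P) = 0 → β = α) : ∃ m : ℤ, α = m := by
  have e : ∀ (Q : ℤ[X]) (z : ℂ), aeval z (Q.map (Int.castRingHom ℚ)) = aeval z Q := fun Q z => by
    rw [← algebraMap_int_eq, aeval_map_algebraMap]
  have hint : IsIntegral ℤ α := ⟨P, hP, hα.1⟩
  have hintQ : IsIntegral ℚ α := hint.tower_top
  have hd1 : minpoly ℚ α ∣ P.map (Int.castRingHom ℚ) := minpoly.dvd _ _ (by rw [e]; exact hα.1)
  have hd2 : minpoly ℚ α ∣ (derivative P).map (Int.castRingHom ℚ) :=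
    minpoly.dvd _ _ (by rw [e]; exact hα.2)
  have hroots : (minpoly ℚ α).rootSet ℂ = {α} := by
    ext β
    rw [mem_rootSet, Set.mem_singleton_iff]
    constructor
    · rintro ⟨-, hβ⟩
      refine h β ?_ ?_
      · rw [← e]
        exact aeval_eq_zero_of_dvd_aeval_eq_zero hd1 hβ
      · rw [← e]
        exact aeval_eq_zero_of_dvd_aeval_eq_zero hd2 hβ
    · rintro rfl
      exact ⟨minpoly.ne_zero hintQ, minpoly.aeval _ _⟩
  have hdeg : (minpoly ℚ α).natDegree = 1 := by
    rw [← card_rootSet_eq_natDegree (K := ℂ) (minpoly.irreducible hintQ).separable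
      (IsAlgClosed.splits _)]
    simp [hroots]
  obtain ⟨q, hq⟩ := minpoly.natDegree_eq_one_iff.mp hdeg
  have hq' : IsIntegral ℤ q := by
    rw [← hq] at hint
    exact (isIntegral_algebraMap_iff (algebraMap ℚ ℂ).injective).mp hint
  obtain ⟨m, rfl⟩ := IsIntegrallyClosed.isIntegral_iff.mp hq'
  exact ⟨m, by rw [← hq]; simp⟩

theorem IsTraceClusters.simpleExceptOneInteger {Φ Ψ : ℤ[X]} {s : ℕ} {A B : ℕ → Multiset ℝ}
    (h : IsTraceClusters Φ Ψ s A B) {k : ℕ} (hk : InCase Ψ s A B k) (hΦ : Φ.Monic)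
    (hd : Φ.natDegree = 10) : SimpleExceptOneInteger Φ := by
  classical
  obtain ⟨O, hO, hodd⟩ := h.exists_odd_roots (h.card_of_inCase hk).2.2
  have hM : (complexRoots Φ).card ≤ 10 := by
    rw [complexRoots]
    refine (card_roots' _).trans ?_
    rw [hΦ.natDegree_map, hd]
  by_cases hnd : (complexRoots Φ).Nodup
  · exact Or.inl hnd
  right
  rw [Multiset.nodup_iff_count_le_one] at hnd
  push Not at hnd
  obtain ⟨α, hα⟩ := hnd
  obtain ⟨h3, huniq⟩ := count_unique_of_odd hM hO hodd hα
  obtain ⟨m, rfl⟩ := exists_int_of_unique_multiple_root hΦ ((two_le_count_iff hΦ).mp hα)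
    fun β h1 h2 => by
      by_contra hne
      have := (two_le_count_iff hΦ).mpr ⟨h1, h2⟩
      have := huniq β hne
      omega
  refine ⟨m, by omega, fun z hz hne => ?_⟩
  have h1 := huniq z hne
  have h2 := Multiset.one_le_count_iff_mem.mpr hz
  omega

end Multiplicities

/-! ### The spectral condition in terms of clusters -/

section Main

variable {Φ Ψ : ℤ[X]} (hΦ : Φ.Monic) (hΨ : Ψ.Monic) (hdΦ : Φ.natDegree = 10)
  (hd : Ψ.natDegree = 11) (hco : ∀ t : ℝ, aeval t Ψ = 0 → aeval t Φ ≠ 0)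
include hΦ hΨ hd hco

/-- The root `τ` has the location of the table, for any choice of clusters, since it is the only
root satisfying the parity condition. -/
theorem SpectralCondition.hasLocation {ε τ : ℝ} (h : SpectralCondition Φ Ψ ε τ) {s : ℕ}
    {A B : ℕ → Multiset ℝ} {k : ℕ} (hc : IsTraceClusters Φ Ψ s A B) (hk : InCase Ψ s A B k) :
    HasLocation s A B k τ := by
  obtain ⟨hnd, -, -, -, hon, hpar⟩ := h.combinatorial hΦ hΨ hd hco
  have hnd' := nodup_rootsOn hΨ hnd
  obtain ⟨τ', hpar', hloc⟩ := hc.exists_hasLocation hnd' hk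
  rwa [hpar.unique hpar' hnd' (by omega)]

include hdΦ

/-- The spectral condition, read off from the trace clusters. -/
theorem exists_spectralCondition_iff :
    (∃ ε τ : ℝ, (ε = 1 ∨ ε = -1) ∧ SpectralCondition Φ Ψ ε τ) ↔
      (complexRoots Ψ).Nodup ∧ Ψ.eval 2 ≠ 0 ∧ Ψ.eval (-2) ≠ 0 ∧
        ∃ (s : ℕ) (A B : ℕ → Multiset ℝ) (k : ℕ),
          IsTraceClusters Φ Ψ s A B ∧ InCase Ψ s A B k := by
  have e : ∀ m : ℤ, aeval (m : ℝ) Ψ = ((Ψ.eval m : ℤ) : ℝ) := fun m => by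
    rw [← eq_intCast (algebraMap ℤ ℝ) m, aeval_algebraMap_apply, coe_aeval_eq_eval]
    simp
  have e2 : aeval (2 : ℝ) Ψ ≠ 0 ↔ Ψ.eval 2 ≠ 0 := by
    have := e 2
    push_cast at this
    rw [this, Int.cast_ne_zero]
  have e2' : aeval (-2 : ℝ) Ψ ≠ 0 ↔ Ψ.eval (-2) ≠ 0 := by
    have := e (-2)
    push_cast at this
    rw [this, Int.cast_ne_zero]
  rw [← e2, ← e2']
  constructor
  · rintro ⟨ε, τ, hε, h⟩
    obtain ⟨hnd, h2, h2', hgt, hon, hpar⟩ := h.combinatorial hΦ hΨ hd hco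
    refine ⟨hnd, h2, h2', ?_⟩
    have hR : (rootsOn Φ).card ≤ 10 := by
      refine (Multiset.card_le_card (Multiset.filter_le _ _)).trans ((card_roots' _).trans ?_)
      rw [hΦ.natDegree_map, hdΦ]
    obtain ⟨s, A, B, hc⟩ := exists_isTraceClusters (Φ := Φ) (Ψ := Ψ)
      (fun t ht ht' => hco t ((mem_rootsOn hΨ).mp ht').1 ((mem_rootsOn hΦ).mp ht).1)
      (fun h0 => by simp [h0] at hon)
    obtain ⟨k, hk⟩ := hc.exists_inCase (nodup_rootsOn hΨ hnd) hon hR hgt hpar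
    exact ⟨s, A, B, k, hc, hk⟩
  · rintro ⟨hnd, h2, h2', s, A, B, k, hc, hk⟩
    obtain ⟨hon, hgt, -⟩ := hc.card_of_inCase hk
    obtain ⟨τ, hpar, -⟩ := hc.exists_hasLocation (nodup_rootsOn hΨ hnd) hk
    obtain ⟨ε, hε, h⟩ := spectralCondition_of_parity hΦ hΨ hd hco hnd h2 h2' hgt hon hpar
    exact ⟨ε, τ, hε, h⟩

end Main

end HypergeometricK3

open HypergeometricK3 in
theorem theorem1p3 (φ ψ : ℤ[X]) (hpair : IsHypergeometricPair 11 φ ψ)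
    (r : Fin 22 → ℚ) (hr : IsReflectionVector 22 φ ψ r)
    (hunimod : IsUnimodular (lattice 22 φ r) (invariantForm 22 φ ψ r)) :
    (IsPositiveHodgeIsometryB φ ψ r ↔
      (complexRoots (tracePolynomial 11 ψ)).Nodup ∧
        (tracePolynomial 11 ψ).eval 2 ≠ 0 ∧ (tracePolynomial 11 ψ).eval (-2) ≠ 0 ∧
        ∃ (s : ℕ) (A B : ℕ → Multiset ℝ) (k : ℕ),
          IsTraceClusters (antiTracePolynomial 11 φ) (tracePolynomial 11 ψ) s A B ∧
          InCase (tracePolynomial 11 ψ) s A B k) ∧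
    (IsPositiveHodgeIsometryB φ ψ r →
      (∃ τ : ℝ,
        (∀ h : HodgeStructure (intersectionForm φ ψ r),
          IsHodgeIsometry (lattice 22 φ r) h (companion 22 ψ) →
            ∀ τ' : ℝ, IsSpecialTrace h (companion 22 ψ) τ' ↔ τ' = τ) ∧
        (∀ (s : ℕ) (A B : ℕ → Multiset ℝ) (k : ℕ),
          IsTraceClusters (antiTracePolynomial 11 φ) (tracePolynomial 11 ψ) s A B →
          InCase (tracePolynomial 11 ψ) s A B k → HasLocation s A B k τ)) ∧
      (∀ h h' : HodgeStructure (intersectionForm φ ψ r),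
        IsHodgeIsometry (lattice 22 φ r) h (companion 22 ψ) →
        IsHodgeIsometry (lattice 22 φ r) h' (companion 22 ψ) → h.EqUpToConj h') ∧
      IsHyperbolic (companion 22 ψ) ∧
      SimpleExceptOneInteger (antiTracePolynomial 11 φ)) := by
  obtain ⟨hdΦ, hΦ⟩ := hpair.left_monic (by norm_num)
  obtain ⟨hdΨ, hΨ⟩ := hpair.right_monic
  have hco : ∀ t : ℝ, aeval t (tracePolynomial 11 ψ) = 0 →
      aeval t (antiTracePolynomial 11 φ) ≠ 0 := fun t ht h0 =>
    hpair.trace_left_ne_zero (by norm_num) (aeval_ofReal_eq_zero.mpr ht)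
      (aeval_ofReal_eq_zero.mpr h0)
  have hiff := isPositiveHodgeIsometryB_iff hpair hr hunimod
  have hclusters := exists_spectralCondition_iff hΦ hΨ hdΦ hdΨ hco
  refine ⟨hiff.trans hclusters, fun h => ?_⟩
  obtain ⟨ε, τ, hε, hτ⟩ := hiff.mp h
  obtain ⟨htrace, huniq, hhyp⟩ := SpectralCondition.geometric hpair hr hε hτ
  obtain ⟨-, -, -, s, A, B, k, hc, hk⟩ := hclusters.mp ⟨ε, τ, hε, hτ⟩
  exact ⟨⟨τ, htrace, fun s A B k hc hk => hτ.hasLocation hΦ hΨ hdΨ hco hc hk⟩, huniq, hhyp,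
    hc.simpleExceptOneInteger hk hΦ hdΦ⟩
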